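/- All graphs are finite, simple, undirected and connected. For a graph $G=(V,E)$ and $S\subseteq V$, the \emph{cutset} $\delta(S)$ of the cut $(S,V\setminus S)$ is the set of edges between $S$ and $V\setminus S$, and the size of the cut is $|\delta(S)|$. A cut is \emph{minimal} if no non-empty cutset of $G$ is properly contained in its cutset (for connected $G$ and $\delta(S)\neq\emptyset$: if both $G[S]$ and $G[V\setminus S]$ are connected). \textsc{Maximum Minimal Cut} asks, given $G$ and an integer $k\ge 0$, whether $G$ has a minimal cut of size at least $k$; \textsc{Maximum Minimal $s$-$t$ Cut} asks, given in addition $s,t\in V$, whether $G$ has a minimal cut $(S,V\setminus S)$ of size at least $k$ with $s\in S$ and $t\in V\setminus S$. In both problems the input also contains a tree decomposition of $G$, that is, a tree $T$ with node set $I$ and bags $X_i\subseteq V$ $(i\in I)$ such that every vertex is in a bag, every edge is contained in a bag, and $X_i\cap X_k\subseteq X_j$ whenever $j$ lies on the path between $i$ and $k$ in $T$; its width is ${\rm tw}=\max_{i\in I}|X_i|-1$. \textbf{Theorem.} For each of the two problems \textsc{Maximum Minimal Cut} and \textsc{Maximum Minimal $s$-$t$ Cut} there are a randomized algorithm and constants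 $C,d\in\mathbb{N}$ such that on every input $x$ of size $|x|$ with a tree decomposition of width ${\rm tw}$: \begin{itemize} \item for every outcome of its coin tosses, the algorithm halts after at most $C\cdot 4^{{\rm tw}}\cdot |x|^{d}$ steps (that is, in time $O^*(4^{{\rm tw}})$) and answers ``yes'' or ``no''; \item if $x$ is a no-instance, it never answers ``yes''; \item if $x$ is a yes-instance, it answers ``no'' with probability at most $1/2$. \end{itemize} Here an algorithm is a fixed program of first-order recursive functions over binary trees (cons cells) with fair coin tosses, in which every variable access, construction or case distinction of a cons cell, local binding, function call and coin toss takes one step (each is a constant number of operations of a random access machine); the input is given by the adjacency matrices of $G$ and $T$, the bags as 0/1 vectors, $k$ in binary and, for the second problem, the indices of $s$ and $t$ in unary, and $|x|$ is the number of nodes of the binary tree that encodes it. -/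

import Mathlib

/-! ## Model of computation

First-order functional programs over binary trees (cons cells), with coin tosses. Values are
immutable binary trees, represented by pointers; there is no arithmetic on large numbers and no
equality test on whole trees. Every evaluation step is a constant number of operations of a random
access machine on machine words, so the step count below never undercounts the time of such a
machine by more than a constant factor (which depends only on the program). -/

/-- The data of the programs: binary trees. -/
inductive Data where
  | nil : Data
  | cons (a b : Data) : Data

namespace Data

/-- Number of nodes of a tree; used as the length of an input. -/
def size : Data → ℕ
  | nil => 1
  | cons a b => a.size + b.size + 1

/-- `false` is the empty tree, `true` is a single cons cell. -/
def ofBool : Bool → Data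
  | false => nil
  | true => cons nil nil

/-- Lists as right-nested cons cells. -/
def ofList : List Data → Data
  | [] => nil
  | a :: l => cons a (ofList l)

/-- A natural number in unary (used for names of vertices only). -/
def ofIndex (i : ℕ) : Data := ofList (List.replicate i nil)

/-- A natural number in binary, least significant bit first. -/
def ofNat (k : ℕ) : Data := ofList (k.bits.map ofBool)

open scoped Classical in
/-- A 0/1 matrix, as the list of its rows. -/
noncomputable def ofMatrix {a b : ℕ} (M : Fin a → Fin b → Prop) : Data :=
  ofList (List.ofFn fun i => ofList (List.ofFn fun j => ofBool (decide (M i j))))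

end Data

/-- Expressions. Variables are de Bruijn indices into the current environment. -/
inductive Expr where
  /-- the value of a variable -/
  | var (i : ℕ) : Expr
  /-- the empty tree -/
  | nil : Expr
  /-- a new cons cell -/
  | cons (a b : Expr) : Expr
  /-- `cases e e₁ e₂`: evaluate `e`; if the value is `nil`, continue with `e₁`; if it is
  `cons u v`, continue with `e₂`, in which `u` is variable `0` and `v` is variable `1` -/
  | cases (e e₁ e₂ : Expr) : Expr
  /-- `letIn e e'`: evaluate `e` and continue with `e'`, in which the value is variable `0` -/
  | letIn (e e' : Expr) : Expr
  /-- call of the `f`-th function of the program; the argument is variable `0` of its body -/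
  | call (f : ℕ) (e : Expr) : Expr
  /-- a fair coin toss -/
  | flip : Expr

/-- A program is a finite list of (mutually recursive) unary functions, given by their bodies. The
function with index `0` is the main function. -/
abbrev Program : Type := List Expr

/-- `Eval P env e r v t`: in the program `P` and the environment `env`, the evaluation of `e`
terminates with the value `v` after exactly `t` steps, the coins tossed on the way being, in this
order, the members of `r`. -/
inductive Eval (P : Program) : List Data → Expr → List Bool → Data → ℕ → Prop where
  | var {env : List Data} {i : ℕ} {v : Data} (h : env[i]? = some v) :
      Eval P env (.var i) [] v 1
  | nil {env : List Data} :
      Eval P env .nil [] .nil 1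
  | cons {env : List Data} {a b : Expr} {r₁ r₂ : List Bool} {u v : Data} {t₁ t₂ : ℕ}
      (h₁ : Eval P env a r₁ u t₁) (h₂ : Eval P env b r₂ v t₂) :
      Eval P env (.cons a b) (r₁ ++ r₂) (.cons u v) (t₁ + t₂ + 1)
  | casesNil {env : List Data} {e e₁ e₂ : Expr} {r₁ r₂ : List Bool} {w : Data} {t₁ t₂ : ℕ}
      (h₁ : Eval P env e r₁ .nil t₁) (h₂ : Eval P env e₁ r₂ w t₂) :
      Eval P env (.cases e e₁ e₂) (r₁ ++ r₂) w (t₁ + t₂ + 1)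
  | casesCons {env : List Data} {e e₁ e₂ : Expr} {r₁ r₂ : List Bool} {u v w : Data} {t₁ t₂ : ℕ}
      (h₁ : Eval P env e r₁ (.cons u v) t₁) (h₂ : Eval P (u :: v :: env) e₂ r₂ w t₂) :
      Eval P env (.cases e e₁ e₂) (r₁ ++ r₂) w (t₁ + t₂ + 1)
  | letIn {env : List Data} {e e' : Expr} {r₁ r₂ : List Bool} {u w : Data} {t₁ t₂ : ℕ}
      (h₁ : Eval P env e r₁ u t₁) (h₂ : Eval P (u :: env) e' r₂ w t₂) :
      Eval P env (.letIn e e') (r₁ ++ r₂) w (t₁ + t₂ + 1)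
  | call {env : List Data} {f : ℕ} {e body : Expr} {r₁ r₂ : List Bool} {u w : Data} {t₁ t₂ : ℕ}
      (hf : P[f]? = some body)
      (h₁ : Eval P env e r₁ u t₁) (h₂ : Eval P [u] body r₂ w t₂) :
      Eval P env (.call f e) (r₁ ++ r₂) w (t₁ + t₂ + 1)
  | flip {env : List Data} (b : Bool) :
      Eval P env .flip [b] (.ofBool b) 1

/-- `Outputs P x ω v t`: started on the input `x` with the infinite sequence `ω` of coin tosses
(of which a finite initial part is used), `P` halts after exactly `t` steps with the output `v`. -/
def Outputs (P : Program) (x : Data) (ω : ℕ → Bool) (v : Data) (t : ℕ) : Prop :=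
  ∃ m : ℕ, Eval P [x] (.call 0 (.var 0)) ((List.range m).map ω) v t

/-- The law of an infinite sequence of independent fair coin tosses. -/
noncomputable def coinMeasure : MeasureTheory.Measure (ℕ → Bool) :=
  MeasureTheory.Measure.infinitePi fun _ : ℕ => (PMF.uniformOfFintype Bool).toMeasure

/-- `P` is a Monte-Carlo algorithm with one-sided error for the decision problem `yes` on inputs
encoded by `enc`, with running time at most `time`: whatever the coins are, it halts within the
time bound and answers `true` or `false`; on no-instances it never answers `true`; on yes-instances
it answers `false` with probability at most `1/2`. -/
def IsOneSidedMonteCarlo {ι : Type*} (P : Program) (enc : ι → Data) (yes : ι → Prop)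
    (time : ι → ℕ) : Prop :=
  ∀ x : ι,
    (∀ ω : ℕ → Bool, ∃ (b : Bool) (t : ℕ), Outputs P (enc x) ω (.ofBool b) t ∧ t ≤ time x) ∧
    (¬ yes x → ∀ (ω : ℕ → Bool) (t : ℕ), ¬ Outputs P (enc x) ω (.ofBool true) t) ∧
    (yes x → coinMeasure {ω | ∃ t : ℕ, Outputs P (enc x) ω (.ofBool false) t} ≤ 1 / 2)

/-! ## Cuts and tree decompositions -/

/-- The cutset of the cut `(S, V \ S)`: the edges between `S` and `V \ S`. -/
def cutset {V : Type*} (G : SimpleGraph V) (S : Set V) : Set (Sym2 V) :=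
  {e | ∃ u v : V, u ∈ S ∧ v ∉ S ∧ G.Adj u v ∧ e = s(u, v)}

/-- The cut `(S, V \ S)` is minimal: no nonempty cutset is properly contained in its cutset. -/
def IsMinimalCut {V : Type*} (G : SimpleGraph V) (S : Set V) : Prop :=
  ∀ S' : Set V, (cutset G S').Nonempty → ¬ cutset G S' ⊂ cutset G S

/-- A tree decomposition of `G` whose tree has the node set `I`. -/
structure TreeDecomposition {V : Type*} (G : SimpleGraph V) (I : Type*) where
  tree : SimpleGraph I
  isTree : tree.IsTree
  bag : I → Finset V
  exists_mem_bag : ∀ v : V, ∃ i : I, v ∈ bag i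
  exists_edge_bag : ∀ u v : V, G.Adj u v → ∃ i : I, u ∈ bag i ∧ v ∈ bag i
  mem_bag_of_mem_path : ∀ (i j k : I) (p : tree.Walk i k), p.IsPath → j ∈ p.support →
    ∀ v : V, v ∈ bag i → v ∈ bag k → v ∈ bag j

/-- The width: the maximum size of a bag, minus one. -/
def TreeDecomposition.width {V I : Type*} [Fintype I] {G : SimpleGraph V}
    (D : TreeDecomposition G I) : ℕ :=
  (Finset.univ.sup fun i : I => (D.bag i).card) - 1

/-! ## The two problems -/

/-- An input of Maximum Minimal Cut: a connected graph on the vertices `0, …, n - 1`, a tree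
decomposition of it with nodes `0, …, N - 1`, and the number `k`. -/
structure CutInput where
  n : ℕ
  graph : SimpleGraph (Fin n)
  connected : graph.Connected
  N : ℕ
  decomp : TreeDecomposition graph (Fin N)
  k : ℕ

namespace CutInput

/-- The adjacency matrices of the graph and of the tree, the bags as 0/1 vectors, and `k` in
binary. -/
noncomputable def encode (x : CutInput) : Data :=
  .cons (.ofMatrix x.graph.Adj)
    (.cons (.ofMatrix x.decomp.tree.Adj)
      (.cons (.ofMatrix fun i v => v ∈ x.decomp.bag i) (.ofNat x.k)))

/-- Maximum Minimal Cut: is there a minimal cut of size at least `k`? -/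
def HasMinimalCut (x : CutInput) : Prop :=
  ∃ S : Set (Fin x.n), IsMinimalCut x.graph S ∧ x.k ≤ (cutset x.graph S).ncard

end CutInput

/-- An input of Maximum Minimal `s`-`t` Cut. -/
structure STCutInput extends CutInput where
  s : Fin n
  t : Fin n

namespace STCutInput

noncomputable def encode (x : STCutInput) : Data :=
  .cons (.ofIndex x.s) (.cons (.ofIndex x.t) x.toCutInput.encode)

/-- Maximum Minimal `s`-`t` Cut: is there a minimal cut `(S, V \ S)` of size at least `k` with
`s ∈ S` and `t ∈ V \ S`? -/
def HasMinimalSTCut (x : STCutInput) : Prop :=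
  ∃ S : Set (Fin x.n), x.s ∈ S ∧ x.t ∉ S ∧ IsMinimalCut x.graph S ∧
    x.k ≤ (cutset x.graph S).ncard

end STCutInput

/-! ## Evaluation without coin tosses, up to a time bound -/

/-! Color every vertex by a side of the cut and a mark. Require `s` on side `true`, `t` on side
`false`, both unmarked, and forbid adjacent vertices on the same side to have different marks. For a
fixed set S of vertices, the admissible markings are the functions that are constant on the
components of the graph without the cut edges and vanish on the components of `s` and `t`. Their
number is 2^c, where c counts the components that contain neither terminal, so it is odd exactly if
both sides are connected, that is, if the cut is minimal. Hence in characteristic two a sum over all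
colorings of a product of vertex and edge factors is a sum over the minimal cuts between `s` and `t`
(`isMinimalCut_iff`, `card_markings`, `sum_colorings_eq`).

Different minimal cuts must not cancel each other. Every vertex v gets a random weight w_v in F_2[X]
of degree less than n, read off n coins, and S contributes X^(n²|δ(S)|) times the product of w_v
over v in S. These products have degree less than n², so blocks of n² coefficients separate the cut
sizes (`coeff_cutSum`). As a polynomial in the w_v, the part that belongs to one size is a sum of
distinct multilinear monomials; it is nonzero if a minimal cut of this size exists, and by
Schwartz-Zippel random weights annihilate it with probability at most n/2^n ≤ 1/2
(`card_annihilating_le`). A nonzero coefficient always comes from an actual cut, so the error is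
one-sided (`stTest_sound`, `stTest_complete`).

The sum is evaluated on the tree decomposition by eliminating nodes from the leaves to the root. A
node sends its parent a table indexed by the colorings of the vertices common to both bags; an entry
is a sum over the colorings of the vertices that are forgotten. Messages that meet at a node are
multiplied entry by entry, without any convolution, so a bag of size b costs 4^b times a polynomial
(`val_foldl_message`, `val_messages`, `XT.message`). Without given terminals, passing to the
complement puts vertex 0 into S, and every `t` is tried.

The program is not written out. The predicates `PT` (polynomial time) and `XT` (time 4^e times a
polynomial) assert that code with this time bound exists, and they are closed under the
constructions from which the algorithm is assembled. -/

/-- Evaluation without coin tosses in at most `t` steps. -/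
def EvalLe (P : Program) (env : List Data) (e : Expr) (v : Data) (t : ℕ) : Prop :=
  ∃ t' ≤ t, Eval P env e [] v t'

namespace EvalLe

variable {P : Program} {env : List Data} {e e₁ e₂ : Expr} {u v w : Data} {t t₁ t₂ : ℕ}

theorem mono (h : EvalLe P env e v t₁) (ht : t₁ ≤ t₂) : EvalLe P env e v t₂ :=
  let ⟨s, hs, he⟩ := h
  ⟨s, hs.trans ht, he⟩

theorem var {i : ℕ} (h : env[i]? = some v) : EvalLe P env (.var i) v 1 :=
  ⟨1, le_rfl, .var h⟩

theorem nil : EvalLe P env .nil .nil 1 := ⟨1, le_rfl, .nil⟩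

theorem cons (h₁ : EvalLe P env e₁ u t₁) (h₂ : EvalLe P env e₂ v t₂) :
    EvalLe P env (.cons e₁ e₂) (.cons u v) (t₁ + t₂ + 1) :=
  let ⟨_, hs₁, he₁⟩ := h₁
  let ⟨_, hs₂, he₂⟩ := h₂
  ⟨_, by gcongr, .cons he₁ he₂⟩

theorem casesNil (h₁ : EvalLe P env e .nil t₁) (h₂ : EvalLe P env e₁ w t₂) :
    EvalLe P env (.cases e e₁ e₂) w (t₁ + t₂ + 1) :=
  let ⟨_, hs₁, he₁⟩ := h₁
  let ⟨_, hs₂, he₂⟩ := h₂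
  ⟨_, by gcongr, .casesNil he₁ he₂⟩

theorem casesCons (h₁ : EvalLe P env e (.cons u v) t₁) (h₂ : EvalLe P (u :: v :: env) e₂ w t₂) :
    EvalLe P env (.cases e e₁ e₂) w (t₁ + t₂ + 1) :=
  let ⟨_, hs₁, he₁⟩ := h₁
  let ⟨_, hs₂, he₂⟩ := h₂
  ⟨_, by gcongr, .casesCons he₁ he₂⟩

theorem letIn (h₁ : EvalLe P env e₁ u t₁) (h₂ : EvalLe P (u :: env) e₂ w t₂) :
    EvalLe P env (.letIn e₁ e₂) w (t₁ + t₂ + 1) :=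
  let ⟨_, hs₁, he₁⟩ := h₁
  let ⟨_, hs₂, he₂⟩ := h₂
  ⟨_, by gcongr, .letIn he₁ he₂⟩

theorem call {f : ℕ} {body : Expr} (hf : P[f]? = some body) (h₁ : EvalLe P env e u t₁)
    (h₂ : EvalLe P [u] body w t₂) : EvalLe P env (.call f e) w (t₁ + t₂ + 1) :=
  let ⟨_, hs₁, he₁⟩ := h₁
  let ⟨_, hs₂, he₂⟩ := h₂
  ⟨_, by gcongr, .call hf he₁ he₂⟩

end EvalLe

/-! ## Encoded types -/

/-- A type whose elements are represented by trees, with a measure of size in which running times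
are expressed. -/
class Enc (α : Type) where
  enc : α → Data
  sz : α → ℕ

open Enc (enc sz)

set_option linter.unusedSectionVars false

/-- The height of a tree. -/
def Data.height : Data → ℕ
  | nil => 0
  | cons a b => max a.height b.height + 1

/-- A table over all colorings of a bag has exponentially many nodes, but it is passed on as a
pointer and read along a single path. Measured by height it has polynomial size, and only the
enumeration that builds it pays an exponential price. -/
instance : Enc Data := ⟨id, Data.height⟩
instance : Enc Bool := ⟨Data.ofBool, fun b => cond b 1 0⟩
instance : Enc ℕ := ⟨Data.ofIndex, id⟩
instance {α β : Type} [Enc α] [Enc β] : Enc (α × β) :=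
  ⟨fun p => .cons (enc p.1) (enc p.2), fun p => sz p.1 + sz p.2⟩
instance {α : Type} [Enc α] : Enc (List α) :=
  ⟨fun l => .ofList (l.map enc), fun l => (l.map fun a => sz a + 1).sum⟩

section Sizes

variable {α β : Type} [Enc α] [Enc β]

@[simp] theorem enc_data (d : Data) : enc d = d := rfl
@[simp] theorem enc_false : enc false = .nil := rfl
@[simp] theorem enc_true : enc true = .cons .nil .nil := rfl
@[simp] theorem enc_pair (p : α × β) : enc p = .cons (enc p.1) (enc p.2) := rfl
@[simp] theorem enc_list_nil : enc ([] : List α) = .nil := rfl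
@[simp] theorem enc_list_cons (a : α) (l : List α) : enc (a :: l) = .cons (enc a) (enc l) := rfl
@[simp] theorem enc_nat_zero : enc 0 = .nil := rfl
@[simp] theorem enc_nat_succ (n : ℕ) : enc (n + 1) = .cons .nil (enc n) := rfl

@[simp] theorem sz_data (d : Data) : sz d = d.height := rfl
theorem sz_bool_le (b : Bool) : sz b ≤ 1 := by cases b <;> decide
@[simp] theorem sz_nat (n : ℕ) : sz n = n := rfl
@[simp] theorem sz_pair (p : α × β) : sz p = sz p.1 + sz p.2 := rfl
@[simp] theorem sz_list_nil : sz ([] : List α) = 0 := rfl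
@[simp] theorem sz_list_cons (a : α) (l : List α) : sz (a :: l) = sz a + 1 + sz l := rfl

@[simp] theorem sz_list_append (l l' : List α) : sz (l ++ l') = sz l + sz l' := by
  induction l with
  | nil => simp
  | cons a l ih => simp [ih]; omega

theorem length_le_sz (l : List α) : l.length ≤ sz l := by
  induction l with
  | nil => simp
  | cons a l ih => simp; omega

theorem sz_le_of_mem {a : α} {l : List α} (h : a ∈ l) : sz a + 1 ≤ sz l := by
  induction l with
  | nil => simp at h
  | cons b l ih =>
    rcases List.mem_cons.1 h with rfl | h
    · simp
    · have := ih h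
      simp; omega

theorem sz_list_le {l : List α} {m : ℕ} (h : ∀ a ∈ l, sz a ≤ m) : sz l ≤ l.length * (m + 1) := by
  induction l with
  | nil => simp
  | cons a l ih =>
    have h1 := h a (by simp)
    have h2 := ih fun b hb => h b (by simp [hb])
    simp only [sz_list_cons, List.length_cons, add_mul, one_mul]
    omega

theorem sz_list_bool_le (l : List Bool) : sz l ≤ 2 * l.length := by
  have := sz_list_le (l := l) (m := 1) fun a _ => sz_bool_le a
  omega

theorem sz_sublist_le {l l' : List α} (h : l.Sublist l') : sz l ≤ sz l' := by
  induction h with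
  | slnil => simp
  | cons a _ ih => simp; omega
  | cons_cons a _ ih => simp; omega

end Sizes

/-! ## Polynomially bounded functions -/

/-- Bounded by a polynomial in the size. -/
def PB {α : Type} [Enc α] (g : α → ℕ) : Prop := ∃ k : ℕ, ∀ x, g x ≤ (sz x + 2) ^ k

namespace PB

variable {α β : Type} [Enc α] [Enc β] {g h : α → ℕ}

theorem mono (hh : PB h) (hg : ∀ x, g x ≤ h x) : PB g :=
  let ⟨k, hk⟩ := hh
  ⟨k, fun x => (hg x).trans (hk x)⟩

theorem const (c : ℕ) : PB fun _ : α => c :=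
  ⟨c, fun x => (Nat.lt_two_pow_self (n := c)).le.trans (Nat.pow_le_pow_left (by omega) c)⟩

theorem size : PB fun x : α => sz x := ⟨1, fun x => by simp⟩

theorem mul (hg : PB g) (hh : PB h) : PB fun x => g x * h x := by
  obtain ⟨k, hk⟩ := hg
  obtain ⟨l, hl⟩ := hh
  exact ⟨k + l, fun x => by rw [pow_add]; exact Nat.mul_le_mul (hk x) (hl x)⟩

theorem add (hg : PB g) (hh : PB h) : PB fun x => g x + h x := by
  obtain ⟨k, hk⟩ := hg
  obtain ⟨l, hl⟩ := hh
  refine ⟨max k l + 1, fun x => ?_⟩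
  have h1 := (hk x).trans (Nat.pow_le_pow_right (by omega) (le_max_left k l))
  have h2 := (hl x).trans (Nat.pow_le_pow_right (by omega) (le_max_right k l))
  calc g x + h x ≤ (sz x + 2) ^ max k l * 2 := by omega
    _ ≤ (sz x + 2) ^ max k l * (sz x + 2) := by gcongr; omega
    _ = _ := (pow_succ _ _).symm

theorem pow (hg : PB g) (c : ℕ) : PB fun x => g x ^ c := by
  obtain ⟨k, hk⟩ := hg
  exact ⟨k * c, fun x => by rw [pow_mul]; exact Nat.pow_le_pow_left (hk x) c⟩

theorem comp {g : β → ℕ} (hg : PB g) {f : α → β} (hf : PB fun x => sz (f x)) :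
    PB fun x => g (f x) := by
  obtain ⟨k, hk⟩ := hg
  exact ((hf.add (.const 2)).pow k).mono fun x => hk (f x)

end PB

/-! ## Computable functions with time bounds -/

/-- In every program that contains the code `P`, the expression `e` computes `f` on variable `0` in
time `T`. Both depend on the position of the code in the program. -/
def Valid {α β : Type} [Enc α] [Enc β] (P : ℕ → Program) (e : ℕ → Expr) (f : α → β) (T : α → ℕ) :
    Prop :=
  ∀ (pre post : Program) (x : α) (env : List Data),
    EvalLe (pre ++ (P pre.length ++ post)) (enc x :: env) (e pre.length) (enc (f x)) (T x)

/-- `f` is computable in time `T`. -/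
def Cmp {α β : Type} [Enc α] [Enc β] (f : α → β) (T : α → ℕ) : Prop :=
  ∃ (n : ℕ) (P : ℕ → Program) (e : ℕ → Expr), (∀ k, (P k).length = n) ∧ Valid P e f T

section ListCase

variable {α β : Type}

/-- Case distinction on a list. -/
def lcase : List α → β → (α → List α → β) → β
  | [], b, _ => b
  | a :: l, _, h => h a l

@[simp] theorem lcase_nil (b : β) (h : α → List α → β) : lcase [] b h = b := rfl
@[simp] theorem lcase_cons (a : α) (l : List α) (b : β) (h : α → List α → β) :
    lcase (a :: l) b h = h a l := rfl

end ListCase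

section Valid

variable {α β γ δ : Type} [Enc α] [Enc β] [Enc γ] [Enc δ]

/-- Functions are called by their absolute position in the program. Code placed behind a block
leaves the block as it is; code placed in front of it (`Valid.left`) shifts it, which is why code
and expressions are parametrized by their position. -/
theorem Valid.right {P : ℕ → Program} {e : ℕ → Expr} {f : α → β} {T : α → ℕ}
    (h : Valid P e f T) (Q : ℕ → Program) (n : ℕ) :
    Valid (fun k => P k ++ Q (k + n)) e f T := fun pre post x env => by
  simpa using h pre (Q (pre.length + n) ++ post) x env

theorem Valid.left {P : ℕ → Program} {e : ℕ → Expr} {f : α → β} {T : α → ℕ}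
    (h : Valid P e f T) (Q : ℕ → Program) {n : ℕ} (hn : ∀ k, (Q k).length = n) :
    Valid (fun k => Q k ++ P (k + n)) (fun k => e (k + n)) f T := fun pre post x env => by
  simpa [hn] using h (pre ++ Q pre.length) post x env

theorem Cmp.mono {f : α → β} {T T' : α → ℕ} (h : Cmp f T) (hT : ∀ x, T x ≤ T' x) : Cmp f T' :=
  let ⟨n, P, e, hn, hv⟩ := h
  ⟨n, P, e, hn, fun pre post x env => (hv pre post x env).mono (hT x)⟩

theorem Cmp.of_expr {f : α → β} {T : α → ℕ} (e : Expr)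
    (h : ∀ (P : Program) (x : α) (env : List Data), EvalLe P (enc x :: env) e (enc (f x)) (T x)) :
    Cmp f T :=
  ⟨0, fun _ => [], fun _ => e, fun _ => rfl, fun _ _ x env => h _ x env⟩

/-- Two functions can be computed by the same code. -/
theorem Cmp.both {f : α → β} {T : α → ℕ} {g : γ → δ} {S : γ → ℕ} (hf : Cmp f T) (hg : Cmp g S) :
    ∃ (n : ℕ) (P : ℕ → Program) (e e' : ℕ → Expr), (∀ k, (P k).length = n) ∧ Valid P e f T ∧
      Valid P e' g S := by
  obtain ⟨n, P, e, hn, hv⟩ := hf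
  obtain ⟨m, Q, e', hm, hw⟩ := hg
  exact ⟨n + m, _, _, _, fun k => by simp [hn, hm], hv.right Q n, hw.left P hn⟩

theorem Cmp.comp {f : β → γ} {T : β → ℕ} {g : α → β} {S : α → ℕ} (hf : Cmp f T) (hg : Cmp g S) :
    Cmp (fun x => f (g x)) (fun x => S x + T (g x) + 1) := by
  obtain ⟨n, P, e, e', hn, hv, hw⟩ := hf.both hg
  exact ⟨n, P, fun k => .letIn (e' k) (e k), hn, fun pre post x env =>
    (hw pre post x env).letIn (hv pre post (g x) _)⟩

theorem Cmp.pair {f : α → β} {T : α → ℕ} {g : α → γ} {S : α → ℕ} (hf : Cmp f T) (hg : Cmp g S) :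
    Cmp (fun x => (f x, g x)) (fun x => T x + S x + 1) := by
  obtain ⟨n, P, e, e', hn, hv, hw⟩ := hf.both hg
  exact ⟨n, P, fun k => .cons (e k) (e' k), hn, fun pre post x env =>
    (hv pre post x env).cons (hw pre post x _)⟩

theorem Cmp.cond {b : α → Bool} {R : α → ℕ} {f g : α → β} {T S : α → ℕ} (hb : Cmp b R)
    (hf : Cmp f T) (hg : Cmp g S) :
    Cmp (fun x => cond (b x) (f x) (g x)) (fun x => R x + (T x + S x + 3) + 1) := by
  obtain ⟨n, P, e, e', hn, hv, hw⟩ := hf.both hg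
  obtain ⟨m, Q, d, hm, hu⟩ := hb
  -- In the `cons` branch two new variables precede the argument, so it is variable 2 and is bound
  -- again in order to become variable 0.
  refine ⟨n + m, fun k => P k ++ Q (k + n),
    fun k => .cases (d (k + n)) (e' k) (.letIn (.var 2) (e k)),
    fun k => by simp [hn, hm], fun pre post x env => ?_⟩
  have h := hu.left P hn pre post x env
  cases hbx : b x
  · rw [hbx] at h
    simp only [hbx, cond_false]
    refine EvalLe.mono (.casesNil h (hw.right Q n pre post x env)) ?_
    omega
  · rw [hbx] at h
    simp only [hbx, cond_true]
    refine EvalLe.mono (.casesCons h (.letIn (.var rfl) (hv.right Q n pre post x _))) ?_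
    omega

theorem Cmp.lcase {l : α → List γ} {R : α → ℕ} {f : α → β} {h : α → γ → List γ → β} {T : α → ℕ}
    {S : α × γ × List γ → ℕ} (hl : Cmp l R) (hf : Cmp f T)
    (hh : Cmp (fun p : α × γ × List γ => h p.1 p.2.1 p.2.2) S) :
    Cmp (fun x => lcase (l x) (f x) (h x))
      (fun x => R x + (T x + lcase (l x) 0 (fun a r => S (x, a, r)) + 6) + 1) := by
  obtain ⟨n, P, e, e', hn, hv, hw⟩ := hf.both hh
  obtain ⟨m, Q, d, hm, hu⟩ := hl
  refine ⟨n + m, fun k => P k ++ Q (k + n),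
    fun k => .cases (d (k + n)) (e k) (.letIn (.cons (.var 2) (.cons (.var 0) (.var 1))) (e' k)),
    fun k => by simp [hn, hm], fun pre post x env => ?_⟩
  have h' := hu.left P hn pre post x env
  cases hlx : l x with
  | nil =>
    rw [hlx] at h'
    simp only [hlx, lcase_nil]
    refine EvalLe.mono (.casesNil h' (hv.right Q n pre post x env)) ?_
    omega
  | cons a r =>
    rw [hlx] at h'
    simp only [hlx, lcase_cons]
    refine EvalLe.mono (.casesCons h' (.letIn (.cons (.var rfl) (.cons (.var rfl) (.var rfl)))
      (hw.right Q n pre post (x, a, r) _))) ?_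
    omega

/-- The expression that constructs a given tree. -/
def Data.quote : Data → Expr
  | nil => .nil
  | cons a b => .cons a.quote b.quote

theorem Data.evalLe_quote (P : Program) (env : List Data) (d : Data) :
    EvalLe P env d.quote d d.size := by
  induction d with
  | nil => exact .nil
  | cons a b iha ihb => exact iha.cons ihb

theorem Cmp.const (y : β) : Cmp (fun _ : α => y) (fun _ => (enc y).size) :=
  .of_expr (enc y).quote fun P _ _ => (enc y).evalLe_quote P _

/-- A recursive function, given by its body, in which `k` is its index. -/
theorem Cmp.rec_call {f : α → β} {T : α → ℕ} {n : ℕ} {P : ℕ → Program} (hn : ∀ k, (P k).length = n)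
    (body : ℕ → Expr)
    (h : ∀ (pre post : Program) (x : α), EvalLe (pre ++ (body pre.length :: P (pre.length + 1) ++ post))
      [enc x] (body pre.length) (enc (f x)) (T x)) :
    Cmp f (fun x => 1 + T x + 1) := by
  refine ⟨n + 1, fun k => body k :: P (k + 1), fun k => .call k (.var 0), fun k => by simp [hn],
    fun pre post x env => .call ?_ (.var rfl) (h pre post x)⟩
  simp

theorem getElem?_pre (pre l : Program) (b : Expr) : (pre ++ b :: l)[pre.length]? = some b := by
  simp

/-- Any `T` that dominates the recurrence of the loop is a time bound. The constants 10 and 30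
absorb the variable accesses, case distinctions and the call in one round. -/
theorem Cmp.foldl {step : γ → β → α → β} {S : γ × β × α → ℕ}
    (hs : Cmp (fun p : γ × β × α => step p.1 p.2.1 p.2.2) S)
    (T : γ × List α × β → ℕ) (hnil : ∀ c s, 10 ≤ T (c, [], s))
    (hcons : ∀ c a l s, T (c, l, step c s a) + S (c, s, a) + 30 ≤ T (c, a :: l, s)) :
    Cmp (fun p : γ × List α × β => p.2.1.foldl (step p.1) p.2.2) (fun p => 1 + T p + 1) := by
  obtain ⟨n, P, e, hn, hv⟩ := hs
  refine Cmp.rec_call hn (fun k => .cases (.var 0) .nil (.cases (.var 1) .nil (.cases (.var 0)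
    (.var 1) (.call k (.cons (.var 4) (.cons (.var 1) (.letIn
      (.cons (.var 4) (.cons (.var 3) (.var 0))) (e (k + 1))))))))) fun pre post ⟨c, l, s⟩ => ?_
  induction l generalizing s with
  | nil =>
    refine EvalLe.mono (.casesCons (.var rfl) (.casesCons (.var rfl) (.casesNil (.var rfl)
      (.var rfl)))) (le_trans ?_ (hnil c s))
    omega
  | cons a l ih =>
    refine EvalLe.mono (.casesCons (.var rfl) (.casesCons (.var rfl) (.casesCons (.var rfl)
      (.call (getElem?_pre _ _ _) (.cons (.var rfl) (.cons (.var rfl)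
        (.letIn (.cons (.var rfl) (.cons (.var rfl) (.var rfl)))
          (hv.left (n := 1) (fun k => [_]) (fun _ => rfl) pre post (c, s, a) _))))
        (ih (step c s a)))))) (le_trans ?_ (hcons c a l s))
    omega

end Valid

/-! ## Enumeration of colorings -/

/-- The states of a vertex: the side of the cut, and a mark. -/
abbrev Color : Type := Bool × Bool

/-- Walks through a list of colors; where the flag is set, all colors are tried and the results are
combined. The color lists handed to `leaf` are reversed. -/
def enum {β : Type} (comb : β → β → β → β → β) (leaf : List Color → β) :
    List (Color × Bool) → List Color → β
  | [], s => leaf s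
  | (q, false) :: l, s => enum comb leaf l (q :: s)
  | (_, true) :: l, s =>
    comb (enum comb leaf l ((false, false) :: s)) (enum comb leaf l ((false, true) :: s))
      (enum comb leaf l ((true, false) :: s)) (enum comb leaf l ((true, true) :: s))

/-! ### Running times of the form 4^e times a polynomial -/

section Time

variable {α β γ δ : Type} [Enc α] [Enc β] [Enc γ] [Enc δ]

theorem Cmp.enum {leaf : γ → List Color → β} {S : γ × List Color → ℕ}
    (hs : Cmp (fun p : γ × List Color => leaf p.1 p.2) S)
    {comb : γ → β → β → β → β → β} {R : γ × β × β × β × β → ℕ}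
    (hr : Cmp (fun p : γ × β × β × β × β => comb p.1 p.2.1 p.2.2.1 p.2.2.2.1 p.2.2.2.2) R)
    (T : γ → List (Color × Bool) → List Color → ℕ) (hnil : ∀ c s, S (c, s) + 20 ≤ T c [] s)
    (hskip : ∀ c q l s, T c l (q :: s) + 40 ≤ T c ((q, false) :: l) s)
    (hbr : ∀ c q l s, T c l ((false, false) :: s) + T c l ((false, true) :: s) +
      T c l ((true, false) :: s) + T c l ((true, true) :: s) +
      R (c, enum (comb c) (leaf c) l ((false, false) :: s),
        enum (comb c) (leaf c) l ((false, true) :: s),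
        enum (comb c) (leaf c) l ((true, false) :: s),
        enum (comb c) (leaf c) l ((true, true) :: s)) + 100 ≤ T c ((q, true) :: l) s) :
    Cmp (fun p : γ × List (Color × Bool) × List Color => enum (comb p.1) (leaf p.1) p.2.1 p.2.2)
      (fun p => 1 + T p.1 p.2.1 p.2.2 + 1) := by
  obtain ⟨n, P, e, e', hn, hv, hw⟩ := hs.both hr
  -- Five nested case distinctions have produced an environment of eleven values; variable 5 is the
  -- rest of the list, 7 the colors chosen so far, and 8 the parameter.
  let C (k : ℕ) (q : Color) : Expr :=
    .call k (.cons (.var 8) (.cons (.var 5) (.cons (enc q).quote (.var 7))))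
  refine Cmp.rec_call (T := fun p : γ × List (Color × Bool) × List Color => T p.1 p.2.1 p.2.2) hn (fun k => .cases (.var 0) .nil
    (.cases (.var 1) .nil (.cases (.var 0)
    (.letIn (.cons (.var 2) (.var 1)) (e (k + 1)))
    (.cases (.var 0) .nil (.cases (.var 1)
      (.call k (.cons (.var 6) (.cons (.var 3) (.cons (.var 0) (.var 5)))))
      (.letIn (.cons (.var 8) (.cons (C k (false, false)) (.cons (C k (false, true))
        (.cons (C k (true, false)) (C k (true, true)))))) (e' (k + 1)))))))) fun pre post ⟨c, l, s⟩ => ?_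
  induction l generalizing s with
  | nil =>
    refine EvalLe.mono (.casesCons (.var rfl) (.casesCons (.var rfl) (.casesNil (.var rfl)
      (.letIn (.cons (.var rfl) (.var rfl))
        (hv.left (n := 1) (fun k => [_]) (fun _ => rfl) pre post (c, s) _)))))
      (le_trans ?_ (hnil c s))
    omega
  | cons a l ih =>
    obtain ⟨q, _ | _⟩ := a
    · refine EvalLe.mono (.casesCons (.var rfl) (.casesCons (.var rfl) (.casesCons (.var rfl)
        (.casesCons (.var rfl) (.casesNil (.var rfl)
        (.call (getElem?_pre _ _ _) (.cons (.var rfl) (.cons (.var rfl)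
          (.cons (.var rfl) (.var rfl)))) (ih (q :: s)))))))) (le_trans ?_ (hskip c q l s))
      dsimp only
      omega
    · have hC (q' : Color) := EvalLe.call (P := pre ++ (_ :: P (pre.length + 1) ++ post))
        (f := pre.length) (env := .nil :: .nil :: enc q :: enc true :: enc (q, true) :: enc l ::
          enc ((q, true) :: l) :: enc s :: enc c :: enc (((q, true) :: l), s) ::
            [enc (c, (q, true) :: l, s)]) (getElem?_pre _ _ _)
        (.cons (.var (i := 8) rfl) (.cons (.var (i := 5) rfl)
          (.cons (Data.evalLe_quote _ _ (enc q')) (.var (i := 7) rfl)))) (ih (q' :: s))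
      refine EvalLe.mono (.casesCons (.var rfl) (.casesCons (.var rfl) (.casesCons (.var rfl)
        (.casesCons (.var rfl) (.casesCons (.var rfl)
        (.letIn (.cons (.var rfl) (.cons (hC _) (.cons (hC _) (.cons (hC _) (hC _)))))
          (hw.left (n := 1) (fun k => [_]) (fun _ => rfl) pre post (c, _, _, _, _) _)))))))
        (le_trans ?_ (hbr c q l s))
      simp only [enc_pair, enc_true, enc_false, Data.size]
      omega

/-- Computable in time `4 ^ e` times a polynomial, with results of polynomial size. -/
def XT (e : α → ℕ) (f : α → β) : Prop :=
  (∃ g : α → ℕ, PB g ∧ Cmp f fun x => 4 ^ e x * g x) ∧ PB fun x => sz (f x)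

/-- Computable in polynomial time. -/
@[fun_prop]
def PT (f : α → β) : Prop := XT (fun _ => 0) f

theorem XT.mono {e e' : α → ℕ} {f : α → β} (h : XT e f) (he : ∀ x, e x ≤ e' x) : XT e' f := by
  obtain ⟨⟨g, hg, hc⟩, hs⟩ := h
  exact ⟨⟨g, hg, hc.mono fun x => Nat.mul_le_mul_right _ (Nat.pow_le_pow_right (by norm_num) (he x))⟩, hs⟩

theorem PT.xt {f : α → β} (h : PT f) (e : α → ℕ) : XT e f := XT.mono h fun _ => Nat.zero_le _

theorem Cmp.xt {e : α → ℕ} {f : α → β} {T g : α → ℕ} (h : Cmp f T) (hg : PB g)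
    (hT : ∀ x, T x ≤ 4 ^ e x * g x) (hs : PB fun x => sz (f x)) : XT e f :=
  ⟨⟨g, hg, h.mono hT⟩, hs⟩

theorem Cmp.pt {f : α → β} {T : α → ℕ} (h : Cmp f T) (hT : PB T) (hs : PB fun x => sz (f x)) :
    PT f :=
  h.xt hT (fun x => by simp) hs

theorem PT.pb {f : α → β} (h : PT f) : PB fun x => sz (f x) := h.2

theorem le_four_pow_mul (e n : ℕ) : n ≤ 4 ^ e * n := Nat.le_mul_of_pos_left _ (by positivity)

theorem XT.comp {ef : β → ℕ} {eg e : α → ℕ} {f : β → γ} {g : α → β} (hf : XT ef f) (hg : XT eg g)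
    (h₁ : ∀ x, eg x ≤ e x) (h₂ : ∀ x, ef (g x) ≤ e x) : XT e fun x => f (g x) := by
  obtain ⟨⟨T, hT, cf⟩, sf⟩ := hf
  obtain ⟨⟨S, hS, cg⟩, sg⟩ := hg.mono h₁
  refine (cf.comp cg).xt ((hS.add (hT.comp sg)).add (.const 1)) (fun x => ?_) (sf.comp sg)
  have h3 : 4 ^ ef (g x) * T (g x) ≤ 4 ^ e x * T (g x) :=
    Nat.mul_le_mul_right _ (Nat.pow_le_pow_right (by norm_num) (h₂ x))
  have := le_four_pow_mul (e x) 1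
  rw [mul_add, mul_add]
  omega

theorem XT.pair {e : α → ℕ} {f : α → β} {g : α → γ} (hf : XT e f) (hg : XT e g) :
    XT e fun x => (f x, g x) := by
  obtain ⟨⟨T, hT, cf⟩, sf⟩ := hf
  obtain ⟨⟨S, hS, cg⟩, sg⟩ := hg
  refine (cf.pair cg).xt ((hT.add hS).add (.const 1)) (fun x => ?_) (sf.add sg)
  have := le_four_pow_mul (e x) 1
  rw [mul_add, mul_add]
  omega

theorem XT.bcond {e : α → ℕ} {b : α → Bool} {f g : α → β} (hb : XT e b) (hf : XT e f)
    (hg : XT e g) : XT e fun x => cond (b x) (f x) (g x) := by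
  obtain ⟨⟨R, hR, cb⟩, -⟩ := hb
  obtain ⟨⟨T, hT, cf⟩, sf⟩ := hf
  obtain ⟨⟨S, hS, cg⟩, sg⟩ := hg
  refine (cb.cond cf cg).xt ((hR.add (hT.add hS)).add (.const 4)) (fun x => ?_)
    ((sf.add sg).mono fun x => ?_)
  · have := le_four_pow_mul (e x) 4
    rw [mul_add, mul_add, mul_add]
    omega
  · cases b x <;> simp

@[fun_prop]
theorem PT.const (y : β) : PT fun _ : α => y := (Cmp.const y).pt (.const _) (.const _)

@[fun_prop]
theorem PT.id : PT fun x : α => x :=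
  Cmp.pt (T := fun _ => 1) (.of_expr (.var 0) fun _ _ _ => .var rfl) (.const _) .size

@[fun_prop]
theorem PT.comp {f : β → γ} {g : α → β} (hf : PT f) (hg : PT g) : PT fun x => f (g x) :=
  XT.comp hf hg (fun _ => le_rfl) fun _ => le_rfl

@[fun_prop]
theorem PT.pair {f : α → β} {g : α → γ} (hf : PT f) (hg : PT g) : PT fun x => (f x, g x) :=
  XT.pair hf hg

theorem PT.fst' : PT fun p : α × β => p.1 :=
  Cmp.pt (.of_expr (.cases (.var 0) .nil (.var 0)) fun _ _ _ => .casesCons (.var rfl) (.var rfl))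
    (.const _) (PB.size.mono fun p => by simp)

theorem PT.snd' : PT fun p : α × β => p.2 :=
  Cmp.pt (.of_expr (.cases (.var 0) .nil (.var 1)) fun _ _ _ => .casesCons (.var rfl) (.var rfl))
    (.const _) (PB.size.mono fun p => by simp)

@[fun_prop]
theorem PT.fst {f : α → β × γ} (hf : PT f) : PT fun x => (f x).1 := PT.fst'.comp hf

@[fun_prop]
theorem PT.snd {f : α → β × γ} (hf : PT f) : PT fun x => (f x).2 := PT.snd'.comp hf

@[fun_prop]
theorem PT.bcond {b : α → Bool} {f g : α → β} (hb : PT b) (hf : PT f) (hg : PT g) :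
    PT fun x => cond (b x) (f x) (g x) :=
  XT.bcond hb hf hg

@[fun_prop]
theorem PT.listCase {l : α → List γ} {f : α → β} {h : α → γ → List γ → β} (hl : PT l) (hf : PT f)
    (hh : PT fun p : α × γ × List γ => h p.1 p.2.1 p.2.2) :
    PT fun x => lcase (l x) (f x) (h x) := by
  obtain ⟨⟨R, hR, cl⟩, sl⟩ := hl
  obtain ⟨⟨T, hT, cf⟩, sf⟩ := hf
  obtain ⟨⟨S, ⟨k, hS⟩, ch⟩, ⟨m, sh⟩⟩ := hh
  have hp : PB fun x => sz x + sz (l x) + 2 := (PB.size.add sl).add (.const 2)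
  refine (cl.lcase cf ch).pt (((hR.add (hT.add ((hp.pow k).add (.const 6)))).add (.const 1)).mono
    fun x => ?_) ((sf.add (hp.pow m)).mono fun x => ?_)
  · simp only [pow_zero, one_mul]
    rw [add_assoc (T x)]
    gcongr
    cases hx : l x with
    | nil => simp
    | cons a r =>
      refine (hS _).trans (Nat.pow_le_pow_left ?_ k)
      simp only [sz_pair, sz_list_cons]
      omega
  · cases hx : l x with
    | nil => simp
    | cons a r =>
      refine (sh (x, a, r)).trans (le_add_left (Nat.pow_le_pow_left ?_ m))
      simp only [sz_pair, sz_list_cons]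
      omega

@[fun_prop]
theorem PT.list_cons {f : α → β} {l : α → List β} (hf : PT f) (hl : PT l) :
    PT fun x => f x :: l x := by
  refine PT.comp (f := fun p : β × List β => p.1 :: p.2)
    (Cmp.pt (T := fun _ => 1) (.of_expr (.var 0) fun _ _ _ => .var rfl) (.const _)
    ((PB.size.add (.const 1)).mono fun p => ?_)) (hf.pair hl)
  simp; omega

/-- The time of a left fold. -/
def foldlTime (step : γ → β → α → β) (S : γ × β × α → ℕ) (c : γ) : List α → β → ℕ
  | [], _ => 10
  | a :: l, s => foldlTime step S c l (step c s a) + S (c, s, a) + 30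

/-- A polynomial size bound for a single step would not survive iteration. Growth by at most an
additive `g` per step does: all states stay below `M`, so every round costs at most `K + 30`. -/
theorem foldlTime_le (step : γ → β → α → β) (S : γ × β × α → ℕ) (c : γ) {g M K : ℕ} (l : List α)
    (s : β) (hg : ∀ a ∈ l, ∀ s, sz (step c s a) ≤ sz s + g) (hM : sz s + l.length * g ≤ M)
    (hK : ∀ a ∈ l, ∀ s, sz s ≤ M → S (c, s, a) ≤ K) :
    foldlTime step S c l s ≤ 10 + l.length * (K + 30) ∧ sz (l.foldl (step c) s) ≤ M := by
  induction l generalizing s with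
  | nil => simpa [foldlTime] using hM
  | cons a l ih =>
    simp only [List.length_cons, add_mul, one_mul] at hM
    have h1 := hg a (by simp) s
    have h2 := hK a (by simp) s (by omega)
    obtain ⟨h3, h4⟩ := ih (step c s a) (fun a ha => hg a (by simp [ha])) (by omega)
      fun a ha => hK a (by simp [ha])
    refine ⟨?_, h4⟩
    simp only [foldlTime, List.length_cons, add_mul, one_mul] at h3 ⊢
    omega

theorem XT.foldl {e : γ → ℕ} {e' : γ × β × α → ℕ} {l : γ → List α} {s : γ → β}
    {step : γ → β → α → β} (hl : PT l) (hs : PT s)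
    (hstep : XT e' fun p : γ × β × α => step p.1 p.2.1 p.2.2)
    (he : ∀ x, ∀ a ∈ l x, ∀ s, e' (x, s, a) ≤ e x)
    (hg : ∃ g, PB g ∧ ∀ x, ∀ a ∈ l x, ∀ s, sz (step x s a) ≤ sz s + g x) :
    XT e fun x => (l x).foldl (step x) (s x) := by
  obtain ⟨⟨S, ⟨k, hS⟩, cs⟩, -⟩ := hstep
  obtain ⟨g, pg, hg⟩ := hg
  obtain ⟨⟨T, hT, ca⟩, -⟩ := (PT.id (α := γ)).pair (hl.pair hs)
  have hM : PB fun x => sz (s x) + sz (l x) * g x := hs.pb.add (hl.pb.mul pg)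
  have hK : PB fun x => (sz x + (sz (s x) + sz (l x) * g x) + sz (l x) + 2) ^ k :=
    (((PB.size.add hM).add hl.pb).add (.const 2)).pow k
  have key (x : γ) := foldlTime_le step (fun p => 4 ^ e' p * S p) x
    (K := 4 ^ e x * (sz x + (sz (s x) + sz (l x) * g x) + sz (l x) + 2) ^ k)
    (M := sz (s x) + sz (l x) * g x) (l x) (s x) (hg x)
    (by gcongr; exact length_le_sz _) fun a ha t ht => by
      have h1 : sz a + 1 ≤ sz (l x) := sz_le_of_mem ha
      refine Nat.mul_le_mul (Nat.pow_le_pow_right (by norm_num) (he x a ha t))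
        ((hS _).trans (Nat.pow_le_pow_left ?_ k))
      simp only [sz_pair]
      omega
  refine Cmp.xt ((Cmp.foldl cs (fun p => foldlTime step (fun p => 4 ^ e' p * S p) p.1 p.2.1 p.2.2) (fun c s => le_rfl)
    fun c a l s => le_rfl).comp ca) ((hT.add (.const 13)).add (hl.pb.mul (hK.add (.const 30))))
    (fun x => ?_) (hM.mono fun x => (key x).2)
  have h1 := (key x).1
  have h2 : (l x).length * (4 ^ e x * (sz x + (sz (s x) + sz (l x) * g x) + sz (l x) + 2) ^ k + 30)
      ≤ 4 ^ e x * (sz (l x) * ((sz x + (sz (s x) + sz (l x) * g x) + sz (l x) + 2) ^ k + 30)) := by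
    have := le_four_pow_mul (e x) 30
    rw [mul_left_comm]
    refine Nat.mul_le_mul (length_le_sz _) ?_
    rw [mul_add]
    omega
  have h3 := le_four_pow_mul (e x) (T x + 13)
  rw [mul_add]
  simp only [pow_zero, one_mul]
  omega

theorem PT.foldl {l : γ → List α} {s : γ → β} {step : γ → β → α → β} (hl : PT l) (hs : PT s)
    (hstep : PT fun p : γ × β × α => step p.1 p.2.1 p.2.2)
    (hg : ∃ g, PB g ∧ ∀ x, ∀ a ∈ l x, ∀ s, sz (step x s a) ≤ sz s + g x) :
    PT fun x => (l x).foldl (step x) (s x) :=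
  XT.foldl hl hs hstep (fun _ _ _ _ => le_rfl) hg

/-- The time of an enumeration. -/
def enumTime (comb : γ → β → β → β → β → β) (leaf : γ → List Color → β) (S : γ × List Color → ℕ)
    (R : γ × β × β × β × β → ℕ) (c : γ) : List (Color × Bool) → List Color → ℕ
  | [], s => S (c, s) + 20
  | (q, false) :: l, s => enumTime comb leaf S R c l (q :: s) + 40
  | (_, true) :: l, s => enumTime comb leaf S R c l ((false, false) :: s) +
      enumTime comb leaf S R c l ((false, true) :: s) +
      enumTime comb leaf S R c l ((true, false) :: s) +
      enumTime comb leaf S R c l ((true, true) :: s) +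
      R (c, enum (comb c) (leaf c) l ((false, false) :: s),
        enum (comb c) (leaf c) l ((false, true) :: s),
        enum (comb c) (leaf c) l ((true, false) :: s),
        enum (comb c) (leaf c) l ((true, true) :: s)) + 100

theorem sz_color_le (q : Color) : sz q ≤ 2 := by
  have h1 := sz_bool_le q.1
  have h2 := sz_bool_le q.2
  simp only [sz_pair]
  omega

/-- The summand 2 is the price of `node4`, which puts two levels of cells on top of its four
subtables. The assumption `m ≤ k` covers combinations such as `addT`, whose results are bounded by
`m` whatever the arguments are. -/
theorem sz_enum_le {comb : β → β → β → β → β} {leaf : List Color → β} {m : ℕ}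
    (hl : ∀ s, sz (leaf s) ≤ m) (hc : ∀ a b c d k, m ≤ k → sz a ≤ k → sz b ≤ k → sz c ≤ k →
      sz d ≤ k → sz (comb a b c d) ≤ k + 2) (l : List (Color × Bool)) (s : List Color) :
    sz (enum comb leaf l s) ≤ m + 2 * l.length := by
  induction l generalizing s with
  | nil => exact hl s
  | cons a l ih =>
    obtain ⟨q, _ | _⟩ := a
    · exact (ih _).trans (by simp)
    · exact hc _ _ _ _ (m + 2 * l.length) (by omega) (ih _) (ih _) (ih _) (ih _)

/-- Only flagged positions branch, so there are 4 to the number of flags many leaves, each of cost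
at most `4 ^ e * K`. Every other level of the recursion has no more calls than there are leaves,
which gives the factor `l.length + 1`. -/
theorem enumTime_le (comb : γ → β → β → β → β → β) (leaf : γ → List Color → β)
    (S : γ × List Color → ℕ) (R : γ × β × β × β × β → ℕ) (c : γ) {m M e K K' N : ℕ}
    (hl : ∀ s, sz (leaf c s) ≤ m)
    (hc : ∀ a b d f k, m ≤ k → sz a ≤ k → sz b ≤ k → sz d ≤ k →
      sz f ≤ k → sz (comb c a b d f) ≤ k + 2)
    (hS : ∀ s, sz s ≤ M → S (c, s) ≤ 4 ^ e * K)
    (hR : ∀ a b d f, sz a ≤ m + 2 * N → sz b ≤ m + 2 * N → sz d ≤ m + 2 * N → sz f ≤ m + 2 * N →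
      R (c, a, b, d, f) ≤ K')
    (l : List (Color × Bool)) (s : List Color) (hM : sz s + 3 * l.length ≤ M) (hN : l.length ≤ N) :
    enumTime comb leaf S R c l s ≤
      4 ^ (e + l.countP (·.2)) * ((l.length + 1) * (K + K' + 100)) := by
  induction l generalizing s with
  | nil =>
    have h1 := hS s (by simpa using hM)
    have h2 := le_four_pow_mul e (K' + 100)
    simp only [enumTime, List.countP_nil, add_zero, List.length_nil, zero_add, one_mul]
    rw [show K + K' + 100 = K + (K' + 100) by ring, mul_add]
    omega
  | cons a l ih =>
    simp only [List.length_cons] at hM hN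
    have ih' (q : Color) := ih (q :: s) (by
      have := sz_color_le q
      simp only [sz_list_cons] at *
      omega) (by omega)
    have hs (s : List Color) := (sz_enum_le hl hc l s).trans
      (show m + 2 * l.length ≤ m + 2 * N by omega)
    obtain ⟨q, _ | _⟩ := a
    · have h1 := ih' q
      have h2 := le_four_pow_mul (e + l.countP (·.2)) (K + K' + 100)
      simp only [enumTime, List.length_cons, List.countP_cons, Bool.false_eq_true, if_false, add_zero]
      rw [add_mul (l.length + 1), mul_add, one_mul]
      omega
    · have h1 := ih' (false, false)
      have h2 := ih' (false, true)
      have h3 := ih' (true, false)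
      have h4 := ih' (true, true)
      have h5 := hR _ _ _ _ (hs ((false, false) :: s)) (hs ((false, true) :: s))
        (hs ((true, false) :: s)) (hs ((true, true) :: s))
      have h6 := le_four_pow_mul (e + l.countP (·.2)) (K + K' + 100)
      simp only [enumTime, List.length_cons, List.countP_cons, if_true]
      rw [add_mul (l.length + 1), mul_add, one_mul, ← add_assoc, pow_succ]
      have h7 : 4 ^ (e + l.countP (·.2)) * 4 * ((l.length + 1) * (K + K' + 100)) =
        4 * (4 ^ (e + l.countP (·.2)) * ((l.length + 1) * (K + K' + 100))) := by ring
      have h8 : 4 ^ (e + l.countP (·.2)) * 4 * (K + K' + 100) =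
        4 * (4 ^ (e + l.countP (·.2)) * (K + K' + 100)) := by ring
      rw [h7, h8]
      omega

theorem XT.enum {e : γ → ℕ} {e' : γ × List Color → ℕ} {l : γ → List (Color × Bool)}
    {leaf : γ → List Color → β} {comb : γ → β → β → β → β → β} (hl : PT l)
    (hleaf : XT e' fun p : γ × List Color => leaf p.1 p.2)
    (hcomb : PT fun p : γ × β × β × β × β => comb p.1 p.2.1 p.2.2.1 p.2.2.2.1 p.2.2.2.2)
    (he : ∀ x s, e' (x, s) ≤ e x)
    (hm : ∃ m, PB m ∧ (∀ x s, sz (leaf x s) ≤ m x) ∧ ∀ x a b c d k, m x ≤ k → sz a ≤ k →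
      sz b ≤ k → sz c ≤ k → sz d ≤ k → sz (comb x a b c d) ≤ k + 2) :
    XT (fun x => e x + (l x).countP (·.2)) fun x => enum (comb x) (leaf x) (l x) [] := by
  obtain ⟨⟨S, ⟨k, hS⟩, cs⟩, -⟩ := hleaf
  obtain ⟨⟨R, ⟨k', hR⟩, cr⟩, -⟩ := hcomb
  obtain ⟨m, pm, hml, hmc⟩ := hm
  obtain ⟨⟨T, hT, ca⟩, -⟩ := (PT.id (α := γ)).pair (hl.pair (.const ([] : List Color)))
  have pK : PB fun x => (sz x + 3 * sz (l x) + 2) ^ k :=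
    ((PB.size.add ((PB.const 3).mul hl.pb)).add (.const 2)).pow k
  have pK' : PB fun x => (sz x + 4 * (m x + 2 * sz (l x)) + 2) ^ k' :=
    ((PB.size.add ((PB.const 4).mul (pm.add ((PB.const 2).mul hl.pb)))).add (.const 2)).pow k'
  have key (x : γ) := enumTime_le comb leaf (fun p => 4 ^ e' p * S p) (fun p => 4 ^ 0 * R p) x
    (m := m x) (M := 3 * sz (l x)) (e := e x) (N := sz (l x))
    (K := (sz x + 3 * sz (l x) + 2) ^ k) (K' := (sz x + 4 * (m x + 2 * sz (l x)) + 2) ^ k')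
    (hml x) (hmc x)
    (fun s hs => Nat.mul_le_mul (Nat.pow_le_pow_right (by norm_num) (he x s))
      ((hS _).trans (Nat.pow_le_pow_left (by simp only [sz_pair]; omega) k)))
    (fun a b d f ha hb hd hf => by
      rw [pow_zero, one_mul]
      exact (hR _).trans (Nat.pow_le_pow_left (by simp only [sz_pair]; omega) k'))
    (l x) [] (by simpa using length_le_sz (l x)) (length_le_sz _)
  refine Cmp.xt ((Cmp.enum cs cr (enumTime comb leaf (fun p => 4 ^ e' p * S p) fun p => 4 ^ 0 * R p) (fun c s => le_rfl)
    (fun c q l s => le_rfl) fun c q l s => le_rfl).comp ca)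
    ((hT.add (.const 3)).add ((hl.pb.add (.const 1)).mul ((pK.add pK').add (.const 100))))
    (fun x => ?_) ((pm.add ((PB.const 2).mul hl.pb)).mono fun x =>
      (sz_enum_le (hml x) (hmc x) (l x) []).trans (by gcongr; exact length_le_sz _))
  have h1 := key x
  have h2 := le_four_pow_mul (e x + (l x).countP (·.2)) (T x + 3)
  have h3 : 4 ^ (e x + (l x).countP (·.2)) * (((l x).length + 1) * ((sz x + 3 * sz (l x) + 2) ^ k +
      (sz x + 4 * (m x + 2 * sz (l x)) + 2) ^ k' + 100)) ≤
      4 ^ (e x + (l x).countP (·.2)) * ((sz (l x) + 1) * ((sz x + 3 * sz (l x) + 2) ^ k +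
      (sz x + 4 * (m x + 2 * sz (l x)) + 2) ^ k' + 100)) := by
    gcongr
    exact length_le_sz _
  rw [mul_add]
  simp only [pow_zero, one_mul] at h1 ⊢
  omega

end Time

/-! ## Polynomial time functions on lists -/

section ListLib

variable {α β γ δ : Type} [Enc α] [Enc β] [Enc γ] [Enc δ]

@[fun_prop]
theorem PT.not {f : α → Bool} (hf : PT f) : PT fun x => !f x := by
  have : PT fun x => cond (f x) false true := by fun_prop
  convert this using 2 with x
  cases f x <;> rfl

@[fun_prop]
theorem PT.and {f g : α → Bool} (hf : PT f) (hg : PT g) : PT fun x => f x && g x := by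
  have : PT fun x => cond (f x) (g x) false := by fun_prop
  convert this using 2 with x
  cases f x <;> rfl

@[fun_prop]
theorem PT.or {f g : α → Bool} (hf : PT f) (hg : PT g) : PT fun x => f x || g x := by
  have : PT fun x => cond (f x) true (g x) := by fun_prop
  convert this using 2 with x
  cases f x <;> rfl

@[fun_prop]
theorem PT.xor {f g : α → Bool} (hf : PT f) (hg : PT g) : PT fun x => f x ^^ g x := by
  have : PT fun x => cond (f x) (!g x) (g x) := by fun_prop
  convert this using 2 with x
  cases f x <;> simp

@[fun_prop]
theorem PT.tail {l : α → List β} (hl : PT l) : PT fun x => (l x).tail := by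
  have : PT fun x => lcase (l x) [] fun _ r => r := by fun_prop
  convert this using 2 with x
  cases l x <;> rfl

@[fun_prop]
theorem PT.isEmpty {l : α → List β} (hl : PT l) : PT fun x => (l x).isEmpty := by
  have : PT fun x => lcase (l x) true fun _ _ => false := by fun_prop
  convert this using 2 with x
  cases l x <;> rfl

@[fun_prop]
theorem PT.headD {l : α → List β} {f : α → β} (hl : PT l) (hf : PT f) :
    PT fun x => (l x).headD (f x) := by
  have : PT fun x => lcase (l x) (f x) fun a _ => a := by fun_prop
  convert this using 2 with x
  cases l x <;> rfl

@[fun_prop]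
theorem PT.take_one {l : α → List β} (hl : PT l) : PT fun x => (l x).take 1 := by
  have : PT fun x => lcase (l x) [] fun a _ => [a] := by fun_prop
  convert this using 2 with x
  cases l x <;> rfl

@[fun_prop]
theorem PT.reverse {l : α → List β} (hl : PT l) : PT fun x => (l x).reverse := by
  have : PT fun x => (l x).foldl (fun s a => a :: s) [] := by
    refine PT.foldl hl (.const _) (by fun_prop) ⟨fun x => sz (l x), hl.pb, fun x a ha s => ?_⟩
    have := sz_le_of_mem ha
    simp only [sz_list_cons]
    omega
  convert this using 2 with x
  simp

@[fun_prop]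
theorem PT.append {l l' : α → List β} (hl : PT l) (hl' : PT l') : PT fun x => l x ++ l' x := by
  have : PT fun x => (l x).reverse.foldl (fun s a => a :: s) (l' x) := by
    refine PT.foldl (by fun_prop) hl' (by fun_prop) ⟨fun x => sz (l x), hl.pb, fun x a ha s => ?_⟩
    have := sz_le_of_mem (List.mem_reverse.1 ha)
    simp only [sz_list_cons]
    omega
  convert this using 2 with x
  simp

/-- A polynomial bound for the values of a function at the members of a list. -/
theorem PT.exists_mem_bound {l : γ → List α} {f : γ → α → β} (hl : PT l)
    (hf : PT fun p : γ × α => f p.1 p.2) :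
    ∃ g, PB g ∧ ∀ x, ∀ a ∈ l x, sz (f x a) ≤ g x := by
  obtain ⟨k, hk⟩ := hf.pb
  refine ⟨fun x => (sz x + sz (l x) + 2) ^ k, ((PB.size.add hl.pb).add (.const 2)).pow k,
    fun x a ha => (hk (x, a)).trans (Nat.pow_le_pow_left ?_ k)⟩
  have := sz_le_of_mem ha
  simp only [sz_pair]
  omega

@[fun_prop]
theorem PT.flatMap {l : γ → List α} {f : γ → α → List β} (hl : PT l)
    (hf : PT fun p : γ × α => f p.1 p.2) : PT fun x => (l x).flatMap (f x) := by
  have : PT fun x => (l x).foldl (fun s a => s ++ f x a) [] := by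
    obtain ⟨g, hg, h⟩ := hl.exists_mem_bound hf
    refine PT.foldl hl (.const _) ?_ ⟨g, hg, fun x a ha s => ?_⟩
    · exact .append (by fun_prop) (hf.comp (g := fun p : γ × List β × α => (p.1, p.2.2)) (by fun_prop))
    · have := h x a ha
      simp only [sz_list_append]
      omega
  convert this using 2 with x
  rw [List.foldl_append_eq_append]
  rfl

@[fun_prop]
theorem PT.map {l : γ → List α} {f : γ → α → β} (hl : PT l)
    (hf : PT fun p : γ × α => f p.1 p.2) : PT fun x => (l x).map (f x) := by
  have : PT fun x => (l x).flatMap fun a => [f x a] := by fun_prop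
  convert this using 2 with x
  exact List.map_eq_flatMap

@[fun_prop]
theorem PT.filter {l : γ → List α} {f : γ → α → Bool} (hl : PT l)
    (hf : PT fun p : γ × α => f p.1 p.2) : PT fun x => (l x).filter (f x) := by
  have : PT fun x => (l x).flatMap fun a => cond (f x a) [a] [] := by fun_prop
  convert this using 2 with x
  induction l x with
  | nil => rfl
  | cons a l ih => cases h : f x a <;> simp [h, ih]

theorem XT.any {e : γ → ℕ} {e' : γ × α → ℕ} {l : γ → List α} {f : γ → α → Bool} (hl : PT l)
    (hf : XT e' fun p : γ × α => f p.1 p.2) (he : ∀ x, ∀ a ∈ l x, e' (x, a) ≤ e x) :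
    XT e fun x => (l x).any (f x) := by
  have : XT e fun x => (l x).foldl (fun s a => cond s true (f x a)) false := by
    have h1 : XT (fun p : γ × Bool × α => e' (p.1, p.2.2)) fun p : γ × Bool × α => f p.1 p.2.2 :=
      XT.comp hf (PT.xt (by fun_prop) _) (fun _ => le_rfl) fun _ => le_rfl
    refine XT.foldl hl (.const _) (.bcond (PT.xt (by fun_prop) _) (PT.xt (by fun_prop) _) h1)
      (fun x a ha s => he x a ha) ⟨fun x => 1, .const 1, fun x a ha s => ?_⟩
    exact (sz_bool_le _).trans (Nat.le_add_left 1 _)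
  convert this using 2 with x
  generalize l x = l
  have key (s : Bool) : l.foldl (fun s a => cond s true (f x a)) s = (s || l.any (f x)) := by
    induction l generalizing s with
    | nil => simp
    | cons a l ih => cases s <;> simp only [List.foldl_cons, ih, List.any_cons, cond_true, cond_false,
        Bool.true_or, Bool.false_or]
  rw [key, Bool.false_or]

@[fun_prop]
theorem PT.any {l : γ → List α} {f : γ → α → Bool} (hl : PT l)
    (hf : PT fun p : γ × α => f p.1 p.2) : PT fun x => (l x).any (f x) :=
  XT.any hl hf fun _ _ _ => le_rfl

@[fun_prop]
theorem PT.zip {l : γ → List α} {l' : γ → List β} (hl : PT l) (hl' : PT l') :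
    PT fun x => (l x).zip (l' x) := by
  have : PT fun x => ((l x).foldl (fun (s : List β × List (α × β)) a =>
      lcase s.1 s fun b r => (r, (a, b) :: s.2)) (l' x, [])).2.reverse := by
    refine .reverse (.snd (PT.foldl hl (by fun_prop) ?_ ⟨fun x => sz (l x) + 1, hl.pb.add (.const 1),
      fun x a ha s => ?_⟩))
    · fun_prop
    · have := sz_le_of_mem ha
      obtain ⟨_ | ⟨b, r⟩, s⟩ := s
      · simp
      · simp
        omega
  convert this using 2 with x
  generalize l x = l
  generalize l' x = l'
  have key (s : List (α × β)) : (l.foldl (fun (s : List β × List (α × β)) a =>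
      lcase s.1 s fun b r => (r, (a, b) :: s.2)) (l', s)).2 = (l.zip l').reverse ++ s := by
    induction l generalizing l' s with
    | nil => simp
    | cons a l ih =>
      cases l' with
      | nil => simpa using ih [] s
      | cons b l' => simp [ih]
  simp [key]

@[fun_prop]
theorem PT.succ {f : α → ℕ} (hf : PT f) : PT fun x => f x + 1 := by
  refine PT.comp (f := fun n : ℕ => n + 1) ?_ hf
  exact Cmp.pt (.of_expr (.cons .nil (.var 0)) fun _ _ _ => .cons .nil (.var rfl)) (.const _)
    (PB.size.add (.const 1))

-- A unary number and a list of copies of `false` are the same tree, so nothing has to be computed.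
-- Folding over this list is how a loop with `f x` rounds is expressed.
@[fun_prop]
theorem PT.replicate_false {f : α → ℕ} (hf : PT f) : PT fun x => List.replicate (f x) false := by
  refine PT.comp (f := fun n : ℕ => List.replicate n false) ?_ hf
  refine Cmp.pt (T := fun _ => 1) (.of_expr (.var 0) fun _ n _ => ?_) (.const _)
    (((PB.const 2).mul PB.size).mono fun n => by simpa using sz_list_bool_le (List.replicate n false))
  refine .var (congrArg some ?_)
  show _ = Data.ofList ((List.replicate n false).map enc)
  rw [List.map_replicate]
  rfl

@[fun_prop]
theorem PT.drop {l : α → List β} {f : α → ℕ} (hl : PT l) (hf : PT f) :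
    PT fun x => (l x).drop (f x) := by
  have : PT fun x => (List.replicate (f x) false).foldl (fun s _ => s.tail) (l x) := by
    refine PT.foldl (by fun_prop) hl (by fun_prop) ⟨fun x => 0, .const 0, fun x a ha s => ?_⟩
    exact sz_sublist_le (List.tail_sublist s)
  convert this using 2 with x
  generalize l x = l
  induction f x generalizing l with
  | zero => simp
  | succ n ih => simp [List.replicate_succ, ← ih]

@[fun_prop]
theorem PT.getD {l : α → List β} {f : α → ℕ} {g : α → β} (hl : PT l) (hf : PT f) (hg : PT g) :
    PT fun x => (l x).getD (f x) (g x) := by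
  have : PT fun x => ((l x).drop (f x)).headD (g x) := by fun_prop
  convert this using 2 with x
  simp [List.headD_eq_head?_getD, List.getD_eq_getElem?_getD]

@[fun_prop]
theorem PT.beq {f g : α → ℕ} (hf : PT f) (hg : PT g) : PT fun x => f x == g x := by
  have : PT fun x => ((List.replicate (f x) false).drop (g x)).isEmpty &&
    ((List.replicate (g x) false).drop (f x)).isEmpty := by fun_prop
  convert this using 2 with x
  rw [Bool.eq_iff_iff]
  simp
  omega

@[fun_prop]
theorem PT.length {l : α → List β} (hl : PT l) : PT fun x => (l x).length := by
  have : PT fun x => (l x).foldl (fun n _ => n + 1) 0 := by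
    refine PT.foldl hl (.const _) (by fun_prop) ⟨fun x => 1, .const 1, fun x a ha s => ?_⟩
    simp
  convert this using 2 with x
  simp

@[fun_prop]
theorem PT.sub {f g : α → ℕ} (hf : PT f) (hg : PT g) : PT fun x => f x - g x := by
  have : PT fun x => ((List.replicate (f x) false).drop (g x)).length := by fun_prop
  convert this using 2 with x
  simp

@[fun_prop]
theorem PT.range_length {l : α → List β} (hl : PT l) : PT fun x => List.range (l x).length := by
  have : PT fun x => ((l x).foldl (fun (s : List β × List ℕ) _ =>
      (s.1.tail, ((l x).length - s.1.length) :: s.2)) (l x, [])).2.reverse := by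
    refine .reverse (.snd (PT.foldl hl (by fun_prop) (by fun_prop)
      ⟨fun x => sz (l x) + 1, hl.pb.add (.const 1), fun x a ha s => ?_⟩))
    have h1 := length_le_sz (l x)
    have h2 := sz_sublist_le (List.tail_sublist s.1)
    simp only [sz_pair, sz_list_cons, sz_nat]
    omega
  convert this using 2 with x
  have key (k : ℕ) (r r' : List β) (t : List ℕ) (hr : r.length = r'.length) :
      (r'.foldl (fun (s : List β × List ℕ) _ =>
        (s.1.tail, (k + r.length - s.1.length) :: s.2)) (r, t)).2 =
        ((List.range r.length).map (k + ·)).reverse ++ t := by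
    induction r' generalizing k r t with
    | nil => simp [List.length_eq_zero_iff.1 hr]
    | cons a r' ih =>
      obtain _ | ⟨b, r⟩ := r
      · simp at hr
      · have := ih (k + 1) r (k :: t) (by simpa using hr)
        simp only [List.length_cons, List.foldl_cons, List.tail_cons, Nat.add_sub_cancel]
        rw [show k + (r.length + 1) = k + 1 + r.length by ring, this, List.range_succ_eq_map]
        simp [Function.comp_def]
        omega
  have := key 0 (l x) (l x) [] rfl
  simp only [zero_add, List.append_nil] at this
  simp [this]

/-- The left subtree. -/
def Data.left : Data → Data
  | nil => nil
  | cons a _ => a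

/-- The right subtree. -/
def Data.right : Data → Data
  | nil => nil
  | cons _ b => b

/-- The list represented by a tree. -/
def Data.toList : Data → List Data
  | nil => []
  | cons a b => a :: b.toList

/-- The list of Booleans represented by a tree. -/
def Data.toBools (d : Data) : List Bool := d.toList.map fun a => !a.toList.isEmpty

@[fun_prop]
theorem PT.left {f : α → Data} (hf : PT f) : PT fun x => (f x).left := by
  refine PT.comp (f := Data.left) ?_ hf
  refine Cmp.pt (T := fun _ => 3) (.of_expr (.cases (.var 0) .nil (.var 0)) fun _ d _ => ?_)
    (.const _) (PB.size.mono fun d => ?_)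
  · cases d with
    | nil => exact .casesNil (.var rfl) .nil
    | cons a b => exact .casesCons (.var rfl) (.var rfl)
  · cases d <;> simp [Data.left, Data.height]; omega

@[fun_prop]
theorem PT.right {f : α → Data} (hf : PT f) : PT fun x => (f x).right := by
  refine PT.comp (f := Data.right) ?_ hf
  refine Cmp.pt (T := fun _ => 3) (.of_expr (.cases (.var 0) .nil (.var 1)) fun _ d _ => ?_)
    (.const _) (PB.size.mono fun d => ?_)
  · cases d with
    | nil => exact .casesNil (.var rfl) .nil
    | cons a b => exact .casesCons (.var rfl) (.var rfl)
  · cases d <;> simp [Data.right, Data.height]; omega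

theorem Data.enc_toList (d : Data) : enc d.toList = d := by
  induction d with
  | nil => rfl
  | cons a b _ ih => simp [Data.toList, ih]

/-- The right spine has at most `d.height` cells, and the trees hanging off it are lower than `d`.
-/
theorem Data.sz_toList_le (d : Data) : sz d.toList ≤ d.height * (d.height + 1) := by
  induction d with
  | nil => simp [Data.toList]
  | cons a b _ ih =>
    simp only [toList, sz_list_cons, height, sz_data]
    have h1 : a.height ≤ max a.height b.height := le_max_left _ _
    have h2 : b.height ≤ max a.height b.height := le_max_right _ _
    nlinarith

@[fun_prop]
theorem PT.toList {f : α → Data} (hf : PT f) : PT fun x => (f x).toList := by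
  refine PT.comp (f := Data.toList) ?_ hf
  exact Cmp.pt (.of_expr (.var 0) fun _ d _ => .var (by simp [Data.enc_toList])) (.const _)
    ((PB.size.mul (PB.size.add (.const 1))).mono Data.sz_toList_le)

@[fun_prop]
theorem PT.toBools {f : α → Data} (hf : PT f) : PT fun x => (f x).toBools := by
  unfold Data.toBools
  fun_prop

theorem height_enc_bools (l : List Bool) : (enc l).height ≤ l.length + 1 := by
  induction l with
  | nil => simp [Data.height]
  | cons a l ih => cases a <;> simp [Data.height] <;> omega

theorem Data.toBools_enc (l : List Bool) : (enc l).toBools = l := by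
  induction l with
  | nil => rfl
  | cons a l ih => cases a <;> simp_all [Data.toBools, Data.toList]

@[fun_prop]
theorem PT.enc_bools {f : α → List Bool} (hf : PT f) : PT fun x => enc (f x) := by
  refine PT.comp (f := fun l : List Bool => enc l) ?_ hf
  exact Cmp.pt (.of_expr (.var 0) fun _ d _ => .var rfl) (.const _)
    ((PB.size.add (.const 1)).mono fun l => (height_enc_bools l).trans (by
      have := length_le_sz l
      omega))

@[fun_prop]
theorem PT.data_cons {f g : α → Data} (hf : PT f) (hg : PT g) : PT fun x => Data.cons (f x) (g x) := by
  refine PT.comp (f := fun p : Data × Data => Data.cons p.1 p.2) ?_ (hf.pair hg)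
  exact Cmp.pt (.of_expr (.var 0) fun _ d _ => .var rfl) (.const _)
    ((PB.size.add (.const 1)).mono fun l => by simp [Data.height])

end ListLib

/-! ## Truncated polynomials over the field with two elements -/

/-- Sum of polynomials, given by their lists of coefficients. -/
def padd (p q : List Bool) : List Bool :=
  let r := p.foldl (fun (s : List Bool × List Bool) a => (s.1.tail, (a ^^ s.1.headD false) :: s.2))
    (q, [])
  r.2.reverse ++ r.1

/-- Truncation to the length of `L`. -/
def trunc (L p : List Bool) : List Bool := (p.zip L).map Prod.fst

/-- Truncated product. -/
def mulT (L p q : List Bool) : List Bool :=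
  p.reverse.foldl (fun s a => trunc L (padd (cond a q []) (false :: s))) []

/-- Truncated product of a list of polynomials. -/
def prodT (L : List Bool) (ps : List (List Bool)) : List Bool :=
  ps.foldl (fun s p => mulT L p s) (trunc L [true])

/-- Truncated sum of four polynomials. -/
def addT (L a b c d : List Bool) : List Bool := trunc L (padd (padd a b) (padd c d))

section

variable {α : Type} [Enc α]

@[fun_prop]
theorem PT.padd {p q : α → List Bool} (hp : PT p) (hq : PT q) : PT fun x => padd (p x) (q x) := by
  unfold _root_.padd
  have : PT fun x => (p x).foldl (fun (s : List Bool × List Bool) a =>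
      (s.1.tail, (a ^^ s.1.headD false) :: s.2)) (q x, []) := by
    refine PT.foldl hp (by fun_prop) (by fun_prop) ⟨fun _ => 2, .const 2, fun x a _ s => ?_⟩
    have h1 := sz_bool_le (a ^^ s.1.headD false)
    have h2 := sz_sublist_le (List.tail_sublist s.1)
    simp only [sz_pair, sz_list_cons]
    omega
  fun_prop

@[fun_prop]
theorem PT.trunc {p q : α → List Bool} (hp : PT p) (hq : PT q) : PT fun x => trunc (p x) (q x) := by
  unfold _root_.trunc
  fun_prop

theorem length_trunc_le (L p : List Bool) : (trunc L p).length ≤ L.length := by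
  simp [trunc]

theorem length_mulT_le (L p q : List Bool) : (mulT L p q).length ≤ L.length := by
  unfold mulT
  rcases List.eq_nil_or_concat p.reverse with h | ⟨l, a, h⟩
  · simp [h]
  · rw [h, List.concat_eq_append, List.foldl_append]
    exact length_trunc_le _ _

theorem length_prodT_le (L : List Bool) (ps : List (List Bool)) :
    (prodT L ps).length ≤ L.length := by
  unfold prodT
  rcases List.eq_nil_or_concat ps with h | ⟨l, a, h⟩
  · rw [h]
    exact length_trunc_le _ _
  · rw [h, List.concat_eq_append, List.foldl_append]
    exact length_mulT_le _ _ _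

theorem sz_le_of_length_le {p : List Bool} {n : ℕ} (h : p.length ≤ n) : sz p ≤ 2 * n :=
  (sz_list_bool_le p).trans (by omega)

@[fun_prop]
theorem PT.mulT {L p q : α → List Bool} (hL : PT L) (hp : PT p) (hq : PT q) :
    PT fun x => mulT (L x) (p x) (q x) := by
  unfold _root_.mulT
  refine PT.foldl (by fun_prop) (by fun_prop) (by fun_prop)
    ⟨fun x => 2 * sz (L x), (PB.const 2).mul hL.pb, fun x a _ s => ?_⟩
  have h1 := sz_le_of_length_le (length_trunc_le (L x) (_root_.padd (cond a (q x) []) (false :: s)))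
  have h2 := length_le_sz (L x)
  beta_reduce
  omega

@[fun_prop]
theorem PT.prodT {L : α → List Bool} {ps : α → List (List Bool)} (hL : PT L) (hp : PT ps) :
    PT fun x => prodT (L x) (ps x) := by
  unfold _root_.prodT
  refine PT.foldl (by fun_prop) (by fun_prop) (by fun_prop)
    ⟨fun x => 2 * sz (L x), (PB.const 2).mul hL.pb, fun x a _ s => ?_⟩
  have h1 := sz_le_of_length_le (length_mulT_le (L x) a s)
  have h2 := length_le_sz (L x)
  beta_reduce
  omega

@[fun_prop]
theorem PT.addT {L a b c d : α → List Bool} (hL : PT L) (ha : PT a) (hb : PT b) (hc : PT c)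
    (hd : PT d) : PT fun x => addT (L x) (a x) (b x) (c x) (d x) := by
  unfold _root_.addT
  fun_prop

end

/-! ## The algorithm -/

/-- A vertex: its index, its random weight, and its row in the adjacency matrix. -/
abbrev VRec : Type := ℕ × List Bool × List Bool

/-- A vertex, its membership in the bag of a node and of the parent of the node, and its color. -/
abbrev Loc : Type := VRec × Bool × Bool × Color

/-- The monomial that marks a cut edge, the bound for the degrees, the terminals, the vertices. -/
abbrev Ctx : Type := List Bool × List Bool × ℕ × ℕ × List VRec

/-- A node of the tree: its index, its row in the adjacency matrix, and its bag. -/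
abbrev NRec : Type := ℕ × List Bool × List Bool

/-- A message: the index of the node it is sent to, the set of its vertices, and a table. -/
abbrev Msg : Type := ℕ × List Bool × Data

/-- The factor of an ordered pair of distinct adjacent vertices. -/
def edgeFac (zB : List Bool) (a b : Color) : List Bool :=
  cond (a.1 ^^ b.1) (cond a.1 zB [true]) (cond (a.2 ^^ b.2) [] [true])

/-- The factor of a vertex. -/
def vertFac (s t i : ℕ) (w : List Bool) (a : Color) : List Bool :=
  cond ((i == s && (!a.1 || a.2)) || (i == t && (a.1 || a.2))) [] (cond a.1 w [true])

/-- The factor of an ordered pair of vertices, counted at the topmost bag that contains both. -/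
def pairFac (cx : Ctx) (u v : Loc) : List Bool :=
  cond (u.2.1 && v.2.1 && !(u.2.2.1 && v.2.2.1))
    (cond (u.1.1 == v.1.1) (vertFac cx.2.2.1 cx.2.2.2.1 u.1.1 u.1.2.1 u.2.2.2)
      (cond (u.1.2.2.getD v.1.1 false) (edgeFac cx.1 u.2.2.2 v.2.2.2) [true])) [true]

/-- The factors counted at a node with a given parent. -/
def localFacs (cx : Ctx) (e : NRec × NRec) (c : List Color) : List (List Bool) :=
  let us : List Loc := cx.2.2.2.2.zip (e.1.2.2.zip (e.2.2.2.zip c))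
  us.flatMap fun u => us.map fun v => pairFac cx u v

/-- The subtable of a color. -/
def child (q : Color) (T : Data) : Data :=
  cond q.2 (cond q.1 T.right T.left).right (cond q.1 T.right T.left).left

/-- The entry of a table for a coloring. -/
def lookup (mask : List Bool) (T : Data) (c : List Color) : List Bool :=
  ((mask.zip c).foldl (fun T e => cond e.1 (child e.2 T) T) T).toBools

/-- The product of the local factors and the received messages. -/
def leafVal (cx : Ctx) (e : NRec × NRec) (ms : List Msg) (c : List Color) : List Bool :=
  prodT cx.2.1 (localFacs cx e c ++
    (ms.filter fun m => m.1 == e.1.1).map fun m => lookup m.2.1 m.2.2 c)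

/-- The vertices of a bag that are also in the bag of the parent. -/
def commonMask (e : NRec × NRec) : List Bool := (e.1.2.2.zip e.2.2.2).map fun b => b.1 && b.2

/-- The vertices of a bag that are not in the bag of the parent. -/
def forgetMask (e : NRec × NRec) : List Bool := (e.1.2.2.zip e.2.2.2).map fun b => b.1 && !b.2

/-- Sum over the colorings of the vertices to be forgotten. -/
def sumForget (cx : Ctx) (e : NRec × NRec) (ms : List Msg) (c : List Color) : List Bool :=
  enum (addT cx.2.1) (fun c' => leafVal cx e ms c'.reverse) (c.zip (forgetMask e)) []

/-- A node of a table, for one vertex. -/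
def node4 (a b c d : Data) : Data := .cons (.cons a b) (.cons c d)

/-- The message of a node to its parent. -/
def message (cx : Ctx) (e : NRec × NRec) (ms : List Msg) : Msg :=
  (e.2.1, commonMask e, enum node4 (fun c => enc (sumForget cx e ms c.reverse))
    ((commonMask e).map fun b => ((false, false), b)) [])

/-- The pairs of nodes. -/
def nodePairs (nodes : List NRec) : List (NRec × NRec) :=
  nodes.flatMap fun j => nodes.map fun p => (j, p)

/-- Whether `j` is a new node with the neighbor `p` that has been visited before. -/
def isNext (st : List (NRec × NRec)) (e : NRec × NRec) : Bool :=
  e.2.2.1.getD e.1.1 false && !(st.any fun d => d.1.1 == e.1.1) && st.any fun d => d.1.1 == e.2.1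

/-- Visits one more node. -/
def growStep (nodes : List NRec) (st : List (NRec × NRec)) : List (NRec × NRec) :=
  ((nodePairs nodes).filter (isNext st)).take 1 ++ st

/-- The nodes with their parents, in the reverse of the order in which they are visited. -/
def order (dummy : NRec) (nodes : List NRec) : List (NRec × NRec) :=
  nodes.foldl (fun st _ => growStep nodes st) ((nodes.take 1).map fun r => (r, dummy))

/-- All messages, the one of the root first. -/
def messages (cx : Ctx) (es : List (NRec × NRec)) : List Msg :=
  es.foldl (fun ms e => message cx e ms :: ms) []

/-- `n ^ 2` zeros. -/
def zeros (adj : List (List Bool)) : List Bool := adj.flatMap fun r => r.map fun _ => false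

/-- The list of vertices. -/
def verts (W adj : List (List Bool)) : List VRec := (List.range adj.length).zip (W.zip adj)

/-- The context. -/
def mkCtx (W adj : List (List Bool)) (s t : ℕ) : Ctx :=
  (zeros adj ++ [true], ((zeros adj).flatMap fun _ => zeros adj) ++ zeros adj, s, t, verts W adj)

/-- The parent of the root. -/
def dummyNode (adj : List (List Bool)) : NRec := (0, [], adj.map fun _ => false)

/-- The list of nodes. -/
def mkNodes (tree bags : List (List Bool)) : List NRec :=
  (List.range tree.length).zip (tree.zip bags)

/-- The number with binary digits `kb`, in unary, but at most the length of `cap`. -/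
def unary (cap kb : List Bool) : List Bool :=
  kb.reverse.foldl (fun s b => trunc cap (s ++ s ++ cond b [false] [])) []

/-- The data of an instance. -/
abbrev Inst : Type := List (List Bool) × List (List Bool) × List (List Bool) × List Bool

/-- The generating polynomial of the minimal cuts. -/
def cutPoly (W : List (List Bool)) (x : Inst) (s t : ℕ) : List Bool :=
  trunc (mkCtx W x.1 s t).2.1 ((messages (mkCtx W x.1 s t)
    (order (dummyNode x.1) (mkNodes x.2.1 x.2.2.1))).headD (0, [], .nil)).2.2.toBools

/-- The test for a large minimal cut between `s` and `t`, for given random weights. -/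
def stTest (W : List (List Bool)) (x : Inst) (s t : ℕ) : Bool :=
  ((cutPoly W x s t).drop ((unary (zeros x.1 ++ [false]) x.2.2.2).flatMap
    fun _ => zeros x.1).length).any fun b => b

/-- The test for a large minimal cut, for given random weights. -/
def cutTest (W : List (List Bool)) (x : Inst) : Bool :=
  x.2.2.2.isEmpty || (List.range x.1.length).any fun t => stTest W x 0 t

/-- The maximal size of a bag. -/
def maxBag (bags : List (List Bool)) : ℕ := (bags.map fun b => b.countP fun a => a).foldr max 0

/-! ### Running time of the dynamic program -/

section

variable {α : Type} [Enc α]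

@[fun_prop]
theorem PT.edgeFac {z : α → List Bool} {a b : α → Color} (hz : PT z) (ha : PT a) (hb : PT b) :
    PT fun x => edgeFac (z x) (a x) (b x) := by
  unfold _root_.edgeFac
  fun_prop

@[fun_prop]
theorem PT.vertFac {s t i : α → ℕ} {w : α → List Bool} {a : α → Color} (hs : PT s) (ht : PT t)
    (hi : PT i) (hw : PT w) (ha : PT a) : PT fun x => vertFac (s x) (t x) (i x) (w x) (a x) := by
  unfold _root_.vertFac
  fun_prop

@[fun_prop]
theorem PT.pairFac {cx : α → Ctx} {u v : α → Loc} (hc : PT cx) (hu : PT u) (hv : PT v) :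
    PT fun x => pairFac (cx x) (u x) (v x) := by
  unfold _root_.pairFac
  fun_prop

@[fun_prop]
theorem PT.localFacs {cx : α → Ctx} {e : α → NRec × NRec} {c : α → List Color} (hc : PT cx)
    (he : PT e) (hv : PT c) : PT fun x => localFacs (cx x) (e x) (c x) := by
  unfold _root_.localFacs
  fun_prop

theorem Data.height_left_le (T : Data) : T.left.height ≤ T.height := by
  cases T <;> simp [Data.left, Data.height]; omega

theorem Data.height_right_le (T : Data) : T.right.height ≤ T.height := by
  cases T <;> simp [Data.right, Data.height]; omega

theorem height_child_le (q : Color) (T : Data) : (child q T).height ≤ T.height := by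
  unfold child
  cases q.1 <;> cases q.2 <;> simp only [cond_true, cond_false]
  · exact (Data.height_left_le _).trans (Data.height_left_le _)
  · exact (Data.height_right_le _).trans (Data.height_left_le _)
  · exact (Data.height_left_le _).trans (Data.height_right_le _)
  · exact (Data.height_right_le _).trans (Data.height_right_le _)

@[fun_prop]
theorem PT.child {q : α → Color} {T : α → Data} (hq : PT q) (hT : PT T) :
    PT fun x => child (q x) (T x) := by
  unfold _root_.child
  fun_prop

@[fun_prop]
theorem PT.lookup {m : α → List Bool} {T : α → Data} {c : α → List Color} (hm : PT m) (hT : PT T)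
    (hc : PT c) : PT fun x => lookup (m x) (T x) (c x) := by
  unfold _root_.lookup
  refine .toBools (PT.foldl (by fun_prop) hT (by fun_prop) ⟨fun _ => 0, .const 0, fun x a _ s => ?_⟩)
  have := height_child_le a.2 s
  cases a.1 <;> simp [this]

@[fun_prop]
theorem PT.leafVal {cx : α → Ctx} {e : α → NRec × NRec} {ms : α → List Msg} {c : α → List Color}
    (hc : PT cx) (he : PT e) (hm : PT ms) (hv : PT c) :
    PT fun x => leafVal (cx x) (e x) (ms x) (c x) := by
  unfold _root_.leafVal
  fun_prop

@[fun_prop]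
theorem PT.commonMask {e : α → NRec × NRec} (he : PT e) : PT fun x => commonMask (e x) := by
  unfold _root_.commonMask
  fun_prop

@[fun_prop]
theorem PT.forgetMask {e : α → NRec × NRec} (he : PT e) : PT fun x => forgetMask (e x) := by
  unfold _root_.forgetMask
  fun_prop

theorem countP_zip_snd_le {β : Type} (l : List β) (m : List Bool) :
    (l.zip m).countP (·.2) ≤ m.countP fun a => a := by
  induction l generalizing m with
  | nil => simp
  | cons a l ih =>
    cases m with
    | nil => simp
    | cons b m =>
      have := ih m
      simp only [List.zip_cons_cons, List.countP_cons]
      omega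

theorem length_sumForget_le (cx : Ctx) (e : NRec × NRec) (ms : List Msg) (c : List Color) :
    (sumForget cx e ms c).length ≤ cx.2.1.length := by
  have key (l : List (Color × Bool)) (s : List Color) :
      (enum (addT cx.2.1) (fun c' => leafVal cx e ms c'.reverse) l s).length ≤ cx.2.1.length := by
    induction l generalizing s with
    | nil => exact length_prodT_le _ _
    | cons a l ih =>
      obtain ⟨q, _ | _⟩ := a
      · exact ih _
      · exact length_trunc_le _ _
  exact key _ _

theorem XT.sumForget : XT (fun p : (Ctx × (NRec × NRec) × List Msg) × List Color =>
    (forgetMask p.1.2.1).countP fun a => a)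
    fun p => sumForget p.1.1 p.1.2.1 p.1.2.2 p.2 := by
  unfold _root_.sumForget
  refine XT.mono (XT.enum (e := fun _ => 0) (e' := fun _ => 0) (by fun_prop) ?_ ?_
    (fun _ _ => le_rfl) ⟨fun p => 2 * sz p.1.1.2.1, ?_, fun x s => ?_, fun x a b c d k hk _ _ _ _ => ?_⟩)
    fun p => ?_
  · exact PT.leafVal (by fun_prop) (by fun_prop) (by fun_prop) (by fun_prop)
  · exact PT.addT (by fun_prop) (by fun_prop) (by fun_prop) (by fun_prop) (by fun_prop)
  · exact (PB.const 2).mul (PT.pb (f := fun p : (Ctx × (NRec × NRec) × List Msg) × List Color =>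
      p.1.1.2.1) (by fun_prop))
  · exact (sz_le_of_length_le (length_prodT_le _ _)).trans (Nat.mul_le_mul_left 2 (length_le_sz _))
  · have h1 := sz_le_of_length_le (length_trunc_le x.1.1.2.1 (padd (padd a b) (padd c d)))
    have h2 := length_le_sz x.1.1.2.1
    unfold addT
    beta_reduce at hk
    omega
  · rw [zero_add]
    exact countP_zip_snd_le _ _

/-- The outer enumeration of a message runs over the common vertices and the inner one over the
forgotten vertices. Since these are disjoint subsets of the bag, the two exponents add up to at most
the size of the bag. -/
theorem countP_masks (e : NRec × NRec) : ((forgetMask e).countP fun a => a) +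
    ((commonMask e).countP fun a => a) ≤ e.1.2.2.countP fun a => a := by
  unfold forgetMask commonMask
  generalize e.1.2.2 = l
  generalize e.2.2.2 = l'
  induction l generalizing l' with
  | nil => simp
  | cons a l ih =>
    cases l' with
    | nil => simp
    | cons b l' =>
      have := ih l'
      simp only [List.zip_cons_cons, List.map_cons, List.countP_cons]
      cases a <;> cases b <;> simp only [Bool.and_true, Bool.and_false, Bool.not_true, Bool.not_false,
        Bool.false_eq_true, if_true, if_false] <;> omega

/-- The bound does not involve `ms`: entries are truncated to the length of `cx.2.1`, so heights do
not accumulate from node to node. This is the additive growth that the fold over all nodes needs. -/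
theorem height_table_le (cx : Ctx) (e : NRec × NRec) (ms : List Msg) :
    (message cx e ms).2.2.height ≤ sz cx.2.1 + 1 + 2 * sz (commonMask e) := by
  have h := sz_enum_le (comb := node4) (leaf := fun c => enc (sumForget cx e ms c.reverse))
    (m := sz cx.2.1 + 1) (fun s => ?_) (fun a b c d k hk ha hb hc hd => ?_)
    ((commonMask e).map fun b => ((false, false), b)) []
  · refine h.trans ?_
    have := length_le_sz (commonMask e)
    simp only [List.length_map]
    omega
  · have h1 := height_enc_bools (_root_.sumForget cx e ms s.reverse)
    have h2 := length_sumForget_le cx e ms s.reverse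
    have h3 := length_le_sz cx.2.1
    simp only [sz_data]
    omega
  · simp only [sz_data, node4, Data.height] at *
    omega

theorem XT.message : XT (fun p : Ctx × (NRec × NRec) × List Msg => p.2.1.1.2.2.countP fun a => a)
    fun p => message p.1 p.2.1 p.2.2 := by
  have h1 : XT (fun p : (Ctx × (NRec × NRec) × List Msg) × List Color =>
      (forgetMask p.1.2.1).countP fun a => a)
      fun p => _root_.sumForget p.1.1 p.1.2.1 p.1.2.2 p.2.reverse :=
    XT.comp XT.sumForget (PT.xt (f := fun p : (Ctx × (NRec × NRec) × List Msg) × List Color =>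
      (p.1, p.2.reverse)) (by fun_prop) (fun _ => 0)) (fun _ => Nat.zero_le _) fun _ => le_rfl
  have h2 : XT (fun p : (Ctx × (NRec × NRec) × List Msg) × List Color =>
      (forgetMask p.1.2.1).countP fun a => a)
      fun p => enc (_root_.sumForget p.1.1 p.1.2.1 p.1.2.2 p.2.reverse) :=
    XT.comp (PT.enc_bools PT.id) h1 (fun _ => le_rfl) fun _ => Nat.zero_le _
  have h3 := XT.enum (γ := Ctx × (NRec × NRec) × List Msg)
    (l := fun p => (_root_.commonMask p.2.1).map fun b => (((false, false), b) : Color × Bool))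
    (leaf := fun p c => enc (_root_.sumForget p.1 p.2.1 p.2.2 c.reverse))
    (comb := fun _ => node4) (e := fun p => (forgetMask p.2.1).countP fun a => a)
    (e' := fun p => (forgetMask p.1.2.1).countP fun a => a) (by fun_prop) h2
    (by unfold node4; fun_prop) (fun _ _ => le_rfl) ⟨fun p => sz p.1.2.1 + 1,
      (PT.pb (f := fun p : Ctx × (NRec × NRec) × List Msg => p.1.2.1) (by fun_prop)).add (.const 1),
      fun x s => ?_, fun x a b c d k hk ha hb hc hd => ?_⟩
  · refine XT.pair (PT.xt (by fun_prop) _) (XT.pair (PT.xt (by fun_prop) _) (h3.mono fun p => ?_))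
    refine le_trans ?_ (countP_masks p.2.1)
    rw [List.countP_map]
    rfl
  · have h1 := height_enc_bools (_root_.sumForget x.1 x.2.1 x.2.2 s.reverse)
    have h2 := length_sumForget_le x.1 x.2.1 x.2.2 s.reverse
    have h3 := length_le_sz x.1.2.1
    simp only [sz_data]
    omega
  · simp only [sz_data, node4, Data.height] at *
    omega

@[fun_prop]
theorem PT.nodePairs {l : α → List NRec} (hl : PT l) : PT fun x => nodePairs (l x) := by
  unfold _root_.nodePairs
  fun_prop

@[fun_prop]
theorem PT.isNext {st : α → List (NRec × NRec)} {e : α → NRec × NRec} (hs : PT st) (he : PT e) :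
    PT fun x => isNext (st x) (e x) := by
  unfold _root_.isNext
  fun_prop

@[fun_prop]
theorem PT.order {d : α → NRec} {l : α → List NRec} (hd : PT d) (hl : PT l) :
    PT fun x => order (d x) (l x) := by
  unfold _root_.order
  refine PT.foldl hl (by fun_prop) (by unfold growStep; fun_prop)
    ⟨fun x => sz (_root_.nodePairs (l x)), PT.pb (by fun_prop), fun x _ _ s => ?_⟩
  have := sz_sublist_le ((List.take_sublist 1 ((_root_.nodePairs (l x)).filter
    (_root_.isNext s))).trans List.filter_sublist)
  simp only [growStep, sz_list_append]
  omega

/-- Needed for the time bound: the bag of every node in the elimination order is one of the bags of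
the input, hence no larger than `maxBag`. -/
theorem mem_of_mem_order {d : NRec} {l : List NRec} {e : NRec × NRec} (he : e ∈ order d l) :
    e.1 ∈ l := by
  have key (l' : List NRec) (st : List (NRec × NRec)) (h : ∀ e ∈ st, e.1 ∈ l) :
      ∀ e ∈ l'.foldl (fun st _ => growStep l st) st, e.1 ∈ l := by
    induction l' generalizing st with
    | nil => exact h
    | cons a l' ih =>
      refine ih _ fun e he => ?_
      rcases List.mem_append.1 he with he | he
      · have := List.mem_of_mem_filter (List.mem_of_mem_take he)
        simp only [nodePairs, List.mem_flatMap, List.mem_map] at this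
        obtain ⟨j, hj, p, _, rfl⟩ := this
        exact hj
      · exact h e he
  refine key l _ (fun e he => ?_) e he
  obtain ⟨r, hr, rfl⟩ := List.mem_map.1 he
  exact List.mem_of_mem_take hr

theorem XT.messages {cx : α → Ctx} {es : α → List (NRec × NRec)} (hc : PT cx) (hes : PT es)
    {e : α → ℕ} (he : ∀ x, ∀ a ∈ es x, a.1.2.2.countP (fun a => a) ≤ e x) :
    XT e fun x => messages (cx x) (es x) := by
  unfold _root_.messages
  have h1 : XT (fun p : α × List Msg × (NRec × NRec) => p.2.2.1.2.2.countP fun a => a)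
      fun p => _root_.message (cx p.1) p.2.2 p.2.1 :=
    XT.comp XT.message (PT.xt (f := fun p : α × List Msg × (NRec × NRec) => (cx p.1, p.2.2, p.2.1))
      (by fun_prop) (fun _ => 0)) (fun _ => Nat.zero_le _) fun _ => le_rfl
  obtain ⟨g, hg, hg'⟩ := hes.exists_mem_bound (f := fun _ a => (a.2.1, _root_.commonMask a))
    (by fun_prop)
  refine XT.foldl hes (.const _) (XT.comp (f := fun p : Msg × List Msg => p.1 :: p.2)
    (PT.xt (by fun_prop) fun _ => 0) (h1.pair (PT.xt (by fun_prop) _)) (fun _ => le_rfl)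
    fun _ => Nat.zero_le _) (fun x a ha s => he x a ha)
    ⟨fun x => 3 * g x + sz (cx x).2.1 + 2,
      (((PB.const 3).mul hg).add (PT.pb (f := fun x => (cx x).2.1) (by fun_prop))).add (.const 2),
      fun x a ha s => ?_⟩
  have h2 := hg' x a ha
  have h3 := height_table_le (cx x) a s
  simp only [sz_pair, sz_nat, sz_list_cons, sz_data] at *
  have h4 : (_root_.message (cx x) a s).1 = a.2.1 := rfl
  have h5 : (_root_.message (cx x) a s).2.1 = commonMask a := rfl
  rw [h4, h5]
  omega

@[fun_prop]
theorem PT.zeros {l : α → List (List Bool)} (hl : PT l) : PT fun x => zeros (l x) := by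
  unfold _root_.zeros
  fun_prop

@[fun_prop]
theorem PT.mkCtx {W adj : α → List (List Bool)} {s t : α → ℕ} (hW : PT W) (ha : PT adj) (hs : PT s)
    (ht : PT t) : PT fun x => mkCtx (W x) (adj x) (s x) (t x) := by
  unfold _root_.mkCtx verts
  fun_prop

@[fun_prop]
theorem PT.dummyNode {l : α → List (List Bool)} (hl : PT l) : PT fun x => dummyNode (l x) := by
  unfold _root_.dummyNode
  fun_prop

@[fun_prop]
theorem PT.mkNodes {l l' : α → List (List Bool)} (hl : PT l) (hl' : PT l') :
    PT fun x => mkNodes (l x) (l' x) := by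
  unfold _root_.mkNodes
  fun_prop

@[fun_prop]
theorem PT.unary {cap kb : α → List Bool} (hc : PT cap) (hk : PT kb) :
    PT fun x => unary (cap x) (kb x) := by
  unfold _root_.unary
  refine PT.foldl (by fun_prop) (by fun_prop) (by fun_prop)
    ⟨fun x => 2 * sz (cap x), (PB.const 2).mul hc.pb, fun x a _ s => ?_⟩
  have h1 := sz_le_of_length_le (length_trunc_le (cap x) (s ++ s ++ cond a [false] []))
  have h2 := length_le_sz (cap x)
  beta_reduce
  omega

theorem countP_le_maxBag {bags : List (List Bool)} {b : List Bool} (hb : b ∈ bags) :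
    b.countP (fun a => a) ≤ maxBag bags := by
  unfold maxBag
  induction bags with
  | nil => simp at hb
  | cons a l ih =>
    rcases List.mem_cons.1 hb with rfl | h
    · simp
    · simp [ih h]

theorem XT.stTest : XT (fun p : List (List Bool) × ℕ × ℕ × Inst => maxBag p.2.2.2.2.2.1)
    fun p => stTest p.1 p.2.2.2 p.2.1 p.2.2.1 := by
  have h1 : XT (fun p : List (List Bool) × ℕ × ℕ × Inst => maxBag p.2.2.2.2.2.1) fun p =>
      _root_.messages (mkCtx p.1 p.2.2.2.1 p.2.1 p.2.2.1)
        (order (dummyNode p.2.2.2.1) (mkNodes p.2.2.2.2.1 p.2.2.2.2.2.1)) := by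
    refine XT.messages (by fun_prop) (by fun_prop) fun x a ha => countP_le_maxBag ?_
    have h2 := mem_of_mem_order ha
    have h3 := (List.of_mem_zip h2).2
    exact (List.of_mem_zip h3).2
  exact XT.comp (f := fun q : (List (List Bool) × ℕ × ℕ × Inst) × List Msg =>
    ((trunc (mkCtx q.1.1 q.1.2.2.2.1 q.1.2.1 q.1.2.2.1).2.1
      (q.2.headD (0, [], .nil)).2.2.toBools).drop ((_root_.unary (_root_.zeros q.1.2.2.2.1 ++ [false])
      q.1.2.2.2.2.2.2).flatMap fun _ => _root_.zeros q.1.2.2.2.1).length).any fun b => b)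
    (PT.xt (by fun_prop) fun _ => 0) ((PT.xt PT.id _).pair h1) (fun _ => le_rfl)
    fun _ => Nat.zero_le _

theorem XT.cutTest : XT (fun p : List (List Bool) × Inst => maxBag p.2.2.2.1)
    fun p => cutTest p.1 p.2 := by
  have h1 : XT (fun p : List (List Bool) × Inst => maxBag p.2.2.2.1)
      fun p => (List.range p.2.1.length).any fun t => _root_.stTest p.1 p.2 0 t := by
    refine XT.any (e' := fun p => maxBag p.1.2.2.2.1) (by fun_prop) ?_ fun _ _ _ => le_rfl
    exact XT.comp XT.stTest (PT.xt (f := fun p : (List (List Bool) × Inst) × ℕ =>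
      (p.1.1, 0, p.2, p.1.2)) (by fun_prop) fun _ => 0) (fun _ => Nat.zero_le _) fun _ => le_rfl
  have h2 : XT (fun p : List (List Bool) × Inst => maxBag p.2.2.2.1) fun p =>
      cond p.2.2.2.2.isEmpty true
        ((List.range p.2.1.length).any fun t => _root_.stTest p.1 p.2 0 t) :=
    XT.bcond (PT.xt (by fun_prop) _) (PT.xt (by fun_prop) _) h1
  convert h2 using 2 with p
  unfold _root_.cutTest
  cases p.2.2.2.2.isEmpty <;> rfl

end

/-! ## Programs with coin tosses -/

/-- The number of coins used by a subevaluation is not known in advance, so equality of the two coin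
lists cannot be an assumption of the induction. That both are initial parts of one sequence can be:
it passes to the first subevaluation and, after cancellation, to the second. -/
theorem Eval.deterministic {P : Program} {env : List Data} {e : Expr} {r : List Bool} {v : Data}
    {t : ℕ} (h : Eval P env e r v t) : ∀ {r' s s' : List Bool} {v' : Data} {t' : ℕ},
    Eval P env e r' v' t' → r ++ s = r' ++ s' → r = r' ∧ v = v' ∧ t = t' := by
  induction h with
  | var h =>
    intro r' s s' v' t' h' hr
    cases h' with
    | var h' => simp_all
  | nil =>
    intro r' s s' v' t' h' hr
    cases h' with
    | nil => simp
  | cons h₁ h₂ ih₁ ih₂ =>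
    intro r' s s' v' t' h' hr
    cases h' with
    | cons h₁' h₂' =>
      simp only [List.append_assoc] at hr
      obtain ⟨rfl, rfl, rfl⟩ := ih₁ h₁' hr
      obtain ⟨rfl, rfl, rfl⟩ := ih₂ h₂' (List.append_cancel_left hr)
      simp
  | casesNil h₁ h₂ ih₁ ih₂ =>
    intro r' s s' v' t' h' hr
    cases h' with
    | casesNil h₁' h₂' =>
      simp only [List.append_assoc] at hr
      obtain ⟨rfl, -, rfl⟩ := ih₁ h₁' hr
      obtain ⟨rfl, rfl, rfl⟩ := ih₂ h₂' (List.append_cancel_left hr)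
      simp
    | casesCons h₁' h₂' =>
      simp only [List.append_assoc] at hr
      simpa using (ih₁ h₁' hr).2.1
  | casesCons h₁ h₂ ih₁ ih₂ =>
    intro r' s s' v' t' h' hr
    cases h' with
    | casesNil h₁' h₂' =>
      simp only [List.append_assoc] at hr
      simpa using (ih₁ h₁' hr).2.1
    | casesCons h₁' h₂' =>
      simp only [List.append_assoc] at hr
      obtain ⟨rfl, h, rfl⟩ := ih₁ h₁' hr
      simp only [Data.cons.injEq] at h
      obtain ⟨rfl, rfl⟩ := h
      obtain ⟨rfl, rfl, rfl⟩ := ih₂ h₂' (List.append_cancel_left hr)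
      simp
  | letIn h₁ h₂ ih₁ ih₂ =>
    intro r' s s' v' t' h' hr
    cases h' with
    | letIn h₁' h₂' =>
      simp only [List.append_assoc] at hr
      obtain ⟨rfl, rfl, rfl⟩ := ih₁ h₁' hr
      obtain ⟨rfl, rfl, rfl⟩ := ih₂ h₂' (List.append_cancel_left hr)
      simp
  | call hf h₁ h₂ ih₁ ih₂ =>
    intro r' s s' v' t' h' hr
    cases h' with
    | call hf' h₁' h₂' =>
      simp only [List.append_assoc] at hr
      obtain rfl : _ = _ := Option.some.inj (hf.symm.trans hf')
      obtain ⟨rfl, rfl, rfl⟩ := ih₁ h₁' hr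
      obtain ⟨rfl, rfl, rfl⟩ := ih₂ h₂' (List.append_cancel_left hr)
      simp
  | flip b =>
    intro r' s s' v' t' h' hr
    cases h' with
    | flip b' => simp_all

theorem Outputs.unique {P : Program} {x : Data} {ω : ℕ → Bool} {v v' : Data} {t t' : ℕ}
    (h : Outputs P x ω v t) (h' : Outputs P x ω v' t') : v = v' := by
  obtain ⟨m, h⟩ := h
  obtain ⟨m', h'⟩ := h'
  -- Both coin lists are extended to the first `max m m'` members of `ω`; truncated subtraction
  -- makes one of the two extensions empty.
  refine (h.deterministic (s := ((List.range (m' - m)).map (m + ·)).map ω)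
    (s' := ((List.range (m - m')).map (m' + ·)).map ω) h' ?_).2.1
  rw [← List.map_append, ← List.map_append, ← List.range_add, ← List.range_add]
  congr 2
  omega

/-- Tosses a coin for every member of a list. -/
def flipRow : Expr := .cases (.var 0) .nil (.cons .flip (.call 1 (.var 1)))

/-- Tosses a coin for every entry of a matrix. -/
def flipMatrix : Expr := .cases (.var 0) .nil (.cons (.call 1 (.var 0)) (.call 2 (.var 1)))

section

variable {α β : Type} [Enc α] [Enc β]

theorem eval_flipRow {P : Program} (hP : P[1]? = some flipRow) {l : List β} {r : List Bool}
    (h : r.length = l.length) : ∃ t ≤ 10 * l.length + 10, Eval P [enc l] flipRow r (enc r) t := by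
  induction l generalizing r with
  | nil =>
    obtain rfl := List.length_eq_zero_iff.1 h
    exact ⟨_, by simp, .casesNil (.var rfl) .nil⟩
  | cons a l ih =>
    obtain _ | ⟨b, r⟩ := r
    · simp at h
    · obtain ⟨t, ht, he⟩ := ih (r := r) (by simpa using h)
      refine ⟨_, ?_, .casesCons (.var rfl) (.cons (.flip b) (.call hP (.var rfl) he))⟩
      simp only [List.length_cons]
      omega

theorem eval_flipMatrix {P : Program} (h₁ : P[1]? = some flipRow) (h₂ : P[2]? = some flipMatrix)
    {l : List (List β)} {r : List (List Bool)} (h : r.map List.length = l.map List.length) :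
    ∃ t ≤ 50 * sz l + 10, Eval P [enc l] flipMatrix r.flatten (enc r) t := by
  induction l generalizing r with
  | nil =>
    obtain rfl : r = [] := by simpa using h
    exact ⟨_, by simp, .casesNil (.var rfl) .nil⟩
  | cons a l ih =>
    obtain _ | ⟨b, r⟩ := r
    · simp at h
    · simp only [List.map_cons, List.cons.injEq] at h
      obtain ⟨t, ht, he⟩ := ih h.2
      obtain ⟨t', ht', he'⟩ := eval_flipRow h₁ h.1
      have hev : Eval P [enc (a :: l)] flipMatrix ([] ++ (([] ++ b) ++ ([] ++ r.flatten))) _ _ :=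
        .casesCons (.var rfl) (.cons (.call h₁ (.var rfl) he') (.call h₂ (.var rfl) he))
      refine ⟨_, ?_, hev⟩
      have := length_le_sz a
      simp only [sz_list_cons]
      omega

theorem sz_le_of_map_length {l : List (List β)} {r : List (List Bool)}
    (h : r.map List.length = l.map List.length) : sz r ≤ 2 * sz l := by
  induction l generalizing r with
  | nil =>
    obtain rfl : r = [] := by simpa using h
    simp
  | cons a l ih =>
    obtain _ | ⟨b, r⟩ := r
    · simp at h
    · simp only [List.map_cons, List.cons.injEq] at h
      have h1 := ih h.2
      have h2 := sz_list_bool_le b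
      have h3 := length_le_sz a
      simp only [sz_list_cons]
      omega

/-- A program that tosses a coin for every entry of a matrix and calls a function. -/
theorem XT.exists_program {e : β → ℕ} {f : List (List Bool) × β → α} {M : β → List (List Bool)}
    (hf : XT (fun p => e p.2) f) (hM : PT M) :
    ∃ (P : Program) (g : β → ℕ), PB g ∧ ∀ (x : β) (W : List (List Bool)),
      W.map List.length = (M x).map List.length → ∃ t ≤ 4 ^ e x * g x,
        Eval P [enc x] (.call 0 (.var 0)) W.flatten (enc (f (W, x))) t := by
  obtain ⟨⟨g, ⟨k, hk⟩, cf⟩, -⟩ := hf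
  obtain ⟨⟨h, hh, cM⟩, sM⟩ := hM
  obtain ⟨n, P, d, d', hn, hv, hw⟩ := cf.both cM
  -- The shared code of `f` and `M` begins at position 3, behind the main function and the two
  -- functions that toss coins. The matrix serves only to prescribe the shape of the random one.
  let main : Expr := .letIn (.call 2 (d' 3)) (.letIn (.cons (.var 0) (.var 1)) (d 3))
  let Q : Program := [main, flipRow, flipMatrix] ++ (P 3 ++ [])
  refine ⟨Q, fun x => h x + 50 * sz (M x) + 30 + (2 * sz (M x) + sz x + 2) ^ k,
    ((hh.add ((PB.const 50).mul sM)).add (.const 30)).add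
      (((((PB.const 2).mul sM).add .size).add (.const 2)).pow k), fun x W hW => ?_⟩
  obtain ⟨t₁, ht₁, h₁⟩ := hw [main, flipRow, flipMatrix] [] x []
  obtain ⟨t₂, ht₂, h₂⟩ := eval_flipMatrix (P := Q) rfl rfl hW
  obtain ⟨t₃, ht₃, h₃⟩ := hv [main, flipRow, flipMatrix] [] (W, x) [enc W, enc x]
  have hev : Eval Q [enc x] (.call 0 (.var 0)) ([] ++ (([] ++ W.flatten) ++ (([] ++ []) ++ []))) _ _ :=
    .call (body := main) rfl (.var rfl) (.letIn (.call (body := flipMatrix) rfl h₁ h₂)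
      (.letIn (.cons (.var rfl) (.var rfl)) h₃))
  simp only [List.nil_append, List.append_nil] at hev
  refine ⟨_, ?_, hev⟩
  have h4 : 4 ^ e x * g (W, x) ≤ 4 ^ e x * (2 * sz (M x) + sz x + 2) ^ k := by
    refine Nat.mul_le_mul_left _ ((hk _).trans (Nat.pow_le_pow_left ?_ k))
    have := sz_le_of_map_length hW
    simp only [sz_pair]
    omega
  have h5 := le_four_pow_mul (e x) (h x + 50 * sz (M x) + 30)
  rw [mul_add]
  simp only [pow_zero, one_mul] at *
  omega

end

/-! ### Coefficient lists as polynomials over the field with two elements, modulo a power of the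
variable -/

open Polynomial in
/-- The polynomial with a given list of coefficients. -/
noncomputable def toPoly : List Bool → (ZMod 2)[X]
  | [] => 0
  | b :: l => (if b then 1 else 0) + X * toPoly l

/-- Polynomials modulo a power of the variable. -/
abbrev TruncPoly (k : ℕ) : Type :=
  Polynomial (ZMod 2) ⧸ Ideal.span {(Polynomial.X : Polynomial (ZMod 2)) ^ k}

/-- The truncated polynomial with a given list of coefficients. -/
noncomputable def val (k : ℕ) (p : List Bool) : TruncPoly k := Ideal.Quotient.mk _ (toPoly p)

section

open Polynomial

@[simp] theorem toPoly_nil : toPoly [] = 0 := rfl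

theorem toPoly_cons (b : Bool) (l : List Bool) :
    toPoly (b :: l) = (if b then 1 else 0) + X * toPoly l := rfl

@[simp] theorem toPoly_one : toPoly [true] = 1 := by simp [toPoly_cons]

theorem toPoly_append (p q : List Bool) : toPoly (p ++ q) = toPoly p + X ^ p.length * toPoly q := by
  induction p with
  | nil => simp
  | cons a p ih =>
    simp only [List.cons_append, toPoly_cons, ih, List.length_cons]
    ring

theorem toPoly_padd (p q : List Bool) : toPoly (padd p q) = toPoly p + toPoly q := by
  -- The accumulator `s` holds the coefficients already produced, in reverse; what remains to be
  -- added is therefore multiplied by `X ^ s.length`.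
  have key (s : List Bool) :
      let r := p.foldl (fun (s : List Bool × List Bool) a =>
        (s.1.tail, (a ^^ s.1.headD false) :: s.2)) (q, s)
      toPoly (r.2.reverse ++ r.1) = toPoly s.reverse + X ^ s.length * (toPoly p + toPoly q) := by
    induction p generalizing q s with
    | nil => simp [toPoly_append]
    | cons a p ih =>
      have h := ih q.tail ((a ^^ q.headD false) :: s)
      simp only [List.foldl_cons] at h ⊢
      rw [h]
      have hq : toPoly q = (if q.headD false then 1 else 0) + X * toPoly q.tail := by
        cases q <;> simp [toPoly_cons]
      have hx : (if (a ^^ q.headD false) = true then (1 : (ZMod 2)[X]) else 0) =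
          (if a then 1 else 0) + (if q.headD false then 1 else 0) := by
        have : (1 : (ZMod 2)[X]) + 1 = 0 := CharTwo.add_self_eq_zero 1
        cases a <;> cases q.headD false <;> simp [this]
      rw [hq]
      simp only [List.reverse_cons, toPoly_append, List.length_reverse, toPoly_cons, toPoly_nil,
        List.length_cons, hx]
      ring
  have h := key []
  simp only [List.reverse_nil, toPoly_nil, List.length_nil, pow_zero, one_mul, zero_add] at h
  exact h

theorem coeff_toPoly (p : List Bool) (i : ℕ) :
    (toPoly p).coeff i = if p.getD i false then 1 else 0 := by
  induction p generalizing i with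
  | nil => simp
  | cons a p ih =>
    cases i with
    | zero => cases a <;> simp [toPoly_cons]
    | succ i => cases a <;> simp [toPoly_cons, ih, coeff_one]

theorem val_eq_iff {k : ℕ} {p q : (ZMod 2)[X]} :
    (Ideal.Quotient.mk (Ideal.span {X ^ k}) p) = Ideal.Quotient.mk (Ideal.span {X ^ k}) q ↔
      ∀ i < k, p.coeff i = q.coeff i := by
  rw [Ideal.Quotient.eq, Ideal.mem_span_singleton, X_pow_dvd_iff]
  simp [sub_eq_zero]

variable {k : ℕ}

@[simp] theorem val_nil : val k [] = 0 := by simp [val]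

@[simp] theorem val_one : val k [true] = 1 := by simp [val]

theorem val_padd (p q : List Bool) : val k (padd p q) = val k p + val k q := by
  simp [val, toPoly_padd]

theorem trunc_eq_take (L p : List Bool) : trunc L p = p.take L.length := by
  unfold trunc
  induction p generalizing L with
  | nil => simp
  | cons a p ih => cases L <;> simp [ih]

theorem val_trunc {L : List Bool} (hL : L.length = k) (p : List Bool) :
    val k (trunc L p) = val k p := by
  rw [trunc_eq_take, val, val, val_eq_iff]
  intro i hi
  simp [coeff_toPoly, List.getD_eq_getElem?_getD, hL, hi]

/-- This is Horner's scheme, from the highest coefficient of `p` down; the truncation after each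
round is invisible in the quotient ring. -/
theorem val_mulT {L : List Bool} (hL : L.length = k) (p q : List Bool) :
    val k (mulT L p q) = val k p * val k q := by
  unfold mulT
  rw [List.foldl_reverse]
  induction p with
  | nil => simp
  | cons a p ih =>
    rw [List.foldr_cons, val_trunc hL, val_padd]
    have h (l : List Bool) (b : Bool) : val k (b :: l) =
        (if b then 1 else 0) + Ideal.Quotient.mk _ X * val k l := by
      simp only [val, toPoly_cons, map_add, map_mul]
      cases b <;> simp
    rw [h, h, ih]
    cases a <;> simp <;> ring

theorem val_prodT {L : List Bool} (hL : L.length = k) (ps : List (List Bool)) :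
    val k (prodT L ps) = (ps.map (val k)).prod := by
  have key (s : List Bool) : val k (ps.foldl (fun s p => mulT L p s) s) =
      (ps.map (val k)).prod * val k s := by
    induction ps generalizing s with
    | nil => simp
    | cons p ps ih =>
      rw [List.foldl_cons, ih, val_mulT hL, List.map_cons, List.prod_cons]
      ring
  rw [prodT, key, val_trunc hL, val_one, mul_one]

theorem val_addT {L : List Bool} (hL : L.length = k) (a b c d : List Bool) :
    val k (addT L a b c d) = val k a + val k b + (val k c + val k d) := by
  rw [addT, val_trunc hL, val_padd, val_padd, val_padd]

end

/-! ## Sums over colorings -/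

/-- The colorings that agree with `q` outside `D`. -/
def colorings {n : ℕ} (D : Fin n → Bool) (q : Fin n → Color) : Finset (Fin n → Color) :=
  Finset.univ.filter fun c => ∀ v, D v = false → c v = q v

section

variable {n : ℕ} {R : Type*} [CommRing R]

theorem mem_colorings {D : Fin n → Bool} {q c : Fin n → Color} :
    c ∈ colorings D q ↔ ∀ v, D v = false → c v = q v := by
  simp [colorings]

theorem sum_colorings_succ (D : Fin (n + 1) → Bool) (q : Fin (n + 1) → Color)
    (g : (Fin (n + 1) → Color) → R) :
    ∑ c ∈ colorings D q, g c = ∑ a ∈ (if D 0 then Finset.univ else {q 0}),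
      ∑ c ∈ colorings (fun v => D v.succ) (fun v => q v.succ), g (Fin.cons a c) := by
  rw [← Finset.sum_product']
  refine Finset.sum_nbij' (fun c => (c 0, Fin.tail c)) (fun p => Fin.cons p.1 p.2) ?_ ?_ ?_ ?_ ?_
  · intro c hc
    rw [mem_colorings] at hc
    simp only [Finset.mem_product, mem_colorings]
    refine ⟨?_, fun v hv => hc _ hv⟩
    cases h : D 0
    · simpa using hc 0 h
    · simp
  · intro p hp
    simp only [Finset.mem_product, mem_colorings] at hp
    rw [mem_colorings]
    intro v hv
    induction v using Fin.cases with
    | zero => simpa [hv] using hp.1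
    | succ v => simpa using hp.2 v hv
  · intro c _
    simp
  · intro p _
    simp
  · intro c _
    simp

theorem sum_color (f : Color → R) : ∑ a, f a =
    f (false, false) + f (false, true) + (f (true, false) + f (true, true)) := by
  rw [Fintype.sum_prod_type]
  simp only [Fintype.sum_bool]
  ring

theorem val_enum_addT {k : ℕ} {L : List Bool} (hL : L.length = k) (leaf : List Color → List Bool)
    (D : Fin n → Bool) (q : Fin n → Color) :
    val k (enum (addT L) (fun c => leaf c.reverse) ((List.ofFn q).zip (List.ofFn D)) []) =
      ∑ c ∈ colorings D q, val k (leaf (List.ofFn c)) := by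
  have key (s : List Color) : val k (enum (addT L) (fun c => leaf c.reverse)
      ((List.ofFn q).zip (List.ofFn D)) s) =
      ∑ c ∈ colorings D q, val k (leaf (s.reverse ++ List.ofFn c)) := by
    induction n generalizing s with
    | zero =>
      have : colorings D q = {q} := by
        ext c
        simp [mem_colorings, Subsingleton.elim c q]
      simp [this, enum]
    | succ n ih =>
      rw [sum_colorings_succ]
      simp only [List.ofFn_succ, List.zip_cons_cons, Fin.cons_zero, Fin.cons_succ]
      cases h : D 0
      · simp only [enum, ih]
        simp
      · simp only [enum, if_true, sum_color, val_addT hL, ih]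
        simp
  simpa using key []

theorem child_node4 (q : Color) (a b c d : Data) : child q (node4 a b c d) =
    if q.1 then (if q.2 then d else c) else (if q.2 then b else a) := by
  obtain ⟨_ | _, _ | _⟩ := q <;> rfl

/-- The default color outside a set. -/
def restrict (A : Fin n → Bool) (c : Fin n → Color) : Fin n → Color :=
  fun v => if A v then c v else (false, false)

/-- At a masked vertex the lookup descends into the branch that the enumeration created for its
color. At the other vertices the enumeration inserted the placeholder `(false, false)`, which
accounts for `restrict`. -/
theorem lookup_enum_node4 (h : List Color → List Bool) (A : Fin n → Bool) (c : Fin n → Color) :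
    lookup (List.ofFn A) (enum node4 (fun c => enc (h c.reverse))
      ((List.ofFn A).map fun b => ((false, false), b)) []) (List.ofFn c) =
      h (List.ofFn (restrict A c)) := by
  have key (s : List Color) : lookup (List.ofFn A) (enum node4 (fun c => enc (h c.reverse))
      ((List.ofFn A).map fun b => ((false, false), b)) s) (List.ofFn c) =
      h (s.reverse ++ List.ofFn (restrict A c)) := by
    induction n generalizing s with
    | zero => simp [enum, lookup, Data.toBools_enc]
    | succ n ih =>
      have ih' := ih (fun v => A v.succ) (fun v => c v.succ)
      have hr : restrict (fun v => A v.succ) (fun v => c v.succ) = fun v => restrict A c v.succ := rfl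
      simp only [lookup, hr] at ih'
      cases h0 : A 0
      · simp only [lookup, List.ofFn_succ, h0, List.map_cons, List.zip_cons_cons, List.foldl_cons,
          cond_false, enum, ih']
        simp [restrict, h0]
      · simp only [lookup, List.ofFn_succ, h0, List.map_cons, List.zip_cons_cons, List.foldl_cons,
          cond_true, enum, child_node4]
        have : restrict A c 0 = c 0 := by simp [restrict, h0]
        rw [this]
        obtain ⟨_ | _, _ | _⟩ := c 0 <;>
          simp only [if_true, if_false, Bool.false_eq_true] <;> rw [ih'] <;> simp
  simpa using key []

theorem lookup_congr (A : Fin n → Bool) (T : Data) {c c' : Fin n → Color}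
    (h : ∀ v, A v = true → c v = c' v) :
    lookup (List.ofFn A) T (List.ofFn c) = lookup (List.ofFn A) T (List.ofFn c') := by
  unfold lookup
  congr 1
  induction n generalizing T with
  | zero => simp
  | succ n ih =>
    simp only [List.ofFn_succ, List.zip_cons_cons, List.foldl_cons]
    rw [ih _ _ fun v hv => h _ hv]
    cases h0 : A 0
    · rfl
    · rw [h 0 h0]

theorem lookup_of_forall_false (T : Data) (c : Fin n → Color) :
    lookup (List.ofFn fun _ : Fin n => false) T (List.ofFn c) = T.toBools := by
  unfold lookup
  congr 1
  induction n generalizing T with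
  | zero => simp
  | succ n ih => simpa [List.ofFn_succ] using ih _ _

/-- Colors are summed first over the colorings of `U` and then over those of `D`. -/
theorem sum_colorings_or {U D : Fin n → Bool} (hd : ∀ v, U v = true → D v = false)
    (q : Fin n → Color) (g : (Fin n → Color) → R) :
    ∑ c ∈ colorings (fun v => U v || D v) q, g c =
      ∑ c ∈ colorings U q, ∑ c' ∈ colorings D c, g c' := by
  -- The sum is split into the fibres of the map that resets the colors outside `U` to those of `q`.
  rw [← Finset.sum_fiberwise_of_maps_to (s := colorings (fun v => U v || D v) q)
    (t := colorings U q) (g := fun c v => if U v then c v else q v)]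
  · refine Finset.sum_congr rfl fun c hc => Finset.sum_congr ?_ fun _ _ => rfl
    rw [mem_colorings] at hc
    ext c'
    simp only [Finset.mem_filter, mem_colorings, funext_iff, Bool.or_eq_false_iff]
    constructor
    · rintro ⟨h1, h2⟩ v hv
      have h3 := h2 v
      cases hu : U v
      · rw [h1 v ⟨hu, hv⟩, hc v hu]
      · simpa [hu] using h3
    · intro h
      refine ⟨fun v hv => (h v hv.2).trans (hc v hv.1), fun v => ?_⟩
      cases hu : U v
      · simpa using (hc v hu).symm
      · simpa using h v (hd v hu)
  · intro c _
    rw [mem_colorings]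
    intro v hv
    simp [hv]

theorem zip_ofFn {α β : Type*} (f : Fin n → α) (g : Fin n → β) :
    (List.ofFn f).zip (List.ofFn g) = List.ofFn fun v => (f v, g v) := by
  induction n with
  | zero => simp
  | succ n ih => simp [List.ofFn_succ, ih]

theorem ofFn_getD {α : Type*} {l : List α} (h : l.length = n) (d : α) :
    List.ofFn (fun v : Fin n => l.getD v d) = l := by
  subst h
  simp

end

/-! ## Correctness of the dynamic program -/

/-- The bag of a node. -/
def bagFn (n : ℕ) (r : NRec) (v : Fin n) : Bool := r.2.2.getD v false

/-- The vertices in the bags of a list of nodes. -/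
def bagUnion (n : ℕ) (es : List (NRec × NRec)) (v : Fin n) : Bool := es.any fun e => bagFn n e.1 v

/-- Every node in the list, except for the last one, has its parent further down in the list, and
its bag meets the bags further down within the bag of the parent. -/
def Elim (n : ℕ) : List (NRec × NRec) → Prop
  | [] => True
  | e :: E => e.1.2.2.length = n ∧ e.2.2.2.length = n ∧ (∀ d ∈ E, d.1.1 ≠ e.1.1) ∧
      ((E = [] ∧ ∀ v, bagFn n e.2 v = false) ∨ ∃ d ∈ E, d.1 = e.2) ∧
      (∀ v, bagFn n e.1 v = true → ∀ d ∈ E, bagFn n d.1 v = true → bagFn n e.2 v = true) ∧ Elim n E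

/-- The messages concern vertices in the bag of the receiver only. -/
def MsgsOK (n : ℕ) (ms : List Msg) (e : NRec × NRec) : Prop :=
  ∀ m ∈ ms, m.1 = e.1.1 → m.2.1.length = n ∧ ∀ v : Fin n, m.2.1.getD v false = true →
    bagFn n e.1 v = true

section

variable {n k : ℕ}

theorem ofFn_bagFn {r : NRec} (h : r.2.2.length = n) : List.ofFn (bagFn n r) = r.2.2 :=
  ofFn_getD h false

/-- The value of the factor of an ordered pair of vertices. -/
noncomputable def facVal (k : ℕ) (cx : Ctx) (u v : VRec) (a b : Color) : TruncPoly k :=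
  val k (cond (u.1 == v.1) (vertFac cx.2.2.1 cx.2.2.2.1 u.1 u.2.1 a)
      (cond (u.2.2.getD v.1 false) (edgeFac cx.1 a b) [true]))

/-- The product of the factors counted at a node. -/
noncomputable def localVal (k : ℕ) (cx : Ctx) (vr : Fin n → VRec) (e : NRec × NRec)
    (c : Fin n → Color) : TruncPoly k :=
  ∏ u, ∏ v, if (bagFn n e.1 u && bagFn n e.1 v && !(bagFn n e.2 u && bagFn n e.2 v)) = true then
    facVal k cx (vr u) (vr v) (c u) (c v) else 1

/-- The value of a leaf. -/
noncomputable def nodeVal (k : ℕ) (cx : Ctx) (e : NRec × NRec) (ms : List Msg)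
    (c : Fin n → Color) : TruncPoly k := val k (leafVal cx e ms (List.ofFn c))

variable {cx : Ctx} {vr : Fin n → VRec}

theorem prod_map_flatMap {α β M : Type*} [CommMonoid M] (l : List α) (f : α → List β) (g : β → M) :
    ((l.flatMap f).map g).prod = (l.map fun a => ((f a).map g).prod).prod := by
  induction l with
  | nil => simp
  | cons a l ih => simp [ih]

theorem nodeVal_eq (hL : cx.2.1.length = k) (hv : cx.2.2.2.2 = List.ofFn vr) {e : NRec × NRec}
    (h₁ : e.1.2.2.length = n) (h₂ : e.2.2.2.length = n) (ms : List Msg) (c : Fin n → Color) :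
    nodeVal k cx e ms c = localVal k cx vr e c * ((ms.filter fun m => m.1 == e.1.1).map fun m =>
      val k (lookup m.2.1 m.2.2 (List.ofFn c))).prod := by
  rw [nodeVal, leafVal, val_prodT hL, List.map_append, List.prod_append, List.map_map]
  congr 1
  simp only [localFacs]
  rw [hv, ← ofFn_bagFn h₁, ← ofFn_bagFn h₂, zip_ofFn, zip_ofFn, zip_ofFn, prod_map_flatMap,
    List.map_ofFn, List.prod_ofFn, localVal]
  refine Finset.prod_congr rfl fun u _ => ?_
  simp only [Function.comp_apply]
  rw [List.map_ofFn, List.map_ofFn, List.prod_ofFn]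
  refine Finset.prod_congr rfl fun v _ => ?_
  simp only [Function.comp_apply, pairFac, facVal]
  cases (bagFn n e.1 u && bagFn n e.1 v && !(bagFn n e.2 u && bagFn n e.2 v)) <;> simp

theorem localVal_congr (e : NRec × NRec) {c c' : Fin n → Color}
    (h : ∀ v, bagFn n e.1 v = true → c v = c' v) : localVal k cx vr e c = localVal k cx vr e c' := by
  refine Finset.prod_congr rfl fun u _ => Finset.prod_congr rfl fun v _ => ?_
  split_ifs with hc
  · simp only [Bool.and_eq_true] at hc
    rw [h u hc.1.1, h v hc.1.2]
  · rfl

theorem nodeVal_congr (hL : cx.2.1.length = k) (hv : cx.2.2.2.2 = List.ofFn vr) {e : NRec × NRec}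
    (h₁ : e.1.2.2.length = n) (h₂ : e.2.2.2.length = n) {ms : List Msg} (hm : MsgsOK n ms e)
    {c c' : Fin n → Color} (h : ∀ v, bagFn n e.1 v = true → c v = c' v) :
    nodeVal k cx e ms c = nodeVal k cx e ms c' := by
  rw [nodeVal_eq hL hv h₁ h₂, nodeVal_eq hL hv h₁ h₂, localVal_congr e h]
  congr 2
  refine List.map_congr_left fun m hmem => ?_
  obtain ⟨h3, h4⟩ := hm m (List.mem_of_mem_filter hmem) (by simpa using List.of_mem_filter hmem)
  have := lookup_congr (fun v : Fin n => m.2.1.getD v false) m.2.2 (c := c) (c' := c')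
    fun v hv => h v (h4 v hv)
  rw [ofFn_getD h3] at this
  rw [this]

theorem commonMask_eq {e : NRec × NRec} (h₁ : e.1.2.2.length = n) (h₂ : e.2.2.2.length = n) :
    commonMask e = List.ofFn fun v => bagFn n e.1 v && bagFn n e.2 v := by
  rw [commonMask, ← ofFn_bagFn h₁, ← ofFn_bagFn h₂, zip_ofFn, List.map_ofFn]
  rfl

theorem forgetMask_eq {e : NRec × NRec} (h₁ : e.1.2.2.length = n) (h₂ : e.2.2.2.length = n) :
    forgetMask e = List.ofFn fun v => bagFn n e.1 v && !bagFn n e.2 v := by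
  rw [forgetMask, ← ofFn_bagFn h₁, ← ofFn_bagFn h₂, zip_ofFn, List.map_ofFn]
  rfl

theorem sum_colorings_congr {R : Type*} [CommRing R] {D : Fin n → Bool} {q q' : Fin n → Color}
    {g : (Fin n → Color) → R} (h : ∀ c ∈ colorings D q, ∀ c' ∈ colorings D q',
      (∀ v, D v = true → c v = c' v) → g c = g c') :
    ∑ c ∈ colorings D q, g c = ∑ c ∈ colorings D q', g c := by
  have h1 (q q' : Fin n → Color) (c : Fin n → Color) (hc : c ∈ colorings D q) :
      (fun v => if D v then c v else q' v) ∈ colorings D q' := by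
    rw [mem_colorings]
    intro v hv
    simp [hv]
  have h2 (q q' : Fin n → Color) (c : Fin n → Color) (hc : c ∈ colorings D q) :
      (fun v => if D v then (fun v => if D v then c v else q' v) v else q v) = c := by
    funext v
    cases hd : D v
    · simp [mem_colorings.1 hc v hd]
    · simp [hd]
  refine Finset.sum_nbij' (fun c v => if D v then c v else q' v) (fun c v => if D v then c v else q v)
    (h1 q q') (h1 q' q) (h2 q q') (h2 q' q) fun c hc => h c hc _ (h1 q q' c hc) fun v hv => ?_
  simp [hv]

/-- The table entry was computed with placeholder colors outside the common vertices, whereas `c` is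
arbitrary there. This makes no difference: the value at a node depends on the colors in its bag
only, and a vertex of the bag is either common or summed over. -/
theorem val_lookup_message (hL : cx.2.1.length = k) (hv : cx.2.2.2.2 = List.ofFn vr)
    {e : NRec × NRec} (h₁ : e.1.2.2.length = n) (h₂ : e.2.2.2.length = n) {ms : List Msg}
    (hm : MsgsOK n ms e) (c : Fin n → Color) :
    val k (lookup (message cx e ms).2.1 (message cx e ms).2.2 (List.ofFn c)) =
      ∑ c' ∈ colorings (fun v => bagFn n e.1 v && !bagFn n e.2 v) c, nodeVal k cx e ms c' := by
  simp only [message]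
  rw [commonMask_eq h₁ h₂, lookup_enum_node4, sumForget, forgetMask_eq h₁ h₂, val_enum_addT hL]
  refine sum_colorings_congr fun c₁ hc₁ c₂ hc₂ h => nodeVal_congr hL hv h₁ h₂ hm fun v hv => ?_
  rw [mem_colorings] at hc₁ hc₂
  cases hp : bagFn n e.2 v
  · exact h v (by simp [hv, hp])
  · rw [hc₁ v (by simp [hp]), hc₂ v (by simp [hp])]
    simp [restrict, hv, hp]

/-- Since the indices of the nodes are distinct, a message enters the product over all nodes exactly
once. -/
theorem Elim.prod_ite {M : Type*} [CommMonoid M] {E : List (NRec × NRec)} (hE : Elim n E) {i : ℕ}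
    (hi : ∃ d ∈ E, d.1.1 = i) (y : M) : (E.map fun d => if d.1.1 = i then y else 1).prod = y := by
  induction E with
  | nil => simp at hi
  | cons e E ih =>
    obtain ⟨-, -, h, -, -, hE⟩ := hE
    by_cases he : e.1.1 = i
    · have : (E.map fun d => if d.1.1 = i then y else 1).prod = 1 := by
        refine List.prod_eq_one fun z hz => ?_
        obtain ⟨d, hd, rfl⟩ := List.mem_map.1 hz
        rw [if_neg (he ▸ h d hd)]
      simp [he, this]
    · obtain ⟨d, hd, hdi⟩ := hi
      rcases List.mem_cons.1 hd with rfl | hd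
      · exact absurd hdi he
      · simp [he, ih hE ⟨d, hd, hdi⟩]

theorem Elim.length {E : List (NRec × NRec)} (hE : Elim n E) {d : NRec × NRec} (hd : d ∈ E) :
    d.1.2.2.length = n ∧ d.2.2.2.length = n := by
  induction E with
  | nil => simp at hd
  | cons e E ih =>
    obtain ⟨h1, h2, -, -, -, hE⟩ := hE
    rcases List.mem_cons.1 hd with rfl | hd
    · exact ⟨h1, h2⟩
    · exact ih hE hd

theorem Elim.eq_of_index {E : List (NRec × NRec)} (hE : Elim n E) {d d' : NRec × NRec} (hd : d ∈ E)
    (hd' : d' ∈ E) (h : d.1.1 = d'.1.1) : d = d' := by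
  induction E with
  | nil => simp at hd
  | cons e E ih =>
    obtain ⟨-, -, h3, -, -, hE⟩ := hE
    rcases List.mem_cons.1 hd with h1 | h1 <;> rcases List.mem_cons.1 hd' with h2 | h2
    · rw [h1, h2]
    · exact absurd h.symm (h1 ▸ h3 _ h2)
    · exact absurd h (h2 ▸ h3 _ h1)
    · exact ih hE h1 h2

theorem nodeVal_cons (hL : cx.2.1.length = k) (hv : cx.2.2.2.2 = List.ofFn vr) {e : NRec × NRec}
    (h₁ : e.1.2.2.length = n) (h₂ : e.2.2.2.length = n) (m : Msg) (ms : List Msg)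
    (c : Fin n → Color) : nodeVal k cx e (m :: ms) c =
      (if e.1.1 = m.1 then val k (lookup m.2.1 m.2.2 (List.ofFn c)) else 1) *
        nodeVal k cx e ms c := by
  rw [nodeVal_eq hL hv h₁ h₂, nodeVal_eq hL hv h₁ h₂]
  by_cases h : e.1.1 = m.1
  · simp [h]
    ring
  · have : (m.1 == e.1.1) = false := by simpa using fun h' => h h'.symm
    simp [h, this]

/-- This is variable elimination by the distributive law. The vertices forgotten at the head of the
list occur in no later bag, so the sum over their colors can be moved to the only factor that
depends on them. The result is the message, which reappears as an additional factor at the parent.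
The induction therefore has to allow for messages `ms` received earlier. -/
theorem val_foldl_message (hL : cx.2.1.length = k) (hv : cx.2.2.2.2 = List.ofFn vr)
    {es : List (NRec × NRec)} (hE : Elim n es) (hne : es ≠ []) {ms : List Msg}
    (hm : ∀ e ∈ es, MsgsOK n ms e) (d : Msg) :
    val k ((es.foldl (fun ms e => message cx e ms :: ms) ms).headD d).2.2.toBools =
      ∑ c ∈ colorings (bagUnion n es) fun _ => (false, false),
        (es.map fun e => nodeVal k cx e ms c).prod := by
  induction es generalizing ms with
  | nil => exact absurd rfl hne
  | cons e E ih =>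
    obtain ⟨h1, h2, h3, h4, h5, hE⟩ := hE
    have hme := val_lookup_message hL hv h1 h2 (hm e (by simp))
    -- At the root the parent is the dummy with an empty bag: no vertex is common, and the table is
    -- the single entry in which all vertices of the bag have been summed over.
    rcases h4 with ⟨rfl, h4⟩ | ⟨p, hp, hpe⟩
    · have h6 := hme fun _ => (false, false)
      have h7 : (message cx e ms).2.1 = List.ofFn fun _ : Fin n => false := by
        simp only [message]
        rw [commonMask_eq h1 h2]
        simp [h4]
      rw [h7, lookup_of_forall_false] at h6
      have h8 : bagUnion n [e] = fun v => bagFn n e.1 v && !bagFn n e.2 v := by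
        funext v
        simp [bagUnion, h4]
      rw [h8]
      simpa using h6
    · have hEne : E ≠ [] := List.ne_nil_of_mem hp
      have hU : bagUnion n (e :: E) =
          fun v => bagUnion n E v || (bagFn n e.1 v && !bagFn n e.2 v) := by
        funext v
        have h6 : bagFn n e.2 v = true → bagUnion n E v = true := fun h =>
          List.any_eq_true.2 ⟨p, hp, hpe ▸ h⟩
        have h7 : bagUnion n (e :: E) v = (bagFn n e.1 v || bagUnion n E v) := rfl
        rw [h7]
        revert h6
        cases bagFn n e.1 v <;> cases bagFn n e.2 v <;> cases bagUnion n E v <;> simp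
      -- A vertex of this bag that occurs in a later bag is also in the bag of the parent, hence is
      -- not forgotten here.
      have hdis : ∀ v, bagUnion n E v = true → (bagFn n e.1 v && !bagFn n e.2 v) = false := by
        intro v hv
        obtain ⟨d, hd, hdv⟩ := List.any_eq_true.1 hv
        have h6 : bagFn n e.1 v = true → bagFn n e.2 v = true := fun h => h5 v h d hd hdv
        cases h7 : bagFn n e.1 v
        · rfl
        · rw [h6 h7]
          rfl
      have hm' : ∀ d ∈ E, MsgsOK n (message cx e ms :: ms) d := by
        intro d hd m hm'' hi
        rcases List.mem_cons.1 hm'' with rfl | hm''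
        · simp only [message] at hi ⊢
          rw [commonMask_eq h1 h2]
          have hdp : d = p := hE.eq_of_index hd hp (by rw [hpe, hi])
          refine ⟨by simp, fun v hv => ?_⟩
          rw [hdp, hpe]
          simp at hv
          exact hv.2
        · exact hm d (by simp [hd]) m hm'' hi
      rw [List.foldl_cons, ih hE hEne hm', hU, sum_colorings_or hdis]
      refine Finset.sum_congr rfl fun c _ => ?_
      have h9 : (E.map fun d => nodeVal k cx d (message cx e ms :: ms) c) = E.map fun d =>
          (if d.1.1 = e.2.1 then val k (lookup (message cx e ms).2.1 (message cx e ms).2.2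
            (List.ofFn c)) else 1) * nodeVal k cx d ms c :=
        List.map_congr_left fun d hd => nodeVal_cons hL hv (hE.length hd).1 (hE.length hd).2 _ _ _
      rw [h9, List.prod_map_mul, hE.prod_ite ⟨p, hp, by rw [hpe]⟩, hme, Finset.sum_mul]
      refine Finset.sum_congr rfl fun c' hc' => ?_
      rw [List.map_cons, List.prod_cons]
      congr 2
      refine List.map_congr_left fun d hd => nodeVal_congr hL hv (hE.length hd).1 (hE.length hd).2
        (hm d (by simp [hd])) fun v hv => ?_
      exact (mem_colorings.1 hc' v (hdis v (List.any_eq_true.2 ⟨d, hd, hv⟩))).symm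

/-- Each pair contained in some bag is counted exactly once, at the last such node of the list. If a
later bag also contains the pair, the separation property puts both vertices into the bag of the
parent, and the pair is skipped. If none does, the bag of the parent, which is a later one or empty,
cannot contain both. -/
theorem Elim.prod_localVal {es : List (NRec × NRec)} (hE : Elim n es) (c : Fin n → Color) :
    (es.map fun e => localVal k cx vr e c).prod = ∏ u, ∏ v,
      if ∃ e ∈ es, bagFn n e.1 u = true ∧ bagFn n e.1 v = true then
        facVal k cx (vr u) (vr v) (c u) (c v) else 1 := by
  induction es with
  | nil => simp
  | cons e E ih =>
    obtain ⟨-, -, -, h4, h5, hE⟩ := hE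
    rw [List.map_cons, List.prod_cons, ih hE, localVal, ← Finset.prod_mul_distrib]
    refine Finset.prod_congr rfl fun u _ => ?_
    rw [← Finset.prod_mul_distrib]
    refine Finset.prod_congr rfl fun v _ => ?_
    have h6 : bagFn n e.2 u = true → bagFn n e.2 v = true →
        ∃ d ∈ E, bagFn n d.1 u = true ∧ bagFn n d.1 v = true := by
      intro hu hv
      rcases h4 with ⟨-, h4⟩ | ⟨d, hd, hde⟩
      · simp [h4] at hu
      · exact ⟨d, hd, hde ▸ hu, hde ▸ hv⟩
    by_cases h7 : ∃ d ∈ E, bagFn n d.1 u = true ∧ bagFn n d.1 v = true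
    · obtain ⟨d, hd, hdu, hdv⟩ := h7
      have h8 : (bagFn n e.1 u && bagFn n e.1 v && !(bagFn n e.2 u && bagFn n e.2 v)) = false := by
        have h9 := fun h => h5 u h d hd hdu
        have h10 := fun h => h5 v h d hd hdv
        revert h9 h10
        cases bagFn n e.1 u <;> cases bagFn n e.1 v <;> cases bagFn n e.2 u <;>
          cases bagFn n e.2 v <;> simp
      rw [h8, if_neg Bool.false_ne_true, if_pos ⟨d, hd, hdu, hdv⟩, if_pos ⟨d, by simp [hd], hdu, hdv⟩,
        one_mul]
    · have h8 : ¬(bagFn n e.2 u = true ∧ bagFn n e.2 v = true) := fun h => h7 (h6 h.1 h.2)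
      rw [if_neg h7, mul_one]
      refine if_congr ?_ rfl rfl
      simp only [List.mem_cons, exists_eq_or_imp, h7, or_false, Bool.and_eq_true,
        Bool.not_eq_true']
      simpa using fun _ _ => h8

/-- The dynamic program computes the sum over all colorings of the product of all factors. -/
theorem val_messages (hL : cx.2.1.length = k) (hv : cx.2.2.2.2 = List.ofFn vr)
    {es : List (NRec × NRec)} (hE : Elim n es) (hne : es ≠ [])
    (hcov : ∀ u v, ((vr u).1 = (vr v).1 ∨ (vr u).2.2.getD (vr v).1 false = true) →
      ∃ e ∈ es, bagFn n e.1 u = true ∧ bagFn n e.1 v = true) (d : Msg) :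
    val k ((messages cx es).headD d).2.2.toBools =
      ∑ c : Fin n → Color, ∏ u, ∏ v, facVal k cx (vr u) (vr v) (c u) (c v) := by
  rw [messages, val_foldl_message hL hv hE hne (fun e _ m hm => by simp at hm)]
  have h1 : colorings (bagUnion n es) (fun _ => (false, false)) = Finset.univ := by
    ext c
    simp only [mem_colorings, Finset.mem_univ, iff_true]
    intro v hv
    obtain ⟨e, he, h, -⟩ := hcov v v (.inl rfl)
    exact absurd (List.any_eq_true.2 ⟨e, he, h⟩) (by rw [show es.any _ = false from hv]; exact Bool.false_ne_true)
  rw [h1]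
  refine Finset.sum_congr rfl fun c _ => ?_
  have h2 : (es.map fun e => nodeVal k cx e [] c) = es.map fun e => localVal k cx vr e c :=
    List.map_congr_left fun e he => by
      rw [nodeVal_eq hL hv (hE.length he).1 (hE.length he).2]
      simp
  rw [h2, hE.prod_localVal]
  refine Finset.prod_congr rfl fun u _ => Finset.prod_congr rfl fun v _ => ?_
  split_ifs with h
  · rfl
  -- A pair that lies in no bag is distinct and nonadjacent by `hcov`, so its factor is 1.
  · have h3 := fun h' => h (hcov u v h')
    have h4 : ((vr u).1 == (vr v).1) = false := beq_false_of_ne fun h' => h3 (.inl h')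
    have h5 : (vr u).2.2.getD (vr v).1 false = false := Bool.eq_false_iff.2 fun h' => h3 (.inr h')
    rw [facVal, h4, h5]
    simp

end

/-! ## The order of elimination -/

section

variable {n N : ℕ} {G : SimpleGraph (Fin n)}

open scoped Classical in
/-- The record of a node of a tree decomposition. -/
noncomputable def nodeRec (D : TreeDecomposition G (Fin N)) (i : Fin N) : NRec :=
  (i, List.ofFn fun j => decide (D.tree.Adj i j), List.ofFn fun v => decide (v ∈ D.bag i))

/-- The nodes that have been visited. -/
def Visited (D : TreeDecomposition G (Fin N)) (st : List (NRec × NRec)) (i : Fin N) : Prop :=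
  ∃ e ∈ st, e.1 = nodeRec D i

/-- The invariant of the search. -/
structure GrowInv (D : TreeDecomposition G (Fin N)) (st : List (NRec × NRec)) : Prop where
  elim : Elim n st
  ne_nil : st ≠ []
  isNode : ∀ e ∈ st, ∃ i, e.1 = nodeRec D i
  walk : ∀ i j, Visited D st i → Visited D st j →
    ∃ p : D.tree.Walk i j, ∀ x ∈ p.support, Visited D st x

variable {D : TreeDecomposition G (Fin N)}

theorem getD_ofFn {α : Type*} (f : Fin n → α) (d : α) (i : Fin n) :
    (List.ofFn f).getD i d = f i := by
  simp [List.getD_eq_getElem?_getD]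

theorem bagFn_nodeRec (i : Fin N) (v : Fin n) : bagFn n (nodeRec D i) v = true ↔ v ∈ D.bag i := by
  simp only [bagFn, nodeRec, getD_ofFn, decide_eq_true_eq]

theorem nodeRec_injective {i j : Fin N} (h : (nodeRec D i).1 = (nodeRec D j).1) : i = j :=
  Fin.val_injective h

theorem GrowInv.any_eq_true_iff {st : List (NRec × NRec)} (h : GrowInv D st) (i : Fin N) :
    (st.any fun d => d.1.1 == (nodeRec D i).1) = true ↔ Visited D st i := by
  rw [List.any_eq_true]
  constructor
  · rintro ⟨e, he, hi⟩
    obtain ⟨j, hj⟩ := h.isNode e he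
    rw [hj] at hi
    have := nodeRec_injective (beq_iff_eq.1 hi)
    exact ⟨e, he, this ▸ hj⟩
  · rintro ⟨e, he, hi⟩
    exact ⟨e, he, by simp [hi]⟩

theorem GrowInv.isNext_iff {st : List (NRec × NRec)} (h : GrowInv D st) (j p : Fin N) :
    isNext st (nodeRec D j, nodeRec D p) = true ↔
      D.tree.Adj p j ∧ ¬Visited D st j ∧ Visited D st p := by
  simp only [isNext, Bool.and_eq_true, h.any_eq_true_iff, Bool.not_eq_true']
  rw [← Bool.not_eq_true, h.any_eq_true_iff]
  simp only [nodeRec, getD_ofFn, decide_eq_true_eq, and_assoc]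

theorem visited_cons {st : List (NRec × NRec)} {j p i : Fin N} :
    Visited D ((nodeRec D j, nodeRec D p) :: st) i ↔ i = j ∨ Visited D st i := by
  constructor
  · rintro ⟨e, he, hi⟩
    rcases List.mem_cons.1 he with rfl | he
    · exact .inl (nodeRec_injective (congrArg Prod.fst hi)).symm
    · exact .inr ⟨e, he, hi⟩
  · rintro (rfl | ⟨e, he, hi⟩)
    · exact ⟨_, List.mem_cons_self, rfl⟩
    · exact ⟨e, List.mem_cons_of_mem _ he, hi⟩

/-- The separation property for the new node `j` holds since the visited nodes are connected: a path
from `p` to a visited node `i` inside them avoids `j`, so together with the edge from `j` to `p` it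
is a path from `j` to `i` through `p`. A vertex in the bags of `j` and `i` is then in the bag of
`p`. -/
theorem GrowInv.cons {st : List (NRec × NRec)} (h : GrowInv D st) {j p : Fin N}
    (hpj : D.tree.Adj p j) (hj : ¬Visited D st j) (hp : Visited D st p) :
    GrowInv D ((nodeRec D j, nodeRec D p) :: st) := by
  classical
  have hw (i : Fin N) (hi : Visited D st i) : ∃ q : D.tree.Walk j i,
      ∀ x ∈ q.support, x = j ∨ Visited D st x := by
    obtain ⟨q, hq⟩ := h.walk p i hp hi
    refine ⟨.cons hpj.symm q, fun x hx => ?_⟩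
    rw [SimpleGraph.Walk.support_cons, List.mem_cons] at hx
    exact hx.imp_right (hq x)
  refine ⟨⟨by simp [nodeRec], by simp [nodeRec], fun d hd hi => ?_, .inr ?_, fun v hv d hd hdv => ?_,
    h.elim⟩, by simp, fun e he => ?_, fun i i' hi hi' => ?_⟩
  · obtain ⟨i, hdi⟩ := h.isNode d hd
    have hij : i = j := nodeRec_injective (D := D) (by rw [← hdi, hi])
    exact hj ⟨d, hd, hij ▸ hdi⟩
  · exact hp
  · obtain ⟨i, hdi⟩ := h.isNode d hd
    obtain ⟨q, hq⟩ := h.walk p i hp ⟨d, hd, hdi⟩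
    have hq' : (SimpleGraph.Walk.cons hpj.symm q.bypass).IsPath :=
      (SimpleGraph.Walk.bypass_isPath q).cons fun hx =>
        hj (hq j (SimpleGraph.Walk.support_bypass_subset_support q hx))
    rw [hdi] at hdv
    rw [bagFn_nodeRec] at *
    exact D.mem_bag_of_mem_path j p i _ hq' (by simp) v hv hdv
  · rcases List.mem_cons.1 he with rfl | he
    · exact ⟨j, rfl⟩
    · exact h.isNode e he
  · simp only [visited_cons] at *
    rcases hi with rfl | hi <;> rcases hi' with rfl | hi'
    · exact ⟨.nil, fun x hx => .inl (by simpa using hx)⟩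
    · exact hw i' hi'
    · obtain ⟨q, hq⟩ := hw i hi
      exact ⟨q.reverse, fun x hx => hq x (by simpa using hx)⟩
    · obtain ⟨q, hq⟩ := h.walk i i' hi hi'
      exact ⟨q, fun x hx => .inr (hq x hx)⟩

theorem mem_nodePairs {nodes : List NRec} {e : NRec × NRec} :
    e ∈ nodePairs nodes ↔ e.1 ∈ nodes ∧ e.2 ∈ nodes := by
  obtain ⟨a, b⟩ := e
  simp only [nodePairs, List.mem_flatMap, List.mem_map, Prod.mk.injEq]
  grind

/-- Here `k` counts the rounds. A round adds a node unless no edge of the tree leaves the visited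
set, in which case connectedness of the tree shows that everything has been visited. -/
theorem GrowInv.growStep {st : List (NRec × NRec)} (h : GrowInv D st) (k : ℕ)
    (hk : k < st.length ∨ ∀ i, Visited D st i) :
    GrowInv D (growStep (List.ofFn (nodeRec D)) st) ∧
      (k + 1 < (growStep (List.ofFn (nodeRec D)) st).length ∨
        ∀ i, Visited D (growStep (List.ofFn (nodeRec D)) st) i) := by
  unfold _root_.growStep
  cases hf : (nodePairs (List.ofFn (nodeRec D))).filter (isNext st) with
  | nil =>
    refine ⟨by simpa using h, .inr ?_⟩
    rcases hk with hk | hk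
    · simp only [List.take_nil, List.nil_append]
      by_contra! hi
      obtain ⟨i, hi⟩ := hi
      obtain ⟨e, he⟩ := List.exists_mem_of_ne_nil _ h.ne_nil
      obtain ⟨j, hj⟩ := h.isNode e he
      obtain ⟨q⟩ := D.isTree.connected j i
      obtain ⟨d, -, hd1, hd2⟩ := q.exists_boundary_dart {x | Visited D st x} ⟨e, he, hj⟩ hi
      have hn := (h.isNext_iff d.snd d.fst).2 ⟨d.adj, hd2, hd1⟩
      have hm : (nodeRec D d.snd, nodeRec D d.fst) ∈
          (nodePairs (List.ofFn (nodeRec D))).filter (isNext st) :=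
        List.mem_filter.2 ⟨mem_nodePairs.2 ⟨List.mem_ofFn.2 ⟨_, rfl⟩, List.mem_ofFn.2 ⟨_, rfl⟩⟩, hn⟩
      rw [hf] at hm
      simp at hm
    · simpa using hk
  | cons e l =>
    have he : e ∈ (nodePairs (List.ofFn (nodeRec D))).filter (isNext st) := by simp [hf]
    obtain ⟨he, hn⟩ := List.mem_filter.1 he
    obtain ⟨h1, h2⟩ := mem_nodePairs.1 he
    obtain ⟨j, hj⟩ := List.mem_ofFn.1 h1
    obtain ⟨p, hp⟩ := List.mem_ofFn.1 h2
    obtain rfl : e = (nodeRec D j, nodeRec D p) := by rw [hj, hp]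
    obtain ⟨h3, h4, h5⟩ := (h.isNext_iff j p).1 hn
    refine ⟨h.cons h3 h4 h5, hk.imp (fun hk => ?_) fun hk i => ?_⟩
    · simpa using hk
    · exact visited_cons.2 (.inr (hk i))

theorem Elim.nodup {st : List (NRec × NRec)} (h : Elim n st) :
    (st.map fun e => e.1.1).Nodup := by
  induction st with
  | nil => simp
  | cons e E ih =>
    obtain ⟨-, -, h3, -, -, hE⟩ := h
    rw [List.map_cons, List.nodup_cons]
    refine ⟨fun hm => ?_, ih hE⟩
    obtain ⟨d, hd, hde⟩ := List.mem_map.1 hm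
    exact h3 d hd hde

/-- The search visits all nodes. -/
theorem order_spec (D : TreeDecomposition G (Fin N)) {dummy : NRec} (h₁ : dummy.2.2.length = n)
    (h₂ : ∀ v, bagFn n dummy v = false) :
    Elim n (order dummy (List.ofFn (nodeRec D))) ∧ order dummy (List.ofFn (nodeRec D)) ≠ [] ∧
      ∀ i, Visited D (order dummy (List.ofFn (nodeRec D))) i := by
  have hN : 0 < N := by
    obtain ⟨i⟩ := D.isTree.connected.nonempty
    exact i.pos
  obtain ⟨M, rfl⟩ : ∃ M, N = M + 1 := ⟨N - 1, by omega⟩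
  have h0 : GrowInv D [(nodeRec D 0, dummy)] := by
    refine ⟨⟨by simp [nodeRec], h₁, by simp, .inl ⟨rfl, h₂⟩, by simp, trivial⟩, by simp,
      fun e he => ⟨0, by rw [List.mem_singleton.1 he]⟩, fun i j hi hj => ?_⟩
    have key (i : Fin (M + 1)) (hi : Visited D [(nodeRec D 0, dummy)] i) : i = 0 := by
      obtain ⟨e, he, hi⟩ := hi
      rw [List.mem_singleton.1 he] at hi
      exact (nodeRec_injective (congrArg Prod.fst hi)).symm
    obtain rfl := key i hi
    obtain rfl := key j hj
    exact ⟨.nil, fun x hx => by simpa [List.mem_singleton.1 hx] using hi⟩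
  have key (l : List NRec) (k : ℕ) (st : List (NRec × NRec)) (h : GrowInv D st)
      (hk : k < st.length ∨ ∀ i, Visited D st i) :
      let st' := l.foldl (fun st _ => growStep (List.ofFn (nodeRec D)) st) st
      GrowInv D st' ∧ (k + l.length < st'.length ∨ ∀ i, Visited D st' i) := by
    induction l generalizing k st with
    | nil => exact ⟨h, hk⟩
    | cons a l ih =>
      obtain ⟨h1, h2⟩ := h.growStep k hk
      have := ih (k + 1) _ h1 h2
      rw [add_right_comm, add_assoc] at this
      exact this
  have ho : order dummy (List.ofFn (nodeRec D)) = (List.ofFn (nodeRec D)).foldl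
      (fun st _ => growStep (List.ofFn (nodeRec D)) st) [(nodeRec D 0, dummy)] := by
    rw [order]
    congr 1
    simp [List.ofFn_succ]
  obtain ⟨h1, h2⟩ := key (List.ofFn (nodeRec D)) 0 _ h0 (.inl (by simp))
  rw [← ho] at h1 h2
  refine ⟨h1.elim, h1.ne_nil, h2.resolve_left fun h3 => ?_⟩
  -- After as many rounds as there are nodes, the alternative would be a list with more entries than
  -- nodes, although its indices are distinct.
  have h4 := List.toFinset_card_of_nodup h1.elim.nodup
  have h5 : ((order dummy (List.ofFn (nodeRec D))).map fun e => e.1.1).toFinset ⊆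
      Finset.range (M + 1) := by
    intro i hi
    obtain ⟨e, he, rfl⟩ := List.mem_map.1 (List.mem_toFinset.1 hi)
    obtain ⟨j, hj⟩ := h1.isNode e he
    rw [hj]
    exact Finset.mem_range.2 j.isLt
  have h6 := Finset.card_le_card h5
  simp only [List.length_ofFn, List.length_map, Finset.card_range] at *
  omega

end

/-! ## Counting minimal cuts modulo two -/

section

variable {V : Type} [Fintype V] [DecidableEq V] (G : SimpleGraph V)

/-- The graph without the edges of a cut. -/
def uncut (S : V → Bool) : SimpleGraph V where
  Adj u v := G.Adj u v ∧ S u = S v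
  symm := ⟨fun _ _ h => ⟨h.1.symm, h.2.symm⟩⟩
  loopless := ⟨fun _ h => G.loopless.irrefl _ h.1⟩

variable {G}

theorem uncut_reachable_eq {β : Type} {S : V → Bool} {f : V → β}
    (hf : ∀ u v, G.Adj u v → S u = S v → f u = f v) {u v : V} (h : (uncut G S).Reachable u v) :
    f u = f v := by
  obtain ⟨p⟩ := h
  induction p with
  | nil => rfl
  | cons hadj _ ih => exact (hf _ _ hadj.1 hadj.2).trans ih

/-- A cut between `s` and `t` is minimal if both sides are connected. -/
theorem isMinimalCut_iff (hG : G.Connected) {S : V → Bool} {s t : V} (hs : S s = true)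
    (ht : S t = false) : IsMinimalCut G {v | S v = true} ↔
      ∀ v, (uncut G S).Reachable s v ∨ (uncut G S).Reachable t v := by
  constructor
  · intro h v
    by_contra! hv
    have boundary (K : Set V) (a b : V) (ha : a ∈ K) (hb : b ∉ K) : (cutset G K).Nonempty := by
      obtain ⟨p⟩ := hG.preconnected a b
      obtain ⟨d, -, h1, h2⟩ := p.exists_boundary_dart K ha hb
      exact ⟨_, d.fst, d.snd, h1, h2, d.adj, rfl⟩
    -- Let `K` and `K'` be the components of `v` and `a`, which lie on the same side. Edges leaving
    -- a component are cut edges, so the cutset of `K` is contained in that of `S`. The containment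
    -- is proper, because an edge leaving `K'` has one end in `K'` and the other on the opposite
    -- side, hence no end in `K`.
    have key (a : V) (ha : ¬(uncut G S).Reachable a v) (hav : S a = S v) : False := by
      let K : Set V := {x | (uncut G S).Reachable v x}
      let K' : Set V := {x | (uncut G S).Reachable a x}
      have haK : a ∉ K := fun h => ha h.symm
      have cross (x u w : V) (hu : (uncut G S).Reachable x u) (hw : ¬(uncut G S).Reachable x w)
          (hadj : G.Adj u w) : S u ≠ S w := fun he =>
        hw (hu.trans (SimpleGraph.Adj.reachable (G := uncut G S) ⟨hadj, he⟩))
      have sub (x : V) : cutset G {y | (uncut G S).Reachable x y} ⊆ cutset G {v | S v = true} := by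
        rintro e ⟨u, w, hu, hw, hadj, rfl⟩
        have := cross x u w hu hw hadj
        cases hSu : S u
        · exact ⟨w, u, by simpa [hSu] using this.symm, by simp [hSu], hadj.symm, Sym2.eq_swap⟩
        · exact ⟨u, w, hSu, by simpa [hSu] using this.symm, hadj, rfl⟩
      refine h K (boundary K v a (SimpleGraph.Reachable.refl v) haK) ⟨sub v, fun hsup => ?_⟩
      obtain ⟨e, u, w, hu, hw, hadj, rfl⟩ := boundary K' a v (SimpleGraph.Reachable.refl a) ha
      obtain ⟨u', w', hu', hw', hadj', he⟩ := hsup (sub a ⟨u, w, hu, hw, hadj, rfl⟩)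
      have h1 : S u' = S v := (uncut_reachable_eq (fun _ _ _ h => h) hu').symm
      have h2 : S u = S a := (uncut_reachable_eq (fun _ _ _ h => h) hu).symm
      have h3 := cross a u w hu hw hadj
      rcases Sym2.eq_iff.1 he with ⟨rfl, rfl⟩ | ⟨rfl, rfl⟩
      · exact ha (hu.trans hu'.symm)
      · exact h3 (h2.trans (hav.trans h1.symm))
    cases hSv : S v
    · exact key t hv.2 (ht.trans hSv.symm)
    · exact key s hv.1 (hs.trans hSv.symm)
  · intro h K hK hss
    obtain ⟨hsub, hnot⟩ := hss
    -- Conversely, if the cutset of `K` lies in that of `S`, membership in `K` is constant along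
    -- uncut edges and hence on each of the two connected sides. A nonempty cutset then forces `K`
    -- to be one of the sides, and the cutsets agree.
    have hconst (u v : V) (hadj : G.Adj u v) (hS : S u = S v) : (u ∈ K) = (v ∈ K) := by
      have key (u v : V) (hadj : G.Adj u v) (hS : S u = S v) (hu : u ∈ K) : v ∈ K := by
        by_contra hv
        obtain ⟨u', v', hu', hv', -, he⟩ := hsub ⟨u, v, hu, hv, hadj, rfl⟩
        simp only [Set.mem_ofPred_eq] at hu' hv'
        rcases Sym2.eq_iff.1 he with ⟨rfl, rfl⟩ | ⟨rfl, rfl⟩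
        · exact hv' (hS ▸ hu')
        · exact hv' (hS ▸ hu')
      exact propext ⟨key u v hadj hS, key v u hadj.symm hS.symm⟩
    have hside (v : V) : (v ∈ K) = if S v then (s ∈ K) else (t ∈ K) := by
      rcases h v with hr | hr
      · have h1 := uncut_reachable_eq (fun _ _ _ h => h) hr
        rw [← uncut_reachable_eq hconst hr, ← h1, hs, if_pos rfl]
      · have h1 := uncut_reachable_eq (fun _ _ _ h => h) hr
        rw [← uncut_reachable_eq hconst hr, ← h1, ht, if_neg Bool.false_ne_true]
    obtain ⟨e, a, b, ha, hb, hab, rfl⟩ := hK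
    refine hnot ?_
    rintro e ⟨u, v, hu, hv, hadj, rfl⟩
    simp only [Set.mem_ofPred_eq] at hu hv
    have h1 := hside u
    have h2 := hside v
    rw [if_pos hu] at h1
    rw [if_neg hv] at h2
    have h3 : ¬((s ∈ K) ↔ (t ∈ K)) := fun h3 => by
      have h4 := hside a
      have h5 := hside b
      have h6 : (s ∈ K) = (t ∈ K) := propext h3
      rw [h6, ite_self] at h4 h5
      exact hb (h5 ▸ h4 ▸ ha)
    by_cases hsK : s ∈ K
    · have htK : t ∉ K := fun h => h3 ⟨fun _ => h, fun _ => hsK⟩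
      exact ⟨u, v, h1 ▸ hsK, h2 ▸ htK, hadj, rfl⟩
    · have htK : t ∈ K := by_contra fun h => h3 ⟨fun h' => absurd h' hsK, fun h' => absurd h' h⟩
      exact ⟨v, u, h2 ▸ htK, h1 ▸ hsK, hadj.symm, Sym2.eq_swap⟩

variable (G)

open scoped Classical in
/-- The pairs of adjacent vertices on different sides of a cut. -/
noncomputable def cutPairs (S : V → Bool) : Finset (V × V) :=
  Finset.univ.filter fun p => G.Adj p.1 p.2 ∧ S p.1 = true ∧ S p.2 = false

theorem ncard_cutset (S : V → Bool) :
    (cutset G {v | S v = true}).ncard = (cutPairs G S).card := by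
  have h : cutset G {v | S v = true} = (fun p : V × V => s(p.1, p.2)) '' (cutPairs G S : Set (V × V)) := by
    ext e
    constructor
    · rintro ⟨u, v, hu, hv, hadj, rfl⟩
      exact ⟨(u, v), by simpa [cutPairs] using ⟨hadj, hu, by simpa using hv⟩, rfl⟩
    · rintro ⟨⟨u, v⟩, h, rfl⟩
      simp only [cutPairs, Finset.coe_filter, Finset.mem_univ, true_and, Set.mem_ofPred_eq] at h
      exact ⟨u, v, h.2.1, by simp [h.2.2], h.1, rfl⟩
  rw [h, Set.InjOn.ncard_image, Set.ncard_coe_finset]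
  rintro ⟨u, v⟩ h ⟨u', v'⟩ h' he
  simp only [cutPairs, Finset.coe_filter, Finset.mem_univ, true_and, Set.mem_ofPred_eq] at h h'
  rcases Sym2.eq_iff.1 he with ⟨h1, h2⟩ | ⟨h1, h2⟩
  · exact Prod.ext h1 h2
  · subst h1 h2
    simp [h.2.1] at h'

variable {R : Type*} [CommRing R]

open scoped Classical in
/-- The factor of a vertex. -/
noncomputable def vertWt (s t : V) (w : V → R) (v : V) (a : Color) : R :=
  if (v = s ∧ a ≠ (true, false)) ∨ (v = t ∧ a ≠ (false, false)) then 0 else if a.1 then w v else 1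

/-- The factor of a pair of adjacent vertices. -/
def edgeWt (y : R) (a b : Color) : R :=
  if a.1 = b.1 then (if a.2 = b.2 then 1 else 0) else if a.1 then y else 1

open scoped Classical in
/-- The minimal cuts between `s` and `t`. -/
noncomputable def minCuts (s t : V) : Finset (V → Bool) :=
  Finset.univ.filter fun S => S s = true ∧ S t = false ∧ IsMinimalCut G {v | S v = true}

open scoped Classical in
/-- The markings that are constant along the edges of the graph without the cut. -/
noncomputable def markings (s t : V) (S : V → Bool) : Finset (V → Bool) :=
  Finset.univ.filter fun l => l s = false ∧ l t = false ∧
    ∀ u v, G.Adj u v → S u = S v → l u = l v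

variable {G}

/-- If every component of the uncut graph contains `s` or `t`, only the zero marking is left.
Otherwise flipping the marks on a component that avoids both is an involution without fixed points,
so the number of markings is even. -/
theorem card_markings [CharP R 2] (hG : G.Connected) {s t : V} {S : V → Bool} (hs : S s = true)
    (ht : S t = false) : ((markings G s t S).card : R) = if S ∈ minCuts G s t then 1 else 0 := by
  classical
  have hmin : S ∈ minCuts G s t ↔
      ∀ v, (uncut G S).Reachable s v ∨ (uncut G S).Reachable t v := by
    simp only [minCuts, Finset.mem_filter, Finset.mem_univ, true_and, hs, ht,
      isMinimalCut_iff hG hs ht]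
  split_ifs with h
  · rw [hmin] at h
    have : markings G s t S = {fun _ => false} := by
      ext l
      simp only [markings, Finset.mem_filter, Finset.mem_univ, true_and, Finset.mem_singleton]
      constructor
      · rintro ⟨h1, h2, h3⟩
        funext v
        rcases h v with hr | hr
        · rw [← uncut_reachable_eq h3 hr, h1]
        · rw [← uncut_reachable_eq h3 hr, h2]
      · rintro rfl
        simp
    simp [this]
  · rw [hmin] at h
    push Not at h
    obtain ⟨v, hv1, hv2⟩ := h
    have hmem (l : V → Bool) (hl : l ∈ markings G s t S) :
        (fun x => l x ^^ decide ((uncut G S).Reachable v x)) ∈ markings G s t S := by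
      simp only [markings, Finset.mem_filter, Finset.mem_univ, true_and] at hl ⊢
      refine ⟨?_, ?_, fun a b hab hS => ?_⟩
      · simpa [hl.1] using fun h => hv1 h.symm
      · simpa [hl.2.1] using fun h => hv2 h.symm
      · have hr : (uncut G S).Reachable a b :=
          SimpleGraph.Adj.reachable (G := uncut G S) ⟨hab, hS⟩
        have : (uncut G S).Reachable v a ↔ (uncut G S).Reachable v b :=
          ⟨fun h => h.trans hr, fun h => h.trans hr.symm⟩
        rw [hl.2.2 a b hab hS]
        simp [this]
    rw [Finset.card_eq_sum_ones, Nat.cast_sum]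
    refine Finset.sum_involution (fun l _ x => l x ^^ decide ((uncut G S).Reachable v x))
      (fun l hl => by simpa using CharTwo.add_self_eq_zero (1 : R)) (fun l hl _ he => ?_)
      (fun l hl => hmem l hl) fun l hl => ?_
    · have := congrFun he v
      simp at this
    · funext x
      simp

/-- The product runs over ordered pairs, but `y` appears only if the first vertex is on side `true`,
so each cut edge contributes it once. An uncut edge with different marks at its ends annihilates the
product. -/
theorem prod_edgeWt [DecidableRel G.Adj] (y : R) (S l : V → Bool) :
    (∏ u, ∏ v, if G.Adj u v then edgeWt y (S u, l u) (S v, l v) else 1) =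
      (if ∀ u v, G.Adj u v → S u = S v → l u = l v then 1 else 0) * y ^ (cutPairs G S).card := by
  split_ifs with h
  · rw [one_mul, ← Finset.prod_const, cutPairs, Finset.prod_filter, ← Finset.univ_product_univ,
      Finset.prod_product]
    refine Finset.prod_congr rfl fun u _ => Finset.prod_congr rfl fun v _ => ?_
    by_cases hadj : G.Adj u v
    · have := h u v hadj
      cases hu : S u <;> cases hv : S v <;> simp_all [edgeWt]
    · simp [hadj]
  · push Not at h
    obtain ⟨u, v, hadj, hS, hl⟩ := h
    rw [zero_mul]
    refine Finset.prod_eq_zero (Finset.mem_univ u) (Finset.prod_eq_zero (Finset.mem_univ v) ?_)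
    simp [hadj, edgeWt, hS, hl]

theorem prod_vertWt {s t : V} (hst : s ≠ t) (w : V → R) (S l : V → Bool) :
    (∏ v, vertWt s t w v (S v, l v)) =
      if S s = true ∧ S t = false ∧ l s = false ∧ l t = false then ∏ v, (if S v then w v else 1)
        else 0 := by
  split_ifs with h
  · refine Finset.prod_congr rfl fun v _ => ?_
    rw [vertWt, if_neg]
    rintro (⟨rfl, h1⟩ | ⟨rfl, h1⟩)
    · simp [h.1, h.2.2.1] at h1
    · simp [h.2.1, h.2.2.2] at h1
  · by_cases h1 : S s = true ∧ l s = false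
    · refine Finset.prod_eq_zero (Finset.mem_univ t) ?_
      rw [vertWt, if_pos]
      refine .inr ⟨rfl, fun h2 => h ?_⟩
      simp only [Prod.mk.injEq] at h2
      exact ⟨h1.1, h2.1, h1.2, h2.2⟩
    · refine Finset.prod_eq_zero (Finset.mem_univ s) ?_
      rw [vertWt, if_pos]
      refine .inl ⟨rfl, fun h2 => h1 ?_⟩
      simpa using h2

/-- The two requirements on terminals are incompatible at a single vertex. The case is needed since
`cutTest` tries all `t`, including 0. -/
theorem prod_vertWt_self (s : V) (w : V → R) (c : V → Color) :
    (∏ v, vertWt s s w v (c v)) = 0 := by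
  refine Finset.prod_eq_zero (Finset.mem_univ s) ?_
  rw [vertWt, if_pos]
  by_cases h : c s = (true, false)
  · exact .inr ⟨rfl, by simp [h]⟩
  · exact .inl ⟨rfl, h⟩

/-- In characteristic two, the sum over all colorings is the sum over the minimal cuts. -/
theorem sum_colorings_eq [CharP R 2] [DecidableRel G.Adj] (hG : G.Connected) (s t : V) (y : R)
    (w : V → R) :
    (∑ c : V → Color, (∏ v, vertWt s t w v (c v)) *
      ∏ u, ∏ v, if G.Adj u v then edgeWt y (c u) (c v) else 1) =
      ∑ S ∈ minCuts G s t, y ^ (cutPairs G S).card * ∏ v, (if S v then w v else 1) := by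
  classical
  rcases eq_or_ne s t with rfl | hst
  · have : minCuts G s s = ∅ := by
      ext S
      simp only [minCuts, Finset.mem_filter, Finset.notMem_empty, iff_false]
      rintro ⟨-, h1, h2, -⟩
      simp [h1] at h2
    simp [prod_vertWt_self, this]
  -- A coloring is a side function `S` together with a marking; for fixed `S` the inner sum counts
  -- the admissible markings.
  · rw [← (Equiv.arrowProdEquivProdArrow V (fun _ => Bool) fun _ => Bool).symm.sum_comp,
      Fintype.sum_prod_type, minCuts, Finset.sum_filter]
    refine Finset.sum_congr rfl fun S _ => ?_
    simp only [Equiv.arrowProdEquivProdArrow_symm_apply]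
    simp only [prod_vertWt hst, prod_edgeWt]
    by_cases hS : S s = true ∧ S t = false
    · have h1 := card_markings (R := R) hG hS.1 hS.2
      have h2 : (S ∈ minCuts G s t) ↔
          (S s = true ∧ S t = false ∧ IsMinimalCut G {v | S v = true}) := by simp [minCuts]
      have h3 : ∀ l : V → Bool, ((if S s = true ∧ S t = false ∧ l s = false ∧ l t = false then
          ∏ v, (if S v then w v else 1) else 0) *
          ((if ∀ u v, G.Adj u v → S u = S v → l u = l v then 1 else 0) *
            y ^ (cutPairs G S).card)) =
          if l ∈ markings G s t S then y ^ (cutPairs G S).card * ∏ v, (if S v then w v else 1)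
            else 0 := by
        intro l
        have h6 : l ∈ markings G s t S ↔ l s = false ∧ l t = false ∧
          ∀ u v, G.Adj u v → S u = S v → l u = l v := by simp [markings]
        by_cases h4 : l s = false ∧ l t = false
        · by_cases h5 : ∀ u v, G.Adj u v → S u = S v → l u = l v
          · rw [if_pos ⟨hS.1, hS.2, h4⟩, if_pos h5, if_pos (h6.2 ⟨h4.1, h4.2, h5⟩)]
            ring
          · rw [if_neg h5, if_neg fun h => h5 (h6.1 h).2.2]
            ring
        · rw [if_neg fun h => h4 h.2.2, if_neg fun h => h4 ⟨(h6.1 h).1, (h6.1 h).2.1⟩]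
          ring
      rw [Finset.sum_congr rfl fun l _ => h3 l, ← Finset.sum_filter, Finset.filter_mem_eq_inter,
        Finset.univ_inter, Finset.sum_const, nsmul_eq_mul, h1, ite_mul, one_mul, zero_mul]
      exact if_congr h2 rfl rfl
    · rw [if_neg fun h => hS ⟨h.1, h.2.1⟩]
      refine Finset.sum_eq_zero fun l _ => ?_
      rw [if_neg fun h => hS ⟨h.1, h.2.1⟩, zero_mul]

end

/-! ## Correctness of the test -/

/-- A matrix as the list of its rows. -/
def matList {a b : ℕ} (M : Fin a → Fin b → Bool) : List (List Bool) :=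
  List.ofFn fun i => List.ofFn fun j => M i j

open scoped Classical in
/-- The data of an input. -/
noncomputable def CutInput.inst (x : CutInput) : Inst :=
  (matList fun i j => decide (x.graph.Adj i j), matList fun i j => decide (x.decomp.tree.Adj i j),
    matList fun i v => decide (v ∈ x.decomp.bag i), x.k.bits)

section

open Polynomial

/-- The generating polynomial of the minimal cuts. -/
noncomputable def cutSum {n : ℕ} (G : SimpleGraph (Fin n)) (s t : Fin n) (w : Fin n → (ZMod 2)[X]) :
    (ZMod 2)[X] :=
  ∑ S ∈ minCuts G s t, (X ^ (n * n)) ^ (cutPairs G S).card * ∏ v, (if S v then w v else 1)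

theorem map_const_flatMap {n : ℕ} {α : Type*} (l : List α) (f : α → List Bool)
    (hf : ∀ a, (f a) = List.replicate n false) :
    l.flatMap f = List.replicate (l.length * n) false := by
  induction l with
  | nil => simp
  | cons a l ih =>
    rw [List.flatMap_cons, ih, hf, List.length_cons, Nat.succ_mul, Nat.add_comm,
      List.replicate_add]

theorem zeros_matList {n : ℕ} (M : Fin n → Fin n → Bool) :
    zeros (matList M) = List.replicate (n * n) false := by
  have : zeros (matList M) = (List.finRange n).flatMap fun i =>
      (List.ofFn fun j => M i j).map fun _ => false := by
    rw [zeros, matList, List.ofFn_eq_map, List.flatMap_map]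
  rw [this, map_const_flatMap (n := n)]
  · simp
  · intro i
    simp

theorem toPoly_replicate_false (m : ℕ) : toPoly (List.replicate m false) = 0 := by
  induction m with
  | zero => rfl
  | succ m ih => simp [List.replicate_succ, toPoly_cons, ih]

theorem toPoly_marker {n : ℕ} (M : Fin n → Fin n → Bool) :
    toPoly (zeros (matList M) ++ [true]) = X ^ (n * n) := by
  rw [zeros_matList, toPoly_append, toPoly_replicate_false]
  simp

theorem length_bound {n : ℕ} (M : Fin n → Fin n → Bool) :
    (((zeros (matList M)).flatMap fun _ => zeros (matList M)) ++ zeros (matList M)).length =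
      n * n * (n * n) + n * n := by
  rw [List.length_append, map_const_flatMap (n := n * n) _ _ fun _ => zeros_matList M,
    zeros_matList]
  simp

theorem range_eq_ofFn (n : ℕ) : List.range n = List.ofFn fun i : Fin n => (i : ℕ) := by
  rw [List.ofFn_eq_map]
  simp

theorem mkNodes_inst (x : CutInput) :
    mkNodes x.inst.2.1 x.inst.2.2.1 = List.ofFn (nodeRec x.decomp) := by
  simp only [mkNodes, CutInput.inst, matList, List.length_ofFn]
  rw [range_eq_ofFn, zip_ofFn, zip_ofFn]
  rfl

theorem dummyNode_matList {n : ℕ} (M : Fin n → Fin n → Bool) :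
    dummyNode (matList M) = (0, [], List.ofFn fun _ : Fin n => false) := by
  simp [dummyNode, matList, List.map_ofFn, Function.comp_def]

open scoped Classical in
theorem verts_matList {n : ℕ} (W M : Fin n → Fin n → Bool) : verts (matList W) (matList M) =
    List.ofFn fun v : Fin n => ((v : ℕ), List.ofFn (W v), List.ofFn (M v)) := by
  simp only [verts, matList, List.length_ofFn]
  rw [range_eq_ofFn, zip_ofFn, zip_ofFn]

theorem toPoly_vertFac {n : ℕ} (s t v : Fin n) (w : List Bool) (a : Color) :
    toPoly (vertFac s t v w a) = vertWt s t (fun _ => toPoly w) v a := by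
  obtain ⟨a, b⟩ := a
  have h1 : ((v : ℕ) == (s : ℕ)) = decide (v = s) := by
    rw [Bool.eq_iff_iff, beq_iff_eq, decide_eq_true_iff, Fin.ext_iff]
  have h2 : ((v : ℕ) == (t : ℕ)) = decide (v = t) := by
    rw [Bool.eq_iff_iff, beq_iff_eq, decide_eq_true_iff, Fin.ext_iff]
  rw [vertFac, vertWt, h1, h2]
  by_cases hs : v = s <;> by_cases ht : v = t <;> cases a <;> cases b <;> simp [hs, ht] <;>
    split_ifs <;> simp_all

theorem toPoly_edgeFac (z : List Bool) (a b : Color) :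
    toPoly (edgeFac z a b) = edgeWt (toPoly z) a b := by
  obtain ⟨a, a'⟩ := a
  obtain ⟨b, b'⟩ := b
  cases a <;> cases a' <;> cases b <;> cases b' <;> simp [edgeFac, edgeWt]

/-- The algorithm computes modulo `X ^ k`, so only the coefficients below the truncation can be
compared. The link is that both sides represent the same element of the quotient ring. -/
theorem coeff_cutPoly (x : CutInput) (W : Fin x.n → Fin x.n → Bool) (s t : Fin x.n) {i : ℕ}
    (hi : i < x.n * x.n * (x.n * x.n) + x.n * x.n) :
    (toPoly (cutPoly (matList W) x.inst s t)).coeff i =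
      (cutSum x.graph s t fun v => toPoly (List.ofFn (W v))).coeff i := by
  classical
  set k := x.n * x.n * (x.n * x.n) + x.n * x.n with hk
  let M : Fin x.n → Fin x.n → Bool := fun i j => decide (x.graph.Adj i j)
  have hx : x.inst.1 = matList M := by
    simp only [CutInput.inst, M]
  let vr : Fin x.n → VRec := fun v => ((v : ℕ), List.ofFn (W v), List.ofFn (M v))
  refine val_eq_iff.1 ?_ i hi
  set cx := mkCtx (matList W) x.inst.1 s t with hcx
  have hL : cx.2.1.length = k := by rw [hcx, hx]; exact length_bound M
  have hv : cx.2.2.2.2 = List.ofFn vr := by rw [hcx, hx]; exact verts_matList W M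
  have hz : toPoly cx.1 = X ^ (x.n * x.n) := by rw [hcx, hx]; exact toPoly_marker M
  obtain ⟨hE, hne, hvis⟩ := order_spec x.decomp (dummy := dummyNode x.inst.1)
    (by rw [hx, dummyNode_matList]; simp)
    (fun v => by rw [hx, dummyNode_matList]; simp [bagFn, List.getD_eq_getElem?_getD])
  have hcov : ∀ u v, ((vr u).1 = (vr v).1 ∨ (vr u).2.2.getD (vr v).1 false = true) →
      ∃ e ∈ order (dummyNode x.inst.1) (List.ofFn (nodeRec x.decomp)),
        bagFn x.n e.1 u = true ∧ bagFn x.n e.1 v = true := by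
    intro u v h
    have h1 : ∃ i, u ∈ x.decomp.bag i ∧ v ∈ x.decomp.bag i := by
      rcases h with h | h
      · obtain ⟨i, hi⟩ := x.decomp.exists_mem_bag u
        have : u = v := Fin.ext h
        exact ⟨i, hi, this ▸ hi⟩
      · simp only [vr, M, getD_ofFn, decide_eq_true_eq] at h
        exact x.decomp.exists_edge_bag u v h
    obtain ⟨i, hu, hv⟩ := h1
    obtain ⟨e, he, hei⟩ := hvis i
    refine ⟨e, he, ?_⟩
    rw [hei, bagFn_nodeRec, bagFn_nodeRec]
    exact ⟨hu, hv⟩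
  have main := val_messages hL hv hE hne hcov (0, [], .nil)
  rw [← mkNodes_inst] at main
  have h1 : Ideal.Quotient.mk (Ideal.span {X ^ k}) (toPoly (cutPoly (matList W) x.inst s t)) =
      val k (cutPoly (matList W) x.inst s t) := rfl
  rw [h1, cutPoly, ← hcx, val_trunc hL, main, cutSum, ← sum_colorings_eq x.connected, map_sum]
  refine Finset.sum_congr rfl fun c _ => ?_
  -- Vertex factors sit on the diagonal of the product over pairs, where the edge factor is 1
  -- because the graph has no loops.
  have h2 : ∀ u v, facVal k cx (vr u) (vr v) (c u) (c v) =
      Ideal.Quotient.mk (Ideal.span {X ^ k}) ((if u = v then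
        vertWt s t (fun v => toPoly (List.ofFn (W v))) u (c u) else 1) *
        if x.graph.Adj u v then edgeWt (X ^ (x.n * x.n)) (c u) (c v) else 1) := by
    intro u v
    have h3 : (vr u).2.2.getD (vr v).1 false = M u v := getD_ofFn _ _ _
    rw [facVal, val, h3]
    congr 1
    by_cases huv : u = v
    · subst huv
      rw [beq_self_eq_true, cond_true, if_pos rfl, if_neg (x.graph.loopless.irrefl u), mul_one]
      exact toPoly_vertFac s t u _ _
    · have h4 : ((vr u).1 == (vr v).1) = false := beq_false_of_ne fun h => huv (Fin.ext h)
      rw [h4, cond_false, if_neg huv, one_mul]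
      by_cases hadj : x.graph.Adj u v
      · simp only [M, hadj, decide_true, cond_true, if_true]
        rw [toPoly_edgeFac, hz]
      · simp [M, hadj]
  simp only [h2]
  rw [map_mul, map_prod, map_prod, ← Finset.prod_mul_distrib]
  refine Finset.prod_congr rfl fun u _ => ?_
  rw [← map_prod, ← map_mul, Finset.prod_mul_distrib]
  simp

/-- Capping after each doubling is harmless: once the cap is reached, further digits cannot lead
below it. -/
theorem length_unary (cap : List Bool) (k : ℕ) :
    (unary cap k.bits).length = min k cap.length := by
  have key (b : Bool) (kb : List Bool) (m : ℕ) (h : (unary cap kb).length = min m cap.length) :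
      (unary cap (b :: kb)).length = min (Nat.bit b m) cap.length := by
    unfold unary at h ⊢
    rw [List.foldl_reverse] at h ⊢
    rw [List.foldr_cons, trunc_eq_take, List.length_take, List.length_append, List.length_append, h]
    cases b <;> simp [Nat.bit] <;> omega
  induction k using Nat.binaryRec' with
  | zero => simp [unary]
  | bit b n h ih =>
    rw [Nat.bits_append_bit n b h]
    exact key b _ n ih

theorem any_drop_iff (p : List Bool) (m : ℕ) :
    ((p.drop m).any fun b => b) = true ↔ ∃ i ≥ m, (toPoly p).coeff i ≠ 0 := by
  simp only [coeff_toPoly, ne_eq, ite_eq_right_iff, one_ne_zero, imp_false, not_not]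
  rw [List.any_eq_true]
  constructor
  · rintro ⟨b, hb, rfl⟩
    obtain ⟨i, he⟩ := List.mem_iff_getElem?.1 hb
    rw [List.getElem?_drop] at he
    exact ⟨m + i, by omega, by rw [List.getD_eq_getElem?_getD, he]; rfl⟩
  · rintro ⟨i, hi, h⟩
    refine ⟨true, ?_, rfl⟩
    rw [List.mem_iff_getElem?]
    refine ⟨i - m, ?_⟩
    rw [List.getElem?_drop, Nat.add_sub_cancel' hi]
    rw [List.getD_eq_getElem?_getD] at h
    cases h' : p[i]? <;> simp_all

/-- Degrees from n²k on belong to cuts of size at least k. The cap n² + 1 exceeds every cut size,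
and n²(n² + 1) is the length of the truncation, so for larger `x.k` no coefficient is left and the
test rejects. -/
theorem stTest_iff (x : CutInput) (W : Fin x.n → Fin x.n → Bool) (s t : Fin x.n) :
    stTest (matList W) x.inst s t = true ↔ ∃ i < x.n * x.n * (x.n * x.n) + x.n * x.n,
      x.n * x.n * min x.k (x.n * x.n + 1) ≤ i ∧
      (cutSum x.graph s t fun v => toPoly (List.ofFn (W v))).coeff i ≠ 0 := by
  classical
  let M : Fin x.n → Fin x.n → Bool := fun i j => decide (x.graph.Adj i j)
  have hx : x.inst.1 = matList M := by
    simp only [CutInput.inst, M]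
  have h1 : ((unary (zeros x.inst.1 ++ [false]) x.inst.2.2.2).flatMap
      fun _ => zeros x.inst.1).length = x.n * x.n * min x.k (x.n * x.n + 1) := by
    rw [hx, map_const_flatMap (n := x.n * x.n) _ _ fun _ => zeros_matList M]
    have := length_unary (zeros (matList M) ++ [false]) x.k
    simp only [zeros_matList, List.length_append, List.length_replicate, List.length_cons,
      List.length_nil] at this ⊢
    rw [mul_comm]
    exact congrArg _ this
  rw [stTest, h1, any_drop_iff]
  constructor
  · rintro ⟨i, hi, hc⟩
    have hlt : i < x.n * x.n * (x.n * x.n) + x.n * x.n := by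
      by_contra hge
      have h2 : (cutPoly (matList W) x.inst s t).length ≤ x.n * x.n * (x.n * x.n) + x.n * x.n := by
        refine (length_trunc_le _ _).trans (le_of_eq ?_)
        rw [hx]
        exact length_bound M
      rw [coeff_toPoly, List.getD_eq_default _ _ (by omega)] at hc
      simp at hc
    exact ⟨i, hlt, hi, by rwa [coeff_cutPoly x W s t hlt] at hc⟩
  · rintro ⟨i, hlt, hi, hc⟩
    exact ⟨i, hi, by rwa [coeff_cutPoly x W s t hlt]⟩

theorem natDegree_toPoly_le (p : List Bool) : (toPoly p).natDegree ≤ p.length - 1 := by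
  rw [natDegree_le_iff_coeff_eq_zero]
  intro i hi
  rw [coeff_toPoly, List.getD_eq_default _ _ (by omega)]
  simp

/-- At most n factors of degree at most n - 1 give n(n - 1) < n², so the weights of a cut never
spill into the block of the next cut size. -/
theorem natDegree_weights_lt {n : ℕ} (hn : 0 < n) (W : Fin n → Fin n → Bool) (S : Fin n → Bool) :
    (∏ v, (if S v then toPoly (List.ofFn (W v)) else 1)).natDegree < n * n := by
  refine lt_of_le_of_lt (natDegree_prod_le _ _) ?_
  have h1 : ∀ v ∈ Finset.univ, (if S v then toPoly (List.ofFn (W v)) else 1).natDegree ≤ n - 1 := by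
    intro v _
    split_ifs
    · simpa using natDegree_toPoly_le (List.ofFn (W v))
    · simp
  refine lt_of_le_of_lt (Finset.sum_le_card_nsmul _ _ _ h1) ?_
  simp only [Finset.card_univ, Fintype.card_fin, smul_eq_mul]
  exact Nat.mul_lt_mul_of_pos_left (by omega) hn

theorem card_cutPairs_le {n : ℕ} (G : SimpleGraph (Fin n)) (S : Fin n → Bool) :
    (cutPairs G S).card ≤ n * n := by
  refine (Finset.card_le_univ _).trans ?_
  simp

open scoped Classical in
/-- The generating polynomial of the minimal cuts of a given size. -/
noncomputable def sizeSum {n : ℕ} (G : SimpleGraph (Fin n)) (s t : Fin n) (m : ℕ)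
    (w : Fin n → (ZMod 2)[X]) : (ZMod 2)[X] :=
  ∑ S ∈ (minCuts G s t).filter fun S => (cutPairs G S).card = m, ∏ v, (if S v then w v else 1)

/-- A cut of size c occupies only degrees from n²c up to n²c + n² - 1, so the coefficients in block
`m` come from the cuts of size `m` alone. -/
theorem coeff_cutSum {n : ℕ} (hn : 0 < n) (G : SimpleGraph (Fin n)) (s t : Fin n)
    (W : Fin n → Fin n → Bool) (m j : ℕ) (hj : j < n * n) :
    (cutSum G s t fun v => toPoly (List.ofFn (W v))).coeff (n * n * m + j) =
      (sizeSum G s t m fun v => toPoly (List.ofFn (W v))).coeff j := by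
  classical
  rw [cutSum, sizeSum, finsetSum_coeff, finsetSum_coeff, Finset.sum_filter]
  refine Finset.sum_congr rfl fun S _ => ?_
  have hd := natDegree_weights_lt hn W S
  rw [← pow_mul]
  split_ifs with h
  · rw [h, add_comm, coeff_X_pow_mul]
  · rcases lt_or_gt_of_ne h with h | h
    · obtain ⟨d, rfl⟩ := Nat.exists_eq_add_of_lt h
      rw [show n * n * ((cutPairs G S).card + d + 1) + j =
        (n * n * (d + 1) + j) + n * n * (cutPairs G S).card by ring, coeff_X_pow_mul]
      refine coeff_eq_zero_of_natDegree_lt (lt_of_lt_of_le hd ?_)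
      rw [mul_add]
      omega
    · rw [coeff_X_pow_mul', if_neg]
      have : n * n * (m + 1) ≤ n * n * (cutPairs G S).card := Nat.mul_le_mul_left _ h
      rw [mul_add] at this
      omega

/-- The test accepts only if there is a large minimal cut. -/
theorem stTest_sound (x : CutInput) (W : Fin x.n → Fin x.n → Bool) (s t : Fin x.n)
    (h : stTest (matList W) x.inst s t = true) : ∃ S : Set (Fin x.n), s ∈ S ∧ t ∉ S ∧
      IsMinimalCut x.graph S ∧ x.k ≤ (cutset x.graph S).ncard := by
  classical
  have hn : 0 < x.n := s.pos
  obtain ⟨i, hlt, hi, hc⟩ := (stTest_iff x W s t).1 h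
  have hn2 : 0 < x.n * x.n := Nat.mul_pos hn hn
  rw [← Nat.div_add_mod i (x.n * x.n), coeff_cutSum hn _ _ _ _ _ _ (Nat.mod_lt _ hn2), sizeSum,
    finsetSum_coeff] at hc
  obtain ⟨S, hS, -⟩ := Finset.exists_ne_zero_of_sum_ne_zero hc
  rw [Finset.mem_filter, minCuts, Finset.mem_filter] at hS
  obtain ⟨⟨-, h1, h2, h3⟩, h4⟩ := hS
  refine ⟨{v | S v = true}, h1, by simp [h2], h3, ?_⟩
  rw [ncard_cutset, h4]
  have h5 : min x.k (x.n * x.n + 1) ≤ i / (x.n * x.n) := by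
    rw [Nat.le_div_iff_mul_le hn2, mul_comm]
    exact hi
  -- The cut has at most n² edges, so the minimum in `h5` is not the cap n² + 1 and must be `x.k`.
  have h6 := card_cutPairs_le x.graph S
  omega

/-- The test accepts if the weights do not annihilate the minimal cuts of some large size. -/
theorem stTest_complete (x : CutInput) (W : Fin x.n → Fin x.n → Bool) (s t : Fin x.n) {m : ℕ}
    (hm : x.k ≤ m) (h : sizeSum x.graph s t m (fun v => toPoly (List.ofFn (W v))) ≠ 0) :
    stTest (matList W) x.inst s t = true := by
  classical
  have hn : 0 < x.n := s.pos
  have hn2 : 0 < x.n * x.n := Nat.mul_pos hn hn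
  obtain ⟨j, hj⟩ : ∃ j, (sizeSum x.graph s t m
      (fun v => toPoly (List.ofFn (W v)))).coeff j ≠ 0 := by
    by_contra! h'
    exact h (Polynomial.ext h')
  have hj' := hj
  rw [sizeSum, finsetSum_coeff] at hj'
  obtain ⟨S, hS, hSj⟩ := Finset.exists_ne_zero_of_sum_ne_zero hj'
  have hlt : j < x.n * x.n := lt_of_le_of_lt (le_natDegree_of_ne_zero hSj)
    (natDegree_weights_lt hn W S)
  have hmn : m ≤ x.n * x.n := (Finset.mem_filter.1 hS).2 ▸ card_cutPairs_le x.graph S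
  refine (stTest_iff x W s t).2 ⟨x.n * x.n * m + j, ?_, ?_, ?_⟩
  · have := Nat.mul_le_mul_left (x.n * x.n) hmn
    omega
  · have := Nat.mul_le_mul_left (x.n * x.n) ((min_le_left x.k (x.n * x.n + 1)).trans hm)
    omega
  · rwa [coeff_cutSum hn _ _ _ _ _ _ hlt]

end

/-! ## The probability of an error -/

section

open Polynomial

theorem toPoly_ofFn_injective (n : ℕ) :
    Function.Injective fun f : Fin n → Bool => toPoly (List.ofFn f) := by
  intro f g h
  funext i
  have h1 := congrArg (fun p => p.coeff i) h
  simp only [coeff_toPoly, getD_ofFn] at h1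
  cases hf : f i <;> cases hg : g i <;> simp_all

/-- At least half of all weights do not annihilate the minimal cuts of a given size. -/
theorem card_annihilating_le {n : ℕ} (G : SimpleGraph (Fin n)) (s t : Fin n) (m : ℕ)
    (hne : ((minCuts G s t).filter fun S => (cutPairs G S).card = m).Nonempty) :
    2 * (Finset.univ.filter fun W : Fin n → Fin n → Bool =>
      sizeSum G s t m (fun v => toPoly (List.ofFn (W v))) = 0).card ≤ 2 ^ (n * n) := by
  classical
  -- The weights become indeterminates. Different cuts have different monomials, all with
  -- coefficient 1, so `p` cannot vanish.
  let p : MvPolynomial (Fin n) (ZMod 2)[X] :=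
    ∑ S ∈ (minCuts G s t).filter fun S => (cutPairs G S).card = m,
      MvPolynomial.monomial (Finsupp.equivFunOnFinite.symm fun v => if S v then 1 else 0) 1
  have hp : p ≠ 0 := by
    obtain ⟨S, hS⟩ := hne
    intro h
    have h1 := congrArg (MvPolynomial.coeff
      (Finsupp.equivFunOnFinite.symm fun v => if S v then 1 else 0)) h
    rw [MvPolynomial.coeff_sum, Finset.sum_eq_single S] at h1
    · simp at h1
    · intro S' _ hS'
      rw [MvPolynomial.coeff_monomial, if_neg]
      intro h2
      apply hS'
      have h3 := Finsupp.equivFunOnFinite.symm.injective h2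
      funext v
      have h4 := congrFun h3 v
      cases h5 : S v <;> cases h6 : S' v <;> simp_all
    · exact fun h => absurd hS h
  have hdeg : p.totalDegree ≤ n := by
    refine MvPolynomial.totalDegree_finsetSum_le fun S _ => ?_
    refine (MvPolynomial.totalDegree_monomial_le _ _).trans ?_
    rw [Finsupp.sum_fintype _ _ fun _ => rfl]
    simp only [id]
    refine (Finset.sum_le_card_nsmul _ _ 1 fun v _ => ?_).trans (by simp)
    simp only [Finsupp.equivFunOnFinite_symm_apply_apply]
    split_ifs <;> simp
  have heval : ∀ w, MvPolynomial.eval w p = sizeSum G s t m w := by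
    intro w
    rw [sizeSum, map_sum]
    refine Finset.sum_congr rfl fun S _ => ?_
    rw [MvPolynomial.eval_monomial, one_mul, Finsupp.prod_fintype _ _ fun v => pow_zero _]
    refine Finset.prod_congr rfl fun v _ => ?_
    simp only [Finsupp.equivFunOnFinite_symm_apply_apply]
    split_ifs <;> simp
  have hinj := toPoly_ofFn_injective n
  -- F_2 itself has too few elements for Schwartz-Zippel; the domain F_2[X] offers the 2^n
  -- polynomials of degree less than n as values.
  let A : Finset (ZMod 2)[X] := Finset.univ.image fun f : Fin n → Bool => toPoly (List.ofFn f)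
  have hA : A.card = 2 ^ n := by
    rw [Finset.card_image_of_injective _ hinj]
    simp
  have hsz := MvPolynomial.schwartz_zippel_totalDegree hp A
  rw [hA] at hsz
  have hcard : (Finset.univ.filter fun W : Fin n → Fin n → Bool =>
      sizeSum G s t m (fun v => toPoly (List.ofFn (W v))) = 0).card ≤
      ((Fintype.piFinset fun _ => A).filter fun f => MvPolynomial.eval f p = 0).card := by
    refine Finset.card_le_card_of_injOn (fun W v => toPoly (List.ofFn (W v))) ?_ ?_
    · intro W hW
      simp only [Finset.coe_filter, Finset.mem_univ, true_and, Set.mem_ofPred_eq,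
        Fintype.mem_piFinset, A, Finset.mem_image] at hW ⊢
      exact ⟨fun v => ⟨W v, rfl⟩, by rw [heval, hW]⟩
    · intro W _ W' _ h
      funext v
      exact hinj (congrFun h v)
  set N := ((Fintype.piFinset fun _ : Fin n => A).filter
    fun f => MvPolynomial.eval f p = 0).card with hN
  -- The fraction of zeros is at most n / 2^n, and this inequality, valid for n ≥ 1, makes it at
  -- most one half.
  have hn : 2 * n ≤ 2 ^ n := by
    have hpos : 0 < n := s.pos
    obtain ⟨k, rfl⟩ := Nat.exists_eq_succ_of_ne_zero hpos.ne'
    have := Nat.lt_two_pow_self (n := k)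
    rw [pow_succ]
    omega
  have h2n : (0 : ℚ≥0) < 2 ^ n := by positivity
  push_cast at hsz
  rw [div_le_div_iff₀ (by positivity) h2n, ← pow_mul] at hsz
  have h3 : N * 2 ^ n ≤ p.totalDegree * 2 ^ (n * n) := by exact_mod_cast hsz
  have h4 : 2 * N * 2 ^ n ≤ 2 ^ (n * n) * 2 ^ n := by
    calc 2 * N * 2 ^ n = 2 * (N * 2 ^ n) := by ring
      _ ≤ 2 * (n * 2 ^ (n * n)) :=
        Nat.mul_le_mul_left 2 (h3.trans (Nat.mul_le_mul_right _ hdeg))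
      _ = (2 * n) * 2 ^ (n * n) := by ring
      _ ≤ 2 ^ n * 2 ^ (n * n) := by gcongr
      _ = _ := by ring
  have h5 := Nat.le_of_mul_le_mul_right h4 (by positivity)
  exact (Nat.mul_le_mul_left 2 hcard).trans h5

end

/-- The weights that are read off a sequence of coin tosses. -/
def coinWeights (n : ℕ) (ω : ℕ → Bool) (i j : Fin n) : Bool := ω (i * n + j)

open MeasureTheory in
theorem coinMeasure_coinWeights (n : ℕ) (r : Fin n → Fin n → Bool) :
    coinMeasure {ω | coinWeights n ω = r} = (2⁻¹ : ENNReal) ^ (n * n) := by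
  classical
  -- Division with remainder inverts `(i, j) ↦ i * n + j`, so the event prescribes exactly the first
  -- n² coins.
  let b : ℕ → Bool := fun k =>
    if h : k / n < n ∧ k % n < n then r ⟨k / n, h.1⟩ ⟨k % n, h.2⟩ else false
  have h1 : {ω | coinWeights n ω = r} =
      Set.pi (Finset.range (n * n)) fun k => ({b k} : Set Bool) := by
    ext ω
    simp only [Set.mem_ofPred_eq, Set.mem_pi, Finset.coe_range, Set.mem_Iio, Set.mem_singleton_iff]
    constructor
    · rintro rfl k hk
      have hn : 0 < n := Nat.pos_of_mul_pos_right (Nat.zero_lt_of_lt hk)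
      have h2 : k / n < n ∧ k % n < n := ⟨Nat.div_lt_of_lt_mul hk, Nat.mod_lt _ hn⟩
      simp only [b, dif_pos h2, coinWeights]
      rw [Nat.div_add_mod']
    · intro h
      funext i j
      have hlt : (i : ℕ) * n + j < n * n := by
        have := Nat.mul_le_mul_right n (Nat.succ_le_of_lt i.2)
        rw [Nat.succ_mul] at this
        omega
      have hd : ((i : ℕ) * n + j) / n = i := by
        rw [mul_comm, Nat.mul_add_div i.pos, Nat.div_eq_of_lt j.2, add_zero]
      have hm : ((i : ℕ) * n + j) % n = j := by
        rw [mul_comm, Nat.mul_add_mod, Nat.mod_eq_of_lt j.2]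
      rw [coinWeights, h _ hlt]
      simp [b, hd, hm]
  rw [h1, coinMeasure, Measure.infinitePi_pi _ fun _ _ => MeasurableSet.singleton _]
  simp

open MeasureTheory in
theorem coinMeasure_annihilating_le {n : ℕ} (G : SimpleGraph (Fin n)) (s t : Fin n) (m : ℕ)
    (hne : ((minCuts G s t).filter fun S => (cutPairs G S).card = m).Nonempty) :
    coinMeasure {ω | sizeSum G s t m (fun v => toPoly (List.ofFn (coinWeights n ω v))) = 0} ≤
      1 / 2 := by
  classical
  set B := Finset.univ.filter fun W : Fin n → Fin n → Bool =>
      sizeSum G s t m (fun v => toPoly (List.ofFn (W v))) = 0 with hB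
  have h1 : {ω | sizeSum G s t m (fun v => toPoly (List.ofFn (coinWeights n ω v))) = 0} ⊆
      ⋃ r ∈ B, {ω | coinWeights n ω = r} := by
    intro ω hω
    simp only [Set.mem_iUnion]
    exact ⟨coinWeights n ω, by simpa [hB] using hω, rfl⟩
  refine (measure_mono h1).trans ((measure_biUnion_finset_le _ _).trans ?_)
  simp only [coinMeasure_coinWeights, Finset.sum_const, nsmul_eq_mul]
  have h2 := card_annihilating_le G s t m hne
  rw [← hB] at h2
  rw [ENNReal.le_div_iff_mul_le (by simp) (by simp), mul_right_comm, ← ENNReal.inv_pow,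
    ← div_eq_mul_inv]
  refine ENNReal.div_le_of_le_mul ?_
  rw [one_mul, mul_comm]
  exact_mod_cast h2

/-! ## The algorithms -/

theorem Data.size_pos (d : Data) : 0 < d.size := by cases d <;> simp [Data.size]

theorem sz_bool_le_size (b : Bool) : sz b ≤ (enc b).size := by
  cases b <;> decide

theorem sz_nat_le_size (n : ℕ) : sz n ≤ (enc n).size := by
  show n ≤ (Data.ofList (List.replicate n Data.nil)).size
  induction n with
  | zero => exact Nat.zero_le _
  | succ n ih =>
    rw [List.replicate_succ, Data.ofList, Data.size]
    omega

theorem sz_list_le_size {α : Type} [Enc α] (h : ∀ a : α, sz a ≤ (enc a).size) (l : List α) :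
    sz l ≤ (enc l).size := by
  show (l.map fun a => sz a + 1).sum ≤ (Data.ofList (l.map enc)).size
  induction l with
  | nil => exact Nat.zero_le _
  | cons a l ih =>
    rw [List.map_cons, List.sum_cons, List.map_cons, Data.ofList, Data.size]
    have := h a
    omega

theorem sz_prod_le_size {α β : Type} [Enc α] [Enc β] (h : ∀ a : α, sz a ≤ (enc a).size)
    (h' : ∀ b : β, sz b ≤ (enc b).size) (p : α × β) : sz p ≤ (enc p).size := by
  show sz p.1 + sz p.2 ≤ (Data.cons (enc p.1) (enc p.2)).size
  rw [Data.size]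
  have := h p.1
  have := h' p.2
  omega

theorem sz_inst_le_size (x : Inst) : sz x ≤ (enc x).size := by
  have h := sz_list_le_size (sz_list_le_size sz_bool_le_size)
  exact sz_prod_le_size h (sz_prod_le_size h (sz_prod_le_size h
    (sz_list_le_size sz_bool_le_size))) x

theorem enc_matList {a b : ℕ} (M : Fin a → Fin b → Bool) :
    enc (matList M) = .ofList (List.ofFn fun i => .ofList (List.ofFn fun j => .ofBool (M i j))) := by
  show Data.ofList ((matList M).map fun l => Data.ofList (l.map Data.ofBool)) = _
  simp only [matList, List.map_ofFn, Function.comp_def]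

theorem enc_inst (x : CutInput) : enc x.inst = x.encode := by
  show Data.cons (enc x.inst.1) (.cons (enc x.inst.2.1)
    (.cons (enc x.inst.2.2.1) (enc x.inst.2.2.2))) = _
  simp only [CutInput.inst, enc_matList, CutInput.encode, Data.ofMatrix]
  congr!

theorem foldr_max_le {l : List ℕ} {m : ℕ} (h : ∀ a ∈ l, a ≤ m) : l.foldr max 0 ≤ m := by
  induction l with
  | nil => exact Nat.zero_le _
  | cons a l ih =>
    exact max_le (h a (by simp)) (ih fun b hb => h b (by simp [hb]))

/-- The exponent produced by the algorithm is the size of a bag, one more than the width allows; the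
extra factor 4 goes into the constant of the time bound. -/
theorem maxBag_inst_le (x : CutInput) : maxBag x.inst.2.2.1 ≤ x.decomp.width + 1 := by
  classical
  refine foldr_max_le fun a ha => ?_
  obtain ⟨b, hb, rfl⟩ := List.mem_map.1 ha
  obtain ⟨i, rfl⟩ := (List.mem_ofFn' _ _).1 hb
  have h1 : (List.ofFn fun v => decide (v ∈ x.decomp.bag i)).countP (fun a => a) =
      (x.decomp.bag i).card := by
    rw [List.ofFn_eq_map, List.countP_map]
    rw [List.countP_eq_length_filter, ← List.toFinset_card_of_nodup ((List.nodup_finRange _).filter _)]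
    congr 1
    ext v
    simp
  have h2 := Finset.le_sup (f := fun i => (x.decomp.bag i).card) (Finset.mem_univ i)
  rw [TreeDecomposition.width]
  refine le_trans (le_of_eq ?_) (h2.trans (by omega))
  rw [← h1]

theorem flatten_coinWeights (n : ℕ) (ω : ℕ → Bool) :
    (matList (coinWeights n ω)).flatten = (List.range (n * n)).map ω := by
  rw [range_eq_ofFn, List.map_ofFn, List.ofFn_mul]
  rfl

/-- A test with random weights yields a Monte-Carlo algorithm. -/
theorem exists_monteCarlo {ι : Type*} {β : Type} [Enc β] (X : ι → CutInput) (inp : ι → β)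
    (code : ι → Data) (yes : ι → Prop) {e : β → ℕ} {f : List (List Bool) × β → Bool}
    {M : β → List (List Bool)} (hf : XT (fun p => e p.2) f) (hM : PT M)
    (hsz : ∀ b : β, sz b ≤ (enc b).size) (hcode : ∀ x, enc (inp x) = code x)
    (he : ∀ x, e (inp x) = maxBag (X x).inst.2.2.1) (hMX : ∀ x, M (inp x) = (X x).inst.1)
    (sound : ∀ x W, f (matList (a := (X x).n) (b := (X x).n) W, inp x) = true → yes x)
    (complete : ∀ x, yes x →
      coinMeasure {ω | f (matList (coinWeights (X x).n ω), inp x) = false} ≤ 1 / 2) :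
    ∃ (P : Program) (C d : ℕ), IsOneSidedMonteCarlo P code yes
      fun x => C * 4 ^ (X x).decomp.width * (code x).size ^ d := by
  obtain ⟨P, g, ⟨k, hg⟩, hP⟩ := hf.exists_program hM
  -- The factor 4 pays for bags of size width + 1. The factor `3 ^ k` arises from `sz + 2 ≤ 3 *
  -- size`, as the code of an input has at least one node.
  have run (x : ι) (ω : ℕ → Bool) : ∃ t ≤ 4 * 3 ^ k * 4 ^ (X x).decomp.width * (code x).size ^ k,
      Outputs P (code x) ω (.ofBool (f (matList (coinWeights (X x).n ω), inp x))) t := by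
    obtain ⟨t, ht, hev⟩ := hP (inp x) (matList (coinWeights (X x).n ω)) (by
      rw [hMX]
      simp [CutInput.inst, matList, List.map_ofFn, Function.comp_def])
    refine ⟨t, ht.trans ?_, (X x).n * (X x).n, ?_⟩
    · have h1 : g (inp x) ≤ (3 * (code x).size) ^ k := by
        refine (hg _).trans (Nat.pow_le_pow_left ?_ k)
        have h2 := hsz (inp x)
        have h3 := (code x).size_pos
        rw [hcode] at h2
        omega
      have h4 : 4 ^ e (inp x) ≤ 4 ^ ((X x).decomp.width + 1) :=
        Nat.pow_le_pow_right (by norm_num) ((he x).trans_le (maxBag_inst_le _))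
      refine (Nat.mul_le_mul h4 h1).trans (le_of_eq ?_)
      rw [mul_pow, pow_succ]
      ring
    · rw [← hcode, ← flatten_coinWeights]
      exact hev
  refine ⟨P, 4 * 3 ^ k, k, fun x => ⟨fun ω => ?_, fun hno ω t hout => hno ?_, fun hyes => ?_⟩⟩
  · obtain ⟨t, ht, h⟩ := run x ω
    exact ⟨_, t, h, ht⟩
  · obtain ⟨t', -, h⟩ := run x ω
    refine sound x (coinWeights (X x).n ω) ?_
    have h1 := hout.unique h
    cases h2 : f (matList (coinWeights (X x).n ω), inp x)
    · rw [h2] at h1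
      cases h1
    · rfl
  · refine (MeasureTheory.measure_mono ?_).trans (complete x hyes)
    rintro ω ⟨t, hout⟩
    obtain ⟨t', -, h⟩ := run x ω
    have h1 := hout.unique h
    cases h2 : f (matList (coinWeights (X x).n ω), inp x)
    · exact h2
    · rw [h2] at h1
      cases h1

/-- The test misses a large minimal cut with probability at most one half. -/
theorem coinMeasure_stTest_eq_false_le (x : CutInput) (s t : Fin x.n) {S : Set (Fin x.n)}
    (hs : s ∈ S) (ht : t ∉ S) (hS : IsMinimalCut x.graph S) (hk : x.k ≤ (cutset x.graph S).ncard) :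
    coinMeasure {ω | stTest (matList (coinWeights x.n ω)) x.inst s t = false} ≤ 1 / 2 := by
  classical
  have hS' : S = {v | decide (v ∈ S) = true} := by
    ext v
    simp
  refine (MeasureTheory.measure_mono ?_).trans (coinMeasure_annihilating_le x.graph s t
    (cutPairs x.graph fun v => decide (v ∈ S)).card ⟨fun v => decide (v ∈ S), ?_⟩)
  · intro ω hω
    by_contra h
    rw [hS', ncard_cutset] at hk
    have h1 := stTest_complete x (coinWeights x.n ω) s t hk h
    rw [Set.mem_ofPred_eq, h1] at hω
    cases hω
  · rw [Finset.mem_filter, minCuts, Finset.mem_filter, ← hS']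
    simp [hs, ht, hS]

/-- Minimality and size of a cut depend on the cutset only, so the two sides may be exchanged; this
lets vertex 0 play the role of `s`. -/
theorem cutset_compl {V : Type*} (G : SimpleGraph V) (S : Set V) : cutset G Sᶜ = cutset G S := by
  ext e
  constructor
  · rintro ⟨u, v, hu, hv, h, rfl⟩
    exact ⟨v, u, not_not.1 hv, hu, h.symm, Sym2.eq_swap⟩
  · rintro ⟨u, v, hu, hv, h, rfl⟩
    exact ⟨v, u, hv, not_not.2 hu, h.symm, Sym2.eq_swap⟩

theorem cutTest_sound (x : CutInput) (W : Fin x.n → Fin x.n → Bool)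
    (h : cutTest (matList W) x.inst = true) : x.HasMinimalCut := by
  rw [cutTest, Bool.or_eq_true] at h
  rcases h with h | h
  · have hk : x.k = 0 := by
      have h1 : x.k.bits = [] := List.isEmpty_iff.1 h
      simpa [Nat.size_eq_bits_len, Nat.size_eq_zero] using congrArg List.length h1
    -- For k = 0 the empty set is a solution: nothing is properly contained in its empty cutset.
    refine ⟨∅, fun S' _ h' => ?_, by simp [hk]⟩
    have h1 : cutset x.graph ∅ = ∅ := by
      ext e
      simp [cutset]
    rw [h1] at h'
    exact not_lt_bot h'
  · rw [List.any_eq_true] at h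
    obtain ⟨t, ht, h⟩ := h
    have htn : t < x.n := by
      simpa [CutInput.inst, matList] using ht
    obtain ⟨S, -, -, h1, h2⟩ := stTest_sound x W ⟨0, Nat.zero_lt_of_lt htn⟩ ⟨t, htn⟩ h
    exact ⟨S, h1, h2⟩

/-- One suitable `t` is enough for acceptance, so the disjunction errs no more often than that
single test, and the same random weights can serve for all `t`. -/
theorem coinMeasure_cutTest_eq_false_le (x : CutInput) (h : x.HasMinimalCut) :
    coinMeasure {ω | cutTest (matList (coinWeights x.n ω)) x.inst = false} ≤ 1 / 2 := by
  obtain ⟨S, hS, hk⟩ := h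
  rcases Nat.eq_zero_or_pos x.k with h0 | hpos
  · have h1 : ∀ ω, cutTest (matList (coinWeights x.n ω)) x.inst = true := by
      intro ω
      simp [cutTest, CutInput.inst, h0]
    simp [h1]
  have hn : 0 < x.n := by
    obtain ⟨v⟩ := x.connected.nonempty
    exact v.pos
  let z : Fin x.n := ⟨0, hn⟩
  obtain ⟨S, hz, hS, hk⟩ : ∃ S : Set (Fin x.n), z ∈ S ∧ IsMinimalCut x.graph S ∧
      x.k ≤ (cutset x.graph S).ncard := by
    by_cases hz : z ∈ S
    · exact ⟨S, hz, hS, hk⟩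
    · refine ⟨Sᶜ, hz, ?_, ?_⟩
      · rw [IsMinimalCut, cutset_compl]
        exact hS
      · rwa [cutset_compl]
  -- Since k is positive the cut has an edge, and the end of it outside `S` is a vertex `t` for
  -- which the test is likely to succeed.
  obtain ⟨e, u, t, -, ht, -, -⟩ : (cutset x.graph S).Nonempty := by
    by_contra he
    rw [Set.not_nonempty_iff_eq_empty.1 he, Set.ncard_empty] at hk
    omega
  refine (MeasureTheory.measure_mono ?_).trans
    (coinMeasure_stTest_eq_false_le x z t hz ht hS hk)
  intro ω hω
  rw [Set.mem_ofPred_eq, cutTest, Bool.or_eq_false_iff, List.any_eq_false] at hω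
  have h1 := hω.2 t (by simp [CutInput.inst, matList])
  rw [Set.mem_ofPred_eq]
  exact Bool.eq_false_of_not_eq_true h1

theorem mainTheorem6 :
    (∃ (P : Program) (C d : ℕ),
      IsOneSidedMonteCarlo P CutInput.encode CutInput.HasMinimalCut
        (fun x => C * 4 ^ x.decomp.width * x.encode.size ^ d)) ∧
    (∃ (P : Program) (C d : ℕ),
      IsOneSidedMonteCarlo P STCutInput.encode STCutInput.HasMinimalSTCut
        (fun x => C * 4 ^ x.decomp.width * x.encode.size ^ d)) := by
  constructor
  · exact exists_monteCarlo id CutInput.inst _ _ (e := fun x : Inst => maxBag x.2.2.1)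
      (M := fun x => x.1) XT.cutTest (by fun_prop) sz_inst_le_size enc_inst (fun _ => rfl)
      (fun _ => rfl) cutTest_sound coinMeasure_cutTest_eq_false_le
  · exact exists_monteCarlo STCutInput.toCutInput
      (fun x => ((x.s : ℕ), (x.t : ℕ), x.toCutInput.inst)) _ _
      (e := fun x : ℕ × ℕ × Inst => maxBag x.2.2.2.2.1) (M := fun x => x.2.2.1) XT.stTest
      (by fun_prop)
      (sz_prod_le_size sz_nat_le_size (sz_prod_le_size sz_nat_le_size sz_inst_le_size))
      (fun x => congrArg (fun d => Data.cons _ (.cons _ d)) (enc_inst x.toCutInput))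
      (fun _ => rfl) (fun _ => rfl) (fun x W h => stTest_sound x.toCutInput W x.s x.t h)
      fun x ⟨_, hs, ht, hS, hk⟩ => coinMeasure_stTest_eq_false_le x.toCutInput x.s x.t hs ht hS hk
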